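/- Let $\Gamma\subset \mathrm{PSL}(2,\mathbb C)$ be a marked, normalized quasi-Fuchsian group of type $(g,n;m_1,\dots,m_r)$, $m_j\ge 2$, with $2g-2+n+\sum_j(1-1/m_j)>0$ and $3g-3+n+r>0$; parabolic generators ($n>0$) and elliptic generators ($r>0$) are allowed. That is, there are quasiconformal homeomorphisms $J_1,J_2$ of $\hat{\mathbb C}$ fixing $0,1,\infty$, with $J_1$ holomorphic on the upper half plane $\mathbb U$, $J_2$ holomorphic on the lower half plane $\mathbb L$, $J_i(\mathbb U)=\Omega_1$, $J_i(\mathbb L)=\Omega_2$, such that $\Gamma_i=J_i^{-1}\Gamma J_i$ are discrete cofinite subgroups of $\mathrm{PSL}(2,\mathbb R)$ with standard presentations: hyperbolic generators $\alpha_k,\beta_k$ ($k\le g$), parabolic generators $\kappa_i$ ($i\le n$), elliptic generators $\tau_j$ of order $m_j$ ($j\le r$), and the relations $\prod_k[\alpha_k,\beta_k]\,\kappa_1\cdots\kappa_n\tau_1\cdots\tau_r=1$, $\tau_j^{m_j}=1$. The group $\Gamma_1$ is normalized: either $g\ge1$, the attracting and repelling fixed points of $\alpha_1$ are $0,\infty$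 and the attracting fixed point of $\beta_1$ is $1$; or $0,1,\infty$ are fixed points of hyperbolic or parabolic elements of $\Gamma_1$ and $0,\infty$ are not $\Gamma_1$-equivalent. Let $$\rho(z)=e^{\varphi(z)}=\frac{|(J_i^{-1})'(z)|^2}{(\operatorname{Im}J_i^{-1}(z))^2},\qquad z\in\Omega_i,\ i=1,2,$$ be the density of the hyperbolic metric on $\Omega_1\sqcup\Omega_2$. (1) $\varphi$ is smooth on $\Omega_1\sqcup\Omega_2$, and for each component $\Omega_i$ and each measurable fundamental domain $F_i$ of $\Gamma$ in $\Omega_i$ the integral $\iint_{F_i}\left(|\varphi_z|^2+e^{\varphi}\right)d^2z$ is finite. (2) The classical Liouville action $S[\varphi]$ is well-defined, in the following sense. Assume that $J_1$ is of class $C^1$ on $\mathbb L$ and Lipschitz there with respect to the hyperbolic metrics of $\mathbb L$ and $\Omega_2$. Let $F\subset\mathbb U$ be a standard fundamental polygon of $\Gamma_1$, with geodesic sides $a_k,a_k',b_k,b_k',c_i,c_i',d_j,d_j'$ such that $\alpha_k(a_k')=a_k$, $\beta_k(b_k')=b_k$, $\kappa_i(c_i')=c_i$, $\tau_j(d_j')=d_j$,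 with positively oriented boundary $$\partial F=\sum_k(a_k+b_k'-a_k'-b_k)+\sum_i(c_i-c_i')+\sum_j(d_j-d_j'),$$ where the terminal points $c_i(1)$ and $d_j(1)$ are the fixed points of $\kappa_i$ and $\tau_j$. Let $P_0,\dots,P_g$ be $\Gamma_1$-contracting paths, $C^1$ away from $0$, from $0$ to $a_1(0)$ if $k=0$ and $g\geq 1$ (to the initial vertex of the boundary if $k=g=0$), and from $0$ to $b_k(0)$ for $1\le k\le g$: $P_k\setminus\{0\}\subset\mathbb U$, and near $0$ the path is $\bigcup_{N\ge0}\gamma^N(I)$ for an arc $I$ and some $\gamma\in\Gamma_1$ fixing $0$. Put $$L=\sum_k(b_k\otimes[\beta_k]-a_k\otimes[\alpha_k])-\sum_i c_i\otimes[\kappa_i]-\sum_j d_j\otimes[\tau_j],$$ and, with $\gamma_k=[\alpha_k,\beta_k]$, $$\begin{aligned}W=&\sum_{k=1}^g\left(P_{k-1}\otimes[\alpha_k|\beta_k]-P_k\otimes[\beta_k|\alpha_k]+P_k\otimes[\gamma_k^{-1}|\alpha_k\beta_k]\right)-\sum_{k=1}^{g-1}P_g\otimes[\gamma_g^{-1}\cdots\gamma_{k+1}^{-1}|\gamma_k^{-1}]\\&+\sum_{i=1}^{n-1}P_g\otimes[\kappa_1\cdots\kappa_i|\kappa_{i+1}]+\sum_{j=0}^{r-1}P_g\otimes[\kappa_1\cdots\kappa_n\tau_1\cdots\tau_j|\tau_{j+1}].\end{aligned}$$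 Let $F_1,L_1,W_1$ be the images under $J_1$ of $F,L,W$, and $F_2,L_2,W_2$ the images under $J_1$ of their complex conjugates (group elements being replaced by the corresponding elements of $\Gamma$). Let $\omega=(|\varphi_z|^2+e^\varphi)\,dz\wedge d\bar z$; for $\gamma\in\Gamma$ with lower left entry $c(\gamma)$ let $$\check\theta_{\gamma^{-1}}=\left(\varphi-\tfrac12\log|\gamma'|^2-2\log2-\log|c(\gamma)|^2\right)\left(\frac{\gamma''}{\gamma'}dz-\frac{\overline{\gamma''}}{\overline{\gamma'}}d\bar z\right)$$ (which is $0$ if $c(\gamma)=0$), and let $\check u=\delta\check\theta$, i.e. $\check u_{\gamma_1^{-1},\gamma_2^{-1}}=\gamma_1^*\check\theta_{\gamma_2^{-1}}-\check\theta_{(\gamma_2\gamma_1)^{-1}}+\check\theta_{\gamma_1^{-1}}$. Then all the integrals in the pairings below converge absolutely, so that $$S[\varphi]=\frac i2\Bigl(\langle\omega,F_1-F_2\rangle-\langle\check\theta,L_1-L_2\rangle+\langle\check u,W_1-W_2\rangle\Bigr)$$ is a well-defined complex number. -/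

import Mathlib

open scoped MatrixGroups ContDiff ComplexConjugate

noncomputable section

namespace Liouville

/-! ### Linear fractional transformations -/

/-- The linear fractional transformation `z ↦ (a z + b) / (c z + d)`. -/
def mob (γ : SL(2, ℂ)) (z : ℂ) : ℂ := (γ 0 0 * z + γ 0 1) / (γ 1 0 * z + γ 1 1)

/-- The derivative `γ'(z) = 1 / (c z + d)²`. -/
def mobDeriv (γ : SL(2, ℂ)) (z : ℂ) : ℂ := 1 / (γ 1 0 * z + γ 1 1) ^ 2

/-- The quotient `γ''(z) / γ'(z) = - 2 c / (c z + d)`. -/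
def mobQuot (γ : SL(2, ℂ)) (z : ℂ) : ℂ := -2 * γ 1 0 / (γ 1 0 * z + γ 1 1)

theorem hasDerivAt_mob (γ : SL(2, ℂ)) (z : ℂ) (h : γ 1 0 * z + γ 1 1 ≠ 0) :
    HasDerivAt (mob γ) (mobDeriv γ z) z := by
  have hdet : γ 0 0 * γ 1 1 - γ 0 1 * γ 1 0 = 1 := by
    have := γ.det_coe
    rwa [Matrix.det_fin_two] at this
  have h1 : HasDerivAt (fun z : ℂ => γ 0 0 * z + γ 0 1) (γ 0 0) z := by
    simpa using ((hasDerivAt_id z).const_mul (γ 0 0)).add_const (γ 0 1)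
  have h2 : HasDerivAt (fun z : ℂ => γ 1 0 * z + γ 1 1) (γ 1 0) z := by
    simpa using ((hasDerivAt_id z).const_mul (γ 1 0)).add_const (γ 1 1)
  have h3 := h1.div h2 h
  have e : (γ 0 0 * (γ 1 0 * z + γ 1 1) - (γ 0 0 * z + γ 0 1) * γ 1 0) /
      (γ 1 0 * z + γ 1 1) ^ 2 = mobDeriv γ z := by
    unfold mobDeriv
    congr 1
    linear_combination hdet
  rw [e] at h3
  exact h3

theorem hasDerivAt_mobDeriv (γ : SL(2, ℂ)) (z : ℂ) (h : γ 1 0 * z + γ 1 1 ≠ 0) :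
    HasDerivAt (mobDeriv γ) (mobQuot γ z * mobDeriv γ z) z := by
  have h2 : HasDerivAt (fun z : ℂ => γ 1 0 * z + γ 1 1) (γ 1 0) z := by
    simpa using ((hasDerivAt_id z).const_mul (γ 1 0)).add_const (γ 1 1)
  have h3 := ((hasDerivAt_const z (1 : ℂ)).div (h2.pow 2) (pow_ne_zero 2 h))
  refine h3.congr_deriv ?_
  simp only [mobQuot, mobDeriv, Pi.pow_apply]
  field_simp
  norm_num
  ring

/-- The inclusion of `SL(2, ℝ)` in `SL(2, ℂ)`. -/
def toC : SL(2, ℝ) →* SL(2, ℂ) := Matrix.SpecialLinearGroup.map Complex.ofRealHom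

/-- The upper half plane, as a subset of `ℂ`. -/
def U : Set ℂ := {z | 0 < z.im}

/-- The lower half plane, as a subset of `ℂ`. -/
def L : Set ℂ := {z | z.im < 0}

/-- Measurable fundamental domains for the action on `Ω ⊆ ℂ` of the image of `Γ` in
`PSL(2, ℂ)`: almost every point of `Ω` has a translate in `F`, and distinct translates of `F`
overlap in a null set. -/
structure IsFundamentalDomain (Γ : Subgroup SL(2, ℂ)) (Ω F : Set ℂ) : Prop where
  subset : F ⊆ Ω
  nullMeasurable : MeasureTheory.NullMeasurableSet F MeasureTheory.volume
  ae_covers : ∀ᵐ z ∂(MeasureTheory.volume : MeasureTheory.Measure ℂ),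
    z ∈ Ω → ∃ γ ∈ Γ, mob γ z ∈ F
  ae_disjoint : ∀ γ ∈ Γ, γ ≠ 1 → γ ≠ -1 →
    MeasureTheory.volume (F ∩ mob γ '' F) = 0

/-! ### Marked Fuchsian groups of type `(g, n; m₁, …, m_r)` -/

/-- Labels of the standard generators: `a k`, `b k` stand for the hyperbolic generators
`α_k`, `β_k`, `c i` for the parabolic generator `κ_i`, `d j` for the elliptic generator `τ_j`. -/
inductive Gen (g n r : ℕ) : Type
  | a (k : Fin g)
  | b (k : Fin g)
  | c (i : Fin n)
  | d (j : Fin r)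

variable {g n r : ℕ}

/-- The word `[α₁, β₁] ⋯ [α_g, β_g] κ₁ ⋯ κ_n τ₁ ⋯ τ_r`. -/
def longWord (g n r : ℕ) : FreeGroup (Gen g n r) :=
  (List.ofFn fun k : Fin g => FreeGroup.of (Gen.a k) * FreeGroup.of (Gen.b k) *
      (FreeGroup.of (Gen.a k))⁻¹ * (FreeGroup.of (Gen.b k))⁻¹).prod *
    (List.ofFn fun i : Fin n => FreeGroup.of (Gen.c i)).prod *
    (List.ofFn fun j : Fin r => FreeGroup.of (Gen.d j)).prod

/-- The defining relators of the standard presentation. -/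
def relators (g n r : ℕ) (m : Fin r → ℕ) : Set (FreeGroup (Gen g n r)) :=
  {longWord g n r} ∪ Set.range fun j : Fin r => FreeGroup.of (Gen.d j) ^ m j

/-- `Γ` is (the full preimage in `SL(2, ℝ)` of) a cofinite discrete subgroup of `PSL(2, ℝ)`,
and `gen` is a standard system of generators of type `(g, n; m₁, …, m_r)`. -/
structure IsMarkedFuchsian (m : Fin r → ℕ) (Γ : Subgroup SL(2, ℝ))
    (gen : Gen g n r → SL(2, ℝ)) : Prop where
  neg_one_mem : -1 ∈ Γ
  discrete : DiscreteTopology Γ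
  cofinite : ∃ D : Set ℂ, IsFundamentalDomain (Γ.map toC) U D ∧
    ∫⁻ z in D, ENNReal.ofReal (1 / z.im ^ 2) < ⊤
  generate : Subgroup.closure (Set.range gen ∪ {-1}) = Γ
  presentation : ∀ w : FreeGroup (Gen g n r),
    (FreeGroup.lift gen w = 1 ∨ FreeGroup.lift gen w = -1) ↔
      w ∈ Subgroup.normalClosure (relators g n r m)
  hyperbolic_a : ∀ k, (gen (.a k)).val.IsHyperbolic
  hyperbolic_b : ∀ k, (gen (.b k)).val.IsHyperbolic
  parabolic : ∀ i, (gen (.c i)).val.IsParabolic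
  elliptic : ∀ j, (gen (.d j)).val.IsElliptic

/-- The action of `SL(2, ℝ)` on the extended real line. -/
def act (γ : SL(2, ℝ)) (x : OnePoint ℝ) : OnePoint ℝ :=
  (Matrix.SpecialLinearGroup.toGL γ : GL (Fin 2) ℝ) • x

/-- `x` is fixed by a hyperbolic or a parabolic element of `Γ`. -/
def IsBoundaryFixedPoint (Γ : Subgroup SL(2, ℝ)) (x : OnePoint ℝ) : Prop :=
  ∃ γ ∈ Γ, (γ.val.IsHyperbolic ∨ γ.val.IsParabolic) ∧ act γ x = x

/-- Normalization of a marked Fuchsian group by three fixed points placed at `0, 1, ∞`. Either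
`g ≥ 1`, the attracting and the repelling fixed points of `α₁` are `0` and `∞` and the attracting
fixed point of `β₁` is `1` (a fixed point of `(a, b; c, d)` is attracting if the derivative
`1 / (c x + d) ^ 2` is less than `1` there); or, more generally, `0, 1, ∞` are fixed by
hyperbolic or parabolic elements and `0`, `∞` are not equivalent under the group. -/
def IsNormalized (Γ : Subgroup SL(2, ℝ)) (gen : Gen g n r → SL(2, ℝ)) : Prop :=
  (∃ hg : 0 < g,
    (act (gen (.a ⟨0, hg⟩)) ((0 : ℝ) : OnePoint ℝ) = ((0 : ℝ) : OnePoint ℝ) ∧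
      act (gen (.a ⟨0, hg⟩)) OnePoint.infty = OnePoint.infty ∧
      1 < |gen (.a ⟨0, hg⟩) 1 1|) ∧
    (act (gen (.b ⟨0, hg⟩)) ((1 : ℝ) : OnePoint ℝ) = ((1 : ℝ) : OnePoint ℝ) ∧
      1 < |gen (.b ⟨0, hg⟩) 1 0 + gen (.b ⟨0, hg⟩) 1 1|)) ∨
  (IsBoundaryFixedPoint Γ ((0 : ℝ) : OnePoint ℝ) ∧
    IsBoundaryFixedPoint Γ ((1 : ℝ) : OnePoint ℝ) ∧
    IsBoundaryFixedPoint Γ OnePoint.infty ∧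
    ∀ γ ∈ Γ, act γ ((0 : ℝ) : OnePoint ℝ) ≠ OnePoint.infty)

/-! ### Quasi-Fuchsian groups -/

/-- Quasiconformal homeomorphisms of the plane (metric definition: the ratio of the largest to the
smallest stretching of small circles is bounded, uniformly in the centre). -/
def IsQuasiconformal (f : ℂ ≃ₜ ℂ) : Prop :=
  ∃ H : ℝ, ∀ z : ℂ, ∀ᶠ ε in nhdsWithin (0 : ℝ) (Set.Ioi 0),
    ∀ w w' : ℂ, ‖w - z‖ = ε → ‖w' - z‖ = ε → ‖f w - f z‖ ≤ H * ‖f w' - f z‖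

/-- A marked, normalized quasi-Fuchsian group of type `(g, n; m₁, …, m_r)`. The group `Γ` is given
by its full preimage in `SL(2, ℂ)`. The maps `J₁`, `J₂` are the quasiconformal homeomorphisms of
the sphere fixing `0, 1, ∞` (so they are homeomorphisms of the plane), holomorphic on the upper,
respectively the lower half plane, which conjugate Fuchsian groups `Γ₁`, `Γ₂` to `Γ`. -/
structure QuasiFuchsian (g n r : ℕ) (m : Fin r → ℕ) where
  Γ : Subgroup SL(2, ℂ)
  gen : Gen g n r → SL(2, ℂ)
  gen_mem : ∀ s, gen s ∈ Γ
  neg_one_mem : -1 ∈ Γ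
  J₁ : ℂ ≃ₜ ℂ
  J₂ : ℂ ≃ₜ ℂ
  quasiconformal₁ : IsQuasiconformal J₁
  quasiconformal₂ : IsQuasiconformal J₂
  holo₁ : DifferentiableOn ℂ J₁ U
  holo₂ : DifferentiableOn ℂ J₂ L
  image_U : J₂ '' U = J₁ '' U
  image_L : J₂ '' L = J₁ '' L
  fix₁ : J₁ 0 = 0 ∧ J₁ 1 = 1
  fix₂ : J₂ 0 = 0 ∧ J₂ 1 = 1
  Γ₁ : Subgroup SL(2, ℝ)
  Γ₂ : Subgroup SL(2, ℝ)
  gen₁ : Gen g n r → SL(2, ℝ)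
  gen₂ : Gen g n r → SL(2, ℝ)
  fuchsian₁ : IsMarkedFuchsian m Γ₁ gen₁
  fuchsian₂ : IsMarkedFuchsian m Γ₂ gen₂
  normalized : IsNormalized Γ₁ gen₁
  conj₁ : ∀ δ ∈ Γ₁, ∃ γ ∈ Γ, ∀ z ∈ U ∪ L, J₁ (mob (toC δ) z) = mob γ (J₁ z)
  conj₁' : ∀ γ ∈ Γ, ∃ δ ∈ Γ₁, ∀ z ∈ U ∪ L, J₁ (mob (toC δ) z) = mob γ (J₁ z)
  conj₂ : ∀ δ ∈ Γ₂, ∃ γ ∈ Γ, ∀ z ∈ U ∪ L, J₂ (mob (toC δ) z) = mob γ (J₂ z)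
  conj₂' : ∀ γ ∈ Γ, ∃ δ ∈ Γ₂, ∀ z ∈ U ∪ L, J₂ (mob (toC δ) z) = mob γ (J₂ z)
  marking₁ : ∀ s, ∀ z ∈ U ∪ L, J₁ (mob (toC (gen₁ s)) z) = mob (gen s) (J₁ z)
  marking₂ : ∀ s, ∀ z ∈ U ∪ L, J₂ (mob (toC (gen₂ s)) z) = mob (gen s) (J₂ z)

namespace QuasiFuchsian

variable {m : Fin r → ℕ} (Q : QuasiFuchsian g n r m)

/-- The component `Ω₁ = J₁(U)` of the region of discontinuity. -/
def Ω₁ : Set ℂ := Q.J₁ '' U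

/-- The component `Ω₂ = J₁(L)` of the region of discontinuity. -/
def Ω₂ : Set ℂ := Q.J₁ '' L

open Classical in
/-- The density `ρ = e^φ` of the hyperbolic metric on `Ω₁ ∪ Ω₂`, the pull-back of
`|dz|² / (Im z)²` by `J₁⁻¹` on `Ω₁` and by `J₂⁻¹` on `Ω₂`. -/
def rho (z : ℂ) : ℝ :=
  if z ∈ Q.Ω₁ then ‖deriv Q.J₁.symm z‖ ^ 2 / (Q.J₁.symm z).im ^ 2
  else ‖deriv Q.J₂.symm z‖ ^ 2 / (Q.J₂.symm z).im ^ 2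

/-- The logarithm `φ` of the density of the hyperbolic metric. -/
def phi (z : ℂ) : ℝ := Real.log (Q.rho z)

/-- The derivative `φ_z = (φ_x - i φ_y) / 2`. -/
def phiZ (z : ℂ) : ℂ :=
  ((fderiv ℝ Q.phi z 1 : ℂ) - Complex.I * (fderiv ℝ Q.phi z Complex.I : ℂ)) / 2

/-- The density `|φ_z|² + e^φ`. -/
def density (z : ℂ) : ℝ := ‖Q.phiZ z‖ ^ 2 + Real.exp (Q.phi z)

/-! ### The forms of the double complex

A complex 1-form is given by its values `θ z v` at the point `z` on the tangent vector `v`. -/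

/-- The 1-form `θ_η` for `η ∈ Γ`: with `γ = η⁻¹`,
`(φ - ½ log |γ'|² - 2 log 2 - log |c(γ)|²) (γ''/γ' dz - conj (γ''/γ') d(conj z))`;
it is `0` if `c(γ) = 0`. -/
def theta (η : SL(2, ℂ)) (z v : ℂ) : ℂ :=
  ((Q.phi z - 1 / 2 * Real.log (‖mobDeriv η⁻¹ z‖ ^ 2) - 2 * Real.log 2 -
      Real.log (‖η⁻¹ 1 0‖ ^ 2) : ℝ) : ℂ) *
    (mobQuot η⁻¹ z * v - conj (mobQuot η⁻¹ z * v))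

/-- The 1-form `u = δ θ`: with `γ₁ = η₁⁻¹`, `u_{η₁, η₂} = γ₁^* θ_{η₂} - θ_{η₁ η₂} + θ_{η₁}`. -/
def u (η₁ η₂ : SL(2, ℂ)) (z v : ℂ) : ℂ :=
  Q.theta η₂ (mob η₁⁻¹ z) (mobDeriv η₁⁻¹ z * v) - Q.theta (η₁ * η₂) z v + Q.theta η₁ z v

end QuasiFuchsian

/-- The integral of the 1-form `θ` along the path `p : [0, 1] → ℂ`; the end points, where the path
may reach a fixed point of the group on the limit set, are left out. -/
def lineIntegral (θ : ℂ → ℂ → ℂ) (p : ℝ → ℂ) : ℂ :=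
  ∫ t in Set.Ioo (0 : ℝ) 1, θ (p t) (deriv p t)

/-- Absolute convergence of the integral of the 1-form `θ` along the path `p`. -/
def LineIntegrable (θ : ℂ → ℂ → ℂ) (p : ℝ → ℂ) : Prop :=
  MeasureTheory.IntegrableOn (fun t => θ (p t) (deriv p t)) (Set.Ioo (0 : ℝ) 1)

/-! ### The standard fundamental polygon and its chains -/

/-- The sign of a side in the oriented boundary
`∑ (a_k + b_k' - a_k' - b_k) + ∑ (c_i - c_i') + ∑ (d_j - d_j')`. -/
def sign : Gen g n r → ℝ
  | .b _ => -1
  | _ => 1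

/-- Parameter values at which a side lies in the upper half plane: a side `c i` ends at a cusp. -/
def sideDom : Gen g n r → Set ℝ
  | .c _ => Set.Ico 0 1
  | _ => Set.Icc 0 1

/-- Geodesic parametrization of the imaginary axis by `[0, 1]`: an arc of length `ℓ` from `i`. -/
def segment (ℓ t : ℝ) : ℂ := Complex.I * Real.exp (ℓ * t)

/-- Geodesic parametrization of the ray from `i` to `∞` by `[0, 1)`. -/
def ray (t : ℝ) : ℂ := Complex.I / ((1 - t : ℝ) : ℂ)

/-- The sides: `e s` is the side labelled by the generator `s`, and `(gen s)⁻¹ (e s)` is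
the side paired with it, labelled by a prime. -/
def side (gen : Gen g n r → SL(2, ℝ)) (e : Gen g n r → ℝ → ℂ) (s : Gen g n r × Bool) : ℝ → ℂ :=
  if s.2 then fun t => mob (toC (gen s.1)⁻¹) (e s.1 t) else e s.1

/-- `F` is a standard fundamental polygon for the marked Fuchsian group, with sides `e` and with
`q` listing the initial points of the sides in their cyclic order along the boundary
(without the two intermediate vertices of each handle). -/
structure IsStandardPolygon (Γ : Subgroup SL(2, ℝ)) (gen : Gen g n r → SL(2, ℝ))
    (F : Set ℂ) (e : Gen g n r → ℝ → ℂ) (q : ℕ → ℂ) : Prop where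
  subset : F ⊆ U
  closed : closure F ∩ U = F
  regular : closure (interior F) ∩ U = F
  connected : IsConnected (interior F)
  covers : ∀ z ∈ U, ∃ γ ∈ Γ, mob (toC γ) z ∈ F
  disjoint : ∀ γ ∈ Γ, γ ≠ 1 → γ ≠ -1 → Disjoint (interior F) (mob (toC γ) '' interior F)
  -- the boundary consists of the sides, which do not overlap
  boundary : frontier F ∩ U = ⋃ s : Gen g n r × Bool, side gen e s '' sideDom s.1
  nonoverlapping : ∀ s s' : Gen g n r × Bool, s ≠ s' →
    Disjoint (side gen e s '' Set.Ioo 0 1) (side gen e s' '' Set.Ioo 0 1)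
  -- the sides are geodesic, oriented by their sign: those with sign `1` have `F` on their left
  geodesic : ∀ s, (∀ i, s ≠ .c i) → ∃ A : SL(2, ℝ), ∃ ℓ > 0,
    (∀ t ∈ Set.Icc (0 : ℝ) 1, e s t = mob (toC A) (segment ℓ t)) ∧
    ∀ t ∈ Set.Ioo (0 : ℝ) 1, ∀ᶠ ε in nhdsWithin (0 : ℝ) (Set.Ioi 0),
      mob (toC A) (segment ℓ t - ((sign s * ε : ℝ) : ℂ)) ∈ interior F
  cusp : ∀ i, ∃ A : SL(2, ℝ),
    (∀ t ∈ Set.Ico (0 : ℝ) 1, e (.c i) t = mob (toC A) (ray t)) ∧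
    act (gen (.c i)) (act A OnePoint.infty) = act A OnePoint.infty ∧
    ∀ t ∈ Set.Ioo (0 : ℝ) 1, ∀ᶠ ε in nhdsWithin (0 : ℝ) (Set.Ioi 0),
      mob (toC A) (ray t - ((ε : ℝ) : ℂ)) ∈ interior F
  -- the order of the sides along the boundary
  a_start : ∀ k : Fin g, e (.a k) 0 = q k
  b_start : ∀ k : Fin g, e (.b k) 0 = q (k + 1)
  a_end : ∀ k : Fin g, mob (toC (gen (.b k))⁻¹) (e (.b k) 0) = e (.a k) 1
  b_end : ∀ k : Fin g, mob (toC (gen (.a k))⁻¹) (e (.a k) 0) = e (.b k) 1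
  ab_end : ∀ k : Fin g, mob (toC (gen (.a k))⁻¹) (e (.a k) 1) =
    mob (toC (gen (.b k))⁻¹) (e (.b k) 1)
  c_start : ∀ i : Fin n, e (.c i) 0 = q (g + i)
  c_next : ∀ i : Fin n, mob (toC (gen (.c i))⁻¹) (e (.c i) 0) = q (g + i + 1)
  d_start : ∀ j : Fin r, e (.d j) 0 = q (g + n + j)
  d_next : ∀ j : Fin r, mob (toC (gen (.d j))⁻¹) (e (.d j) 0) = q (g + n + j + 1)
  d_end : ∀ j : Fin r, mob (toC (gen (.d j))) (e (.d j) 1) = e (.d j) 1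
  closes_up : q (g + n + r) = q 0

/-- `p` is a `Γ`-contracting path in `U` from the boundary point `0` to `w`: near `0` it is the
union of the images under the powers of some `γ ∈ Γ` fixing `0` of one of its arcs. (The path is
parametrized so that `γ` acts by `s ↦ s / 2`.) -/
structure IsContractingPath (Γ : Subgroup SL(2, ℝ)) (w : ℂ) (p : ℝ → ℂ) : Prop where
  continuousOn : ContinuousOn p (Set.Icc 0 1)
  source : p 0 = 0
  target : p 1 = w
  mem : ∀ s ∈ Set.Ioc (0 : ℝ) 1, p s ∈ U
  smooth : ContDiffOn ℝ 1 p (Set.Ioc 0 1)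
  contracting : ∃ γ ∈ Γ, act γ ((0 : ℝ) : OnePoint ℝ) = ((0 : ℝ) : OnePoint ℝ) ∧
    ∃ ε ∈ Set.Ioc (0 : ℝ) 1, ∀ s ∈ Set.Ioc 0 ε, p (s / 2) = mob (toC γ) (p s)

/-- The commutator `γ_k = [α_k, β_k]`. -/
def comm (gen : Gen g n r → SL(2, ℂ)) (k : Fin g) : SL(2, ℂ) :=
  gen (.a k) * gen (.b k) * (gen (.a k))⁻¹ * (gen (.b k))⁻¹

/-- The terms of the chain `W`: the entry `(ε, k, η₁, η₂)` stands for `ε P_k ⊗ [η₁ | η₂]`. -/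
def chainW (gen : Gen g n r → SL(2, ℂ)) : List (ℤ × ℕ × SL(2, ℂ) × SL(2, ℂ)) :=
  (List.ofFn fun k : Fin g =>
    [((1 : ℤ), (k : ℕ), gen (.a k), gen (.b k)),
     ((-1 : ℤ), (k : ℕ) + 1, gen (.b k), gen (.a k)),
     ((1 : ℤ), (k : ℕ) + 1, (comm gen k)⁻¹, gen (.a k) * gen (.b k))]).flatten ++
  (List.ofFn fun k : Fin (g - 1) =>
    ((-1 : ℤ), g, (((List.ofFn (comm gen)).drop (k + 1)).prod)⁻¹,
      (comm gen ⟨k, by omega⟩)⁻¹)) ++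
  (List.ofFn fun i : Fin (n - 1) =>
    ((1 : ℤ), g, ((List.ofFn fun i => gen (.c i)).take (i + 1)).prod,
      gen (.c ⟨i + 1, by omega⟩))) ++
  (List.ofFn fun j : Fin r =>
    ((1 : ℤ), g, (List.ofFn fun i => gen (.c i)).prod *
      ((List.ofFn fun j => gen (.d j)).take j).prod, gen (.d j)))

/-- Push-forward by `J` of a path. -/
def push (J : ℂ → ℂ) (p : ℝ → ℂ) : ℝ → ℂ := fun t => J (p t)

/-- Push-forward by `J` of the complex conjugate of a path. -/
def pushConj (J : ℂ → ℂ) (p : ℝ → ℂ) : ℝ → ℂ := fun t => J (conj (p t))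

namespace QuasiFuchsian

variable {m : Fin r → ℕ} (Q : QuasiFuchsian g n r m)

/-- `J₁` is of class `C¹` on the lower half plane, and Lipschitz there for the
hyperbolic metrics of `L` and `Ω₂`. -/
def IsLipschitzOnL : Prop :=
  ContDiffOn ℝ 1 Q.J₁ L ∧
    ∃ K : ℝ, ∀ z ∈ L, Real.exp (Q.phi (Q.J₁ z) / 2) * ‖fderiv ℝ Q.J₁ z‖ ≤ K / |z.im|

/-- The pairing `⟨ω[φ], F₁ - F₂⟩` with `ω[φ] = (|φ_z|² + e^φ) dz ∧ d(conj z)`, `F₁ = J₁(F)` and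
`F₂ = J₁(conj F)`. Since `dz ∧ d(conj z) = - 2 i dx dy` and complex conjugation reverses the
orientation of the chain `F₂`, the two area integrals are added. -/
def pairingOmega (F : Set ℂ) : ℂ :=
  -2 * Complex.I *
    (((∫ z in Q.J₁ '' F, Q.density z) + ∫ z in Q.J₁ '' (conj '' F), Q.density z : ℝ) : ℂ)

/-- `⟨θ, L⟩` with `L = ∑ (b_k ⊗ [β_k] - a_k ⊗ [α_k]) - ∑ c_i ⊗ [κ_i] - ∑ d_j ⊗ [τ_j]`, where
`p` gives the sides (in `Ω₁` or `Ω₂`). -/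
def pairingTheta (p : Gen g n r → ℝ → ℂ) : ℂ :=
  ∑ k : Fin g, (lineIntegral (Q.theta (Q.gen (.b k))) (p (.b k)) -
      lineIntegral (Q.theta (Q.gen (.a k))) (p (.a k))) -
    ∑ i : Fin n, lineIntegral (Q.theta (Q.gen (.c i))) (p (.c i)) -
    ∑ j : Fin r, lineIntegral (Q.theta (Q.gen (.d j))) (p (.d j))

/-- `⟨u, W⟩`, where `P` gives the paths (in `Ω₁` or `Ω₂`). -/
def pairingU (P : ℕ → ℝ → ℂ) : ℂ :=
  ((chainW Q.gen).map fun x => (x.1 : ℂ) * lineIntegral (Q.u x.2.2.1 x.2.2.2) (P x.2.1)).sum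

/-- All the integrals in the definition of the classical Liouville action converge absolutely. -/
structure ActionConverges (F : Set ℂ) (e : Gen g n r → ℝ → ℂ) (P : ℕ → ℝ → ℂ) : Prop where
  omega₁ : MeasureTheory.IntegrableOn Q.density (Q.J₁ '' F)
  omega₂ : MeasureTheory.IntegrableOn Q.density (Q.J₁ '' (conj '' F))
  theta₁ : ∀ s, LineIntegrable (Q.theta (Q.gen s)) (push Q.J₁ (e s))
  theta₂ : ∀ s, LineIntegrable (Q.theta (Q.gen s)) (pushConj Q.J₁ (e s))
  u₁ : ∀ x ∈ chainW Q.gen, LineIntegrable (Q.u x.2.2.1 x.2.2.2) (push Q.J₁ (P x.2.1))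
  u₂ : ∀ x ∈ chainW Q.gen, LineIntegrable (Q.u x.2.2.1 x.2.2.2) (pushConj Q.J₁ (P x.2.1))

/-- The classical Liouville action
`S[φ] = (i / 2) (⟨ω, F₁ - F₂⟩ - ⟨θ, L₁ - L₂⟩ + ⟨u, W₁ - W₂⟩)` exists and has the value `S`. -/
def HasClassicalAction (F : Set ℂ) (e : Gen g n r → ℝ → ℂ) (P : ℕ → ℝ → ℂ) (S : ℂ) : Prop :=
  Q.ActionConverges F e P ∧
    S = Complex.I / 2 * (Q.pairingOmega F -
      (Q.pairingTheta (fun s => push Q.J₁ (e s)) - Q.pairingTheta fun s => pushConj Q.J₁ (e s)) +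
      (Q.pairingU (fun k => push Q.J₁ (P k)) - Q.pairingU fun k => pushConj Q.J₁ (P k)))

end QuasiFuchsian

end Liouville

end

noncomputable section

open Metric Set Filter Topology

namespace Liouville

/-! ### Univalent functions -/

/-! Everything reduces to comparing $e^{-\varphi/2}$, the conformal radius up to normalization, with
Euclidean quantities by means of weak Koebe-type distortion estimates. Sharp constants are
irrelevant, so these estimates are derived from the Schwarz lemma and Cauchy estimates alone.

Area integrals. On a component, $\varphi=\log|f'|^2-2\log|\operatorname{Im}f|$ with $f$ the
holomorphic inverse Riemann map, so $\varphi$ is smooth. The bound on the second coefficient of a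
univalent function gives $|\varphi_z|^2\le C e^{\varphi}$ (`norm_phiZ_sq_le`), so only the
hyperbolic area has to be finite. A set whose translates do not overlap has at most the area of a
set whose translates cover (`hypArea_le_of_packing`), and the Fuchsian group is cofinite.

Line integrals. Along compact arcs in the open components the forms are continuous and nothing has
to be shown. At a boundary point $z_0$ the coefficient of $\check\theta$ grows like $\varphi$ unless
the rational factor has a pole at $z_0$; away from poles it is therefore $O(e^{\varphi/8})$
(`TameAt`). This growth has to be beaten by the decay of $|dz|$.

At a cusp, a Lipschitz parametrization gives $|dz|\le K e^{-\varphi/2}\,|dw|/|\operatorname{Im}w|$,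
and Koebe gives $e^{-\varphi/2}\le 16|z-z_0|$. The parabolic element acts as a translation by some
$b\ne0$ in the coordinate $1/(z-z_0)$, which forces $|z-z_0|=O(1/|\operatorname{Im}w|)$
(`exists_cusp_bound`). The integrand is then $O((1-t)^{-1/4})$. If the generator fixes $\infty$, its
form is $0$.

Along a contracting path the tail is a union of arcs $\gamma^N(I)$, and $e^{\varphi/8}|dz|$ scales
by $|(\gamma^N)'|^{3/4}$. In the coordinate $1/z$ the element $\gamma$ is affine, whence
$(\gamma^N)'=O(N^{-2})$ on $I$, and $\sum N^{-3/2}$ converges. The forms $\check u$ have no pole at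
$0$ because the normalization prevents $0$ and $\infty$ from being equivalent
(`lower_right_ne_zero`): a discrete group containing the diagonal $\alpha_1$ could only exchange $0$
and $\infty$ by conjugating $\alpha_1$ to its inverse, which the abelianized presentation forbids.
-/

theorem ball_subset_image_of_norm_le {f : ℂ → ℂ} {M : ℝ} (hf : DifferentiableOn ℂ f (ball 0 1))
    (h0 : f 0 = 0) (hM : ∀ z ∈ ball (0 : ℂ) 1, ‖f z‖ ≤ M) (hd : deriv f 0 ≠ 0) :
    ball 0 (‖deriv f 0‖ ^ 2 / (16 * M)) ⊆ f '' ball 0 1 := by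
  have hA : 0 < ‖deriv f 0‖ := norm_pos_iff.mpr hd
  set A := ‖deriv f 0‖ with hAdef
  have hmaps : MapsTo f (ball 0 1) (closedBall (f 0) M) := fun z hz => by
    simpa [h0] using hM z hz
  have hg : ∀ z ∈ ball (0 : ℂ) 1, ‖dslope f 0 z‖ ≤ M := fun z hz => by
    simpa using Complex.norm_dslope_le_div_of_mapsTo_ball hf hmaps hz
  have hAM : A ≤ M := by
    simpa using hg 0 (by simp)
  have hMpos : 0 < M := hA.trans_le hAM
  have hgd : DifferentiableOn ℂ (dslope f 0) (ball 0 1) :=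
    (Complex.differentiableOn_dslope (ball_mem_nhds _ one_pos)).mpr hf
  have hg2 : ∀ z ∈ ball (0 : ℂ) 1, dist (dslope f 0 z) (dslope f 0 0) ≤ 2 * M / 1 * dist z 0 := by
    intro z hz
    refine Complex.dist_le_div_mul_dist_of_mapsTo_ball hgd (fun w hw => ?_) hz
    rw [mem_closedBall, dist_eq_norm]
    linarith [norm_sub_le (dslope f 0 w) (dslope f 0 0), hg w hw, hg 0 (by simp)]
  -- On the circle of this radius the difference quotient, which varies by at most $2M|z|$, still
  -- has modulus at least $A/2$; hence $|f|\ge A^2/(8M)$ there, and the quantitative open mapping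
  -- theorem loses a factor $2$.
  set r := A / (4 * M) with hr
  have hrpos : 0 < r := by positivity
  have hr1 : r < 1 := by
    rw [hr, div_lt_one (by positivity)]; linarith
  have hcl : closedBall (0 : ℂ) r ⊆ ball 0 1 := closedBall_subset_ball hr1
  have hdc : DiffContOnCl ℂ f (ball 0 r) :=
    (hf.mono hcl).diffContOnCl_ball subset_rfl
  have hsph : ∀ z ∈ sphere (0 : ℂ) r, A ^ 2 / (8 * M) ≤ ‖f z - f 0‖ := by
    intro z hz
    have hz' : ‖z‖ = r := by simpa using hz
    have hz1 := hcl (sphere_subset_closedBall hz)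
    have hfz : f z - f 0 = z * dslope f 0 z := by
      have := sub_smul_dslope f 0 z
      simpa using this.symm
    have h2 := hg2 z hz1
    rw [dslope_same, dist_eq_norm, dist_zero_right, hz', div_one] at h2
    have h3 : A - 2 * M * r ≤ ‖dslope f 0 z‖ := by
      have := norm_sub_norm_le (deriv f 0) (dslope f 0 z)
      rw [norm_sub_rev] at this
      linarith
    have h4 : A - 2 * M * r = A / 2 := by rw [hr]; field_simp; ring
    rw [hfz, norm_mul, hz']
    calc A ^ 2 / (8 * M) = r * (A / 2) := by rw [hr]; field_simp; ring
      _ ≤ _ := by gcongr; linarith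
  have hfreq : ∃ᶠ z in 𝓝 (0 : ℂ), f z ≠ f 0 := by
    have hda : HasDerivAt f (deriv f 0) 0 :=
      (hf.differentiableAt (ball_mem_nhds _ one_pos)).hasDerivAt
    exact ((hda.eventually_ne hd).frequently).filter_mono nhdsWithin_le_nhds
  have := hdc.ball_subset_image_closedBall hrpos hsph hfreq
  rw [h0] at this
  have e : A ^ 2 / (8 * M) / 2 = A ^ 2 / (16 * M) := by field_simp; norm_num
  rw [e] at this
  exact this.trans (image_mono hcl)

/-- A weak form of the bound for the derivative of Bieberbach-Eilenberg functions. -/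
theorem norm_deriv_le_of_mul_ne_one {f : ℂ → ℂ} (hf : DifferentiableOn ℂ f (ball 0 1))
    (h0 : f 0 = 0) (h1 : ∀ z ∈ ball (0 : ℂ) 1, ∀ w ∈ ball (0 : ℂ) 1, f z * f w ≠ 1) :
    ‖deriv f 0‖ ≤ 4 := by
  by_contra! hlt
  have hd : deriv f 0 ≠ 0 := by
    intro h; rw [h, norm_zero] at hlt; linarith
  set k := ‖deriv f 0‖ ^ 2 / 16 with hk
  have hk1 : 1 < k := by rw [hk, lt_div_iff₀ (by norm_num)]; nlinarith
  obtain ⟨r, hr, hball⟩ : ∃ r > 0, ball 0 r ⊆ f '' ball 0 1 := by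
    have han : AnalyticAt ℂ f 0 := hf.analyticAt (ball_mem_nhds _ one_pos)
    have := han.hasStrictDerivAt.map_nhds_eq hd
    rw [h0] at this
    have h2 : f '' ball 0 1 ∈ 𝓝 (0 : ℂ) := by
      rw [← this]; exact image_mem_map (ball_mem_nhds _ one_pos)
    exact Metric.mem_nhds_iff.mp h2
  -- Bootstrapping: if the image contains the disc of radius $\rho$, then $|f|\le1/\rho$, since
  -- otherwise $1/f(z)$ would be a value of $f$. The preceding lemma enlarges the disc to radius
  -- $k\rho$. As $k>1$, the value $1$ is eventually taken, and $1\cdot1=1$.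
  have hstep : ∀ N : ℕ, ball 0 (k ^ N * r) ⊆ f '' ball 0 1 := by
    intro N
    induction N with
    | zero => simpa using hball
    | succ N ih =>
      have hpos : 0 < k ^ N * r := by positivity
      have hM : ∀ z ∈ ball (0 : ℂ) 1, ‖f z‖ ≤ 1 / (k ^ N * r) := by
        intro z hz
        by_contra! hc
        have hfz : f z ≠ 0 := by
          intro h; rw [h, norm_zero] at hc
          have : 0 < 1 / (k ^ N * r) := by positivity
          linarith
        have : (f z)⁻¹ ∈ ball (0 : ℂ) (k ^ N * r) := by
          rw [mem_ball_zero_iff, norm_inv]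
          exact inv_lt_of_inv_lt₀ hpos (by simpa using hc)
        obtain ⟨w, hw, hw2⟩ := ih this
        exact h1 z hz w hw (by rw [hw2, mul_inv_cancel₀ hfz])
      have := ball_subset_image_of_norm_le hf h0 hM hd
      refine subset_trans (ball_subset_ball ?_) this
      rw [hk]; apply le_of_eq; field_simp; rw [pow_succ]; ring
  obtain ⟨N, hN⟩ := pow_unbounded_of_one_lt (1 / r) hk1
  rw [div_lt_iff₀ hr] at hN
  obtain ⟨z, hz, hz1⟩ := hstep N (show (1 : ℂ) ∈ _ by simpa using hN)
  exact h1 z hz z hz (by simp [hz1])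

/-- On a disc $h'/h$ has a primitive; half of it, exponentiated and rescaled by a constant, is the
square root. -/
theorem exists_sq_eq_of_ne_zero {h : ℂ → ℂ} (hh : DifferentiableOn ℂ h (ball 0 1))
    (hne : ∀ z ∈ ball (0 : ℂ) 1, h z ≠ 0) :
    ∃ s : ℂ → ℂ, DifferentiableOn ℂ s (ball 0 1) ∧ ∀ z ∈ ball (0 : ℂ) 1, s z ^ 2 = h z := by
  have hd : DifferentiableOn ℂ (fun z => deriv h z / h z) (ball 0 1) :=
    (hh.deriv isOpen_ball).div hh hne
  obtain ⟨G, hG⟩ := hd.isExactOn_ball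
  have hGd : DifferentiableOn ℂ G (ball 0 1) := fun z hz =>
    (hG z hz).differentiableAt.differentiableWithinAt
  have hc : ∀ z ∈ ball (0 : ℂ) 1, HasDerivAt (fun z => Complex.exp (-G z) * h z) 0 z := by
    intro z hz
    have h1 := (hG z hz).neg.cexp.mul
      (hh.differentiableAt (isOpen_ball.mem_nhds hz)).hasDerivAt
    refine h1.congr_deriv ?_
    have := hne z hz
    field_simp
    ring
  have hconst : ∀ z ∈ ball (0 : ℂ) 1, Complex.exp (-G z) * h z = Complex.exp (-G 0) * h 0 := by
    intro z hz
    refine isOpen_ball.is_const_of_deriv_eq_zero (convex_ball (0 : ℂ) 1).isPreconnected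
      (fun z hz => (hc z hz).differentiableAt.differentiableWithinAt)
      (fun z hz => (hc z hz).deriv) hz (by simp)
  obtain ⟨a, ha⟩ : ∃ a : ℂ, a ^ 2 = Complex.exp (-G 0) * h 0 :=
    IsAlgClosed.exists_pow_nat_eq _ (by norm_num)
  refine ⟨fun z => a * Complex.exp (G z / 2), (hGd.div_const 2).cexp.const_mul a, fun z hz => ?_⟩
  rw [mul_pow, ha, ← hconst z hz, ← Complex.exp_nat_mul]
  push_cast
  rw [mul_div_cancel₀ _ (two_ne_zero), mul_right_comm, ← Complex.exp_add]
  simp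

/-- A weak form of the Koebe one-quarter theorem. -/
theorem norm_deriv_le_of_forall_ne {h : ℂ → ℂ} (hh : DifferentiableOn ℂ h (ball 0 1))
    (hinj : InjOn h (ball 0 1)) (hne : ∀ z ∈ ball (0 : ℂ) 1, h z ≠ 0) :
    ‖deriv h 0‖ ≤ 16 * ‖h 0‖ := by
  obtain ⟨s, hs, hs2⟩ := exists_sq_eq_of_ne_zero hh hne
  have h00 : (0 : ℂ) ∈ ball (0 : ℂ) 1 := by simp
  have hsum : ∀ z ∈ ball (0 : ℂ) 1, ∀ w ∈ ball (0 : ℂ) 1, s z + s w ≠ 0 := by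
    intro z hz w hw h0
    have e : s z = -s w := eq_neg_of_add_eq_zero_left h0
    have : z = w := hinj hz hw (by rw [← hs2 z hz, ← hs2 w hw, e, neg_sq])
    subst this
    have : s z = 0 := by
      have h2 : 2 * s z = 0 := by rw [two_mul]; exact h0
      simpa using h2
    exact hne z hz (by rw [← hs2 z hz, this]; simp)
  -- Injectivity of $h=s^2$ and $h\ne0$ give $s(z)+s(w)\neq0$ always. This is equivalent to
  -- $f(z)f(w)\neq1$, and $h'(0)=4h(0)f'(0)$.
  set f : ℂ → ℂ := fun z => (s z - s 0) / (s z + s 0) with hf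
  have hfd : DifferentiableOn ℂ f (ball 0 1) :=
    (hs.sub_const _).div (hs.add_const _) fun z hz => hsum z hz 0 h00
  have hb := norm_deriv_le_of_mul_ne_one hfd (by simp [hf]) (by
    intro z hz w hw h1
    have hz0 := hsum z hz 0 h00
    have hw0 := hsum w hw 0 h00
    simp only [hf] at h1
    rw [div_mul_div_comm, div_eq_one_iff_eq (mul_ne_zero hz0 hw0)] at h1
    have hs0 : s 0 ≠ 0 := fun h => hsum 0 h00 0 h00 (by simp [h])
    have : 2 * s 0 * (s z + s w) = 0 := by linear_combination -h1
    exact hsum z hz w hw (by simpa [hs0] using this))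
  have hsder := (hs.differentiableAt (ball_mem_nhds (0 : ℂ) one_pos)).hasDerivAt
  have hs0 : s 0 ≠ 0 := fun h => hsum 0 h00 0 h00 (by simp [h])
  have hder : deriv f 0 = deriv s 0 / (2 * s 0) := by
    have := ((hsder.sub_const (s 0)).div (hsder.add_const (s 0)) (hsum 0 h00 0 h00)).deriv
    rw [show deriv f 0 = _ from this]
    field_simp
    ring
  have hder2 : deriv h 0 = 2 * s 0 * deriv s 0 := by
    have h1 : HasDerivAt (fun z => s z ^ 2) (2 * s 0 * deriv s 0) 0 := by
      simpa using hsder.fun_pow 2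
    refine (h1.congr_of_eventuallyEq ?_).deriv
    filter_upwards [ball_mem_nhds (0 : ℂ) one_pos] with z hz using (hs2 z hz).symm
  have : deriv h 0 = 4 * h 0 * deriv f 0 := by
    rw [hder, hder2, ← hs2 0 h00]; field_simp; ring
  rw [this, norm_mul, norm_mul]
  norm_num
  nlinarith [norm_nonneg (h 0)]

theorem norm_deriv_mul_le_of_notMem {J : ℂ → ℂ} {w : ℂ} {R : ℝ} (hR : 0 < R)
    (hJ : DifferentiableOn ℂ J (ball w R)) (hinj : InjOn J (ball w R)) {z₀ : ℂ}
    (hz₀ : z₀ ∉ J '' ball w R) : ‖deriv J w‖ * R ≤ 16 * ‖J w - z₀‖ := by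
  have hmap : MapsTo (fun z : ℂ => w + R * z) (ball 0 1) (ball w R) := by
    intro z hz
    rw [mem_ball_zero_iff] at hz
    simp only [mem_ball, dist_eq_norm, add_sub_cancel_left, norm_mul, Complex.norm_real,
      Real.norm_eq_abs, abs_of_pos hR]
    nlinarith
  have hRc : (R : ℂ) ≠ 0 := by exact_mod_cast hR.ne'
  have hw : HasDerivAt J (deriv J w) (w + R * 0) := by
    simpa using (hJ.differentiableAt (ball_mem_nhds w hR)).hasDerivAt
  have haff : HasDerivAt (fun z : ℂ => w + R * z) (R : ℂ) 0 := by
    simpa using ((hasDerivAt_id (0 : ℂ)).const_mul (R : ℂ)).const_add w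
  have hder := ((hw.comp 0 haff).sub_const z₀).deriv
  have := norm_deriv_le_of_forall_ne (h := fun z => J (w + R * z) - z₀)
    ((hJ.comp (by fun_prop) hmap).sub_const z₀)
    (fun z hz z' hz' he => by
      have := hinj (hmap hz) (hmap hz') (sub_left_injective he)
      simpa [hRc] using this)
    (fun z hz he => hz₀ ⟨_, hmap hz, sub_eq_zero.mp he⟩)
  rw [show deriv (fun z => J (w + R * z) - z₀) 0 = _ from hder, norm_mul, Complex.norm_real,
    Real.norm_eq_abs, abs_of_pos hR] at this
  simpa using this

theorem hasDerivAt_symm (J : ℂ ≃ₜ ℂ) {z : ℂ} (hJ : DifferentiableAt ℂ J z) (hd : deriv J z ≠ 0) :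
    HasDerivAt J.symm (deriv J z)⁻¹ (J z) := by
  refine HasDerivAt.of_local_left_inverse J.symm.continuous.continuousAt ?_ hd
    (Eventually.of_forall fun w => J.apply_symm_apply w)
  rw [J.symm_apply_apply]
  exact hJ.hasDerivAt

/-- At a zero of $J'$, either $J'$ vanishes nearby and $J$ is locally constant, or the zero is
isolated. In the second case $J^{-1}$ is holomorphic off $J(z)$ and continuous, so the singularity
is removable and the chain rule gives $1=0$. -/
theorem deriv_ne_zero_of_homeomorph (J : ℂ ≃ₜ ℂ) {z : ℂ} (hJ : AnalyticAt ℂ J z) :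
    deriv J z ≠ 0 := by
  intro h0
  rcases hJ.deriv.eventually_eq_zero_or_eventually_ne_zero with h | h
  · have hev : ∀ᶠ w in 𝓝 z, J w = J z := by
      obtain ⟨ε, hε, hball⟩ := Metric.eventually_nhds_iff_ball.mp
        (h.and hJ.eventually_analyticAt)
      filter_upwards [ball_mem_nhds z hε] with w hw
      exact isOpen_ball.is_const_of_deriv_eq_zero (convex_ball z ε).isPreconnected
        (fun u hu => (hball u hu).2.differentiableAt.differentiableWithinAt)
        (fun u hu => (hball u hu).1) hw (mem_ball_self hε)
    have : ∀ᶠ w in 𝓝[≠] z, False := by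
      filter_upwards [hev.filter_mono nhdsWithin_le_nhds, self_mem_nhdsWithin] with w hw hne
      exact hne (J.injective hw)
    simp only [eventually_false_iff_eq_bot] at this
    exact (inferInstance : (𝓝[≠] z).NeBot).ne this
  · have hda : ∀ᶠ w in 𝓝[≠] (J z), DifferentiableAt ℂ J.symm w := by
      have h1 : ∀ᶠ w in 𝓝[≠] z, DifferentiableAt ℂ J.symm (J w) := by
        filter_upwards [h, hJ.eventually_analyticAt.filter_mono nhdsWithin_le_nhds] with w hw ha
        exact (hasDerivAt_symm J ha.differentiableAt hw).differentiableAt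
      have h2 : Tendsto J.symm (𝓝[≠] (J z)) (𝓝[≠] z) := by
        have hc : ContinuousAt J.symm (J z) := J.symm.continuous.continuousAt
        have hc' : Tendsto J.symm (𝓝[≠] (J z)) (𝓝 z) := by
          simpa [ContinuousAt] using hc.tendsto.mono_left nhdsWithin_le_nhds
        refine tendsto_nhdsWithin_iff.mpr ⟨hc', ?_⟩
        filter_upwards [self_mem_nhdsWithin] with w hw hw'
        rw [mem_singleton_iff] at hw'
        exact hw (by rw [mem_singleton_iff, ← hw', J.apply_symm_apply])
      simpa using h2.eventually h1
    have han : AnalyticAt ℂ J.symm (J z) :=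
      Complex.analyticAt_of_differentiable_on_punctured_nhds_of_continuousAt hda
        J.symm.continuous.continuousAt
    have hcomp := han.differentiableAt.hasDerivAt.comp z hJ.differentiableAt.hasDerivAt
    have hid : HasDerivAt (J.symm ∘ J) 1 z := by
      have : (J.symm ∘ J : ℂ → ℂ) = id := by ext; simp
      rw [this]; exact hasDerivAt_id z
    have := hcomp.unique hid
    rw [h0, mul_zero] at this
    exact zero_ne_one this

/-- A weak form of the bound for the second coefficient of univalent functions. -/
theorem norm_deriv_deriv_mul_le (J : ℂ ≃ₜ ℂ) {w : ℂ} {R : ℝ} (hR : 0 < R)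
    (hJ : DifferentiableOn ℂ J (ball w R)) :
    ‖deriv (deriv J) w‖ * R ≤ 16 * Real.exp 16 * ‖deriv J w‖ := by
  have han : ∀ z ∈ ball w R, AnalyticAt ℂ J z := fun z hz =>
    hJ.analyticAt (isOpen_ball.mem_nhds hz)
  have hd : ∀ z ∈ ball w R, deriv J z ≠ 0 := fun z hz =>
    deriv_ne_zero_of_homeomorph J (han z hz)
  have hwm : w ∈ ball w R := mem_ball_self hR
  have hdw : 0 < ‖deriv J w‖ := norm_pos_iff.mpr (hd w hwm)
  -- If no omitted value were this close, $J^{-1}$ would map a disc of radius $2R|J'(w)|$ into one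
  -- of radius $R$, and the bound on its derivative at the centre would read $2R\le R$.
  obtain ⟨z₀, hz₀, hz₀'⟩ : ∃ z₀, z₀ ∉ J '' ball w R ∧ ‖J w - z₀‖ ≤ 2 * R * ‖deriv J w‖ := by
    by_contra! hcon
    have hsub : ∀ z ∈ ball (J w) (2 * R * ‖deriv J w‖), z ∈ J '' ball w R := by
      intro z hz
      by_contra hz'
      have := hcon z hz'
      rw [mem_ball, dist_eq_norm, norm_sub_rev] at hz
      linarith
    have hmaps : MapsTo J.symm (ball (J w) (2 * R * ‖deriv J w‖)) (closedBall (J.symm (J w)) R) := by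
      intro z hz
      obtain ⟨u, hu, rfl⟩ := hsub z hz
      rw [J.symm_apply_apply, J.symm_apply_apply]
      exact ball_subset_closedBall hu
    have hdiff : DifferentiableOn ℂ J.symm (ball (J w) (2 * R * ‖deriv J w‖)) := by
      intro z hz
      obtain ⟨u, hu, rfl⟩ := hsub z hz
      exact (hasDerivAt_symm J (han u hu).differentiableAt
        (hd u hu)).differentiableAt.differentiableWithinAt
    have := Complex.norm_deriv_le_div_of_mapsTo_ball hdiff hmaps (by positivity)
    rw [(hasDerivAt_symm J (han w hwm).differentiableAt (hd w hwm)).deriv, norm_inv,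
      le_div_iff₀ (by positivity)] at this
    have e : ‖deriv J w‖⁻¹ * (2 * R * ‖deriv J w‖) = 2 * R := by field_simp
    rw [e] at this
    linarith
  -- Koebe in the discs of radius $R/2$ centred on the segment from $w$ to $\zeta$ bounds the
  -- logarithmic derivative of $J-z_0$ along it by $16$ per unit parameter; Grönwall gives $e^{16}$.
  -- The Cauchy estimate on this circle then bounds $J''(w)$.
  have hgrow : ∀ ζ ∈ sphere w (R / 2), ‖J ζ - z₀‖ ≤ Real.exp 16 * ‖J w - z₀‖ := by
    intro ζ hζ
    have hζn : ‖ζ - w‖ = R / 2 := by rwa [mem_sphere, dist_eq_norm] at hζ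
    have hpath : ∀ t ∈ Icc (0 : ℝ) 1, ball (w + t * (ζ - w)) (R / 2) ⊆ ball w R := by
      intro t ht
      refine ball_subset_ball' ?_
      simp only [dist_eq_norm, add_sub_cancel_left, norm_mul, Complex.norm_real, Real.norm_eq_abs,
        abs_of_nonneg ht.1, hζn]
      nlinarith [ht.2]
    have hder : ∀ t ∈ Icc (0 : ℝ) 1, HasDerivAt (fun t : ℝ => J (w + t * (ζ - w)) - z₀)
        (deriv J (w + t * (ζ - w)) * (ζ - w)) t := by
      intro t ht
      have h1 : HasDerivAt (fun t : ℝ => w + (t : ℂ) * (ζ - w)) (ζ - w) t := by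
        simpa using ((Complex.ofRealCLM.hasDerivAt (x := t)).mul_const (ζ - w)).const_add w
      have h2 := (han _ (hpath t ht (mem_ball_self (by linarith)))).differentiableAt.hasDerivAt
      exact (h2.comp t h1).sub_const z₀
    have := norm_le_gronwallBound_of_norm_deriv_right_le
      (f := fun t : ℝ => J (w + t * (ζ - w)) - z₀) (δ := ‖J w - z₀‖) (K := 16) (ε := 0)
      (fun t ht => (hder t ht).continuousAt.continuousWithinAt)
      (fun t ht => (hder t ⟨ht.1, ht.2.le⟩).hasDerivWithinAt) (by simp) (by
        intro t ht
        have hb := hpath t ⟨ht.1, ht.2.le⟩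
        have := norm_deriv_mul_le_of_notMem (half_pos hR) (hJ.mono hb) J.injective.injOn
          (fun h => hz₀ (image_mono hb h))
        rw [norm_mul, hζn]
        linarith) 1 (by simp)
    rw [gronwallBound_ε0] at this
    simp only [Complex.ofReal_one, one_mul, add_sub_cancel, sub_zero, mul_one] at this
    linarith
  have hdc : DiffContOnCl ℂ (fun z => J z - z₀) (ball w (R / 2)) :=
    ((hJ.sub_const z₀).mono (closedBall_subset_ball (by linarith))).diffContOnCl_ball subset_rfl
  have hc := Complex.norm_iteratedDeriv_le_of_forall_mem_sphere_norm_le 2 (half_pos hR) hdc hgrow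
  have e2 : iteratedDeriv 2 (fun z => J z - z₀) w = deriv (deriv J) w := by
    rw [iteratedDeriv_succ, iteratedDeriv_one]
    congr 1
    ext z
    simp
  rw [e2, le_div_iff₀ (by positivity)] at hc
  norm_num [Nat.factorial] at hc
  have h3 : ‖deriv (deriv J) w‖ * (R / 2) ^ 2 ≤
      2 * (Real.exp 16 * (2 * R * ‖deriv J w‖)) := hc.trans (by gcongr)
  have h4 : (‖deriv (deriv J) w‖ * R) * R ≤ (16 * Real.exp 16 * ‖deriv J w‖) * R := by
    nlinarith
  exact le_of_mul_le_mul_right h4 hR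

end Liouville

namespace Liouville

/-! ### Linear fractional transformations -/

theorem det_eq_one (γ : SL(2, ℂ)) : γ 0 0 * γ 1 1 - γ 0 1 * γ 1 0 = 1 := by
  have := γ.det_coe
  rwa [Matrix.det_fin_two] at this

theorem det_eq_one_real (δ : SL(2, ℝ)) : δ 0 0 * δ 1 1 - δ 0 1 * δ 1 0 = 1 := by
  have := δ.det_coe
  rwa [Matrix.det_fin_two] at this

@[simp] theorem toC_apply (δ : SL(2, ℝ)) (i j : Fin 2) : toC δ i j = (δ i j : ℂ) := rfl

theorem mul_apply_two (A B : SL(2, ℂ)) (i j : Fin 2) :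
    (A * B) i j = A i 0 * B 0 j + A i 1 * B 1 j := by
  rw [Matrix.SpecialLinearGroup.coe_mul, Matrix.mul_apply, Fin.sum_univ_two]

theorem mob_mul (A B : SL(2, ℂ)) {z : ℂ} (h : B 1 0 * z + B 1 1 ≠ 0) :
    mob (A * B) z = mob A (mob B z) := by
  have e1 : A 0 0 * mob B z + A 0 1 =
      ((A * B) 0 0 * z + (A * B) 0 1) / (B 1 0 * z + B 1 1) := by
    rw [mob, mul_apply_two, mul_apply_two, eq_div_iff h, add_mul, mul_assoc, div_mul_cancel₀ _ h]
    ring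
  have e2 : A 1 0 * mob B z + A 1 1 =
      ((A * B) 1 0 * z + (A * B) 1 1) / (B 1 0 * z + B 1 1) := by
    rw [mob, mul_apply_two, mul_apply_two, eq_div_iff h, add_mul, mul_assoc, div_mul_cancel₀ _ h]
    ring
  rw [mob, mob, e1, e2, div_div_div_cancel_right₀ h]

theorem denom_mul (A B : SL(2, ℂ)) {z : ℂ} (h : B 1 0 * z + B 1 1 ≠ 0) :
    (A * B) 1 0 * z + (A * B) 1 1 = (A 1 0 * mob B z + A 1 1) * (B 1 0 * z + B 1 1) := by
  rw [mob, mul_apply_two, mul_apply_two]; field_simp; ring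

theorem mobDeriv_mul (A B : SL(2, ℂ)) {z : ℂ} (h : B 1 0 * z + B 1 1 ≠ 0) :
    mobDeriv (A * B) z = mobDeriv A (mob B z) * mobDeriv B z := by
  rw [mobDeriv, mobDeriv, mobDeriv, denom_mul A B h, mul_pow, div_mul_div_comm, one_mul]

@[simp] theorem mob_one (z : ℂ) : mob 1 z = z := by simp [mob]

@[simp] theorem mob_neg (γ : SL(2, ℂ)) (z : ℂ) : mob (-γ) z = mob γ z := by
  simp only [mob, Matrix.SpecialLinearGroup.coe_neg, Matrix.neg_apply]
  rw [← neg_div_neg_eq]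
  congr 1 <;> ring

theorem inv_apply (γ : SL(2, ℂ)) :
    γ⁻¹ 0 0 = γ 1 1 ∧ γ⁻¹ 0 1 = -γ 0 1 ∧ γ⁻¹ 1 0 = -γ 1 0 ∧ γ⁻¹ 1 1 = γ 0 0 := by
  rw [Matrix.SpecialLinearGroup.coe_inv, Matrix.adjugate_fin_two]
  simp

theorem denom_inv_ne_zero {γ : SL(2, ℂ)} {z : ℂ} (h : γ 1 0 * z + γ 1 1 ≠ 0) :
    γ⁻¹ 1 0 * mob γ z + γ⁻¹ 1 1 ≠ 0 := by
  have := denom_mul γ⁻¹ γ h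
  rw [inv_mul_cancel] at this
  intro h0
  rw [h0, zero_mul] at this
  simp at this

theorem mob_inv_mob {γ : SL(2, ℂ)} {z : ℂ} (h : γ 1 0 * z + γ 1 1 ≠ 0) :
    mob γ⁻¹ (mob γ z) = z := by
  rw [← mob_mul _ _ h, inv_mul_cancel, mob_one]

theorem mobDeriv_ne_zero {γ : SL(2, ℂ)} {z : ℂ} (h : γ 1 0 * z + γ 1 1 ≠ 0) :
    mobDeriv γ z ≠ 0 := one_div_ne_zero (pow_ne_zero 2 h)

/-- Two transformations agree on three points only if they are equal up to sign. -/
theorem eq_one_or_of_mob_eq {γ : SL(2, ℂ)} {S : Set ℂ} (hS : S.Infinite)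
    (h : ∀ z ∈ S, γ 1 0 * z + γ 1 1 ≠ 0 ∧ mob γ z = z) : γ = 1 ∨ γ = -1 := by
  have hroot : ∀ z ∈ S, γ 1 0 * z ^ 2 + (γ 1 1 - γ 0 0) * z - γ 0 1 = 0 := by
    intro z hz
    obtain ⟨h1, h2⟩ := h z hz
    rw [mob, div_eq_iff h1] at h2
    linear_combination -h2
  obtain ⟨x, hx⟩ := hS.nonempty
  obtain ⟨y, hy, hyx⟩ := (hS.sdiff (finite_singleton x)).nonempty
  obtain ⟨z, hz, hzy⟩ := (hS.sdiff ((finite_singleton x).insert y)).nonempty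
  simp only [mem_insert_iff, mem_singleton_iff, not_or] at hyx hzy
  have hxy : x - y ≠ 0 := sub_ne_zero.mpr fun h => hyx h.symm
  have hxz : x - z ≠ 0 := sub_ne_zero.mpr fun h => hzy.2 h.symm
  have hyz : y - z ≠ 0 := sub_ne_zero.mpr fun h => hzy.1 h.symm
  have e1 := hroot x hx
  have e2 := hroot y hy
  have e3 := hroot z hz
  have f1 : γ 1 0 * (x + y) + (γ 1 1 - γ 0 0) = 0 := by
    apply mul_left_cancel₀ hxy; linear_combination e1 - e2
  have f2 : γ 1 0 * (x + z) + (γ 1 1 - γ 0 0) = 0 := by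
    apply mul_left_cancel₀ hxz; linear_combination e1 - e3
  have hc : γ 1 0 = 0 := by apply mul_left_cancel₀ hyz; linear_combination f1 - f2
  have hd : γ 1 1 = γ 0 0 := by rw [hc] at f1; linear_combination f1
  have hb : γ 0 1 = 0 := by rw [hc, hd] at e1; linear_combination -e1
  have hdet := det_eq_one γ
  rw [hd, hb] at hdet
  have : γ 0 0 = 1 ∨ γ 0 0 = -1 := mul_self_eq_one_iff.mp (by linear_combination hdet)
  refine this.imp (fun h => ?_) (fun h => ?_)
  all_goals
    ext i j
    fin_cases i <;> fin_cases j <;> simp [hb, hc, hd, h]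

theorem toC_neg (δ : SL(2, ℝ)) : toC (-δ) = -toC δ := by
  ext i j; simp

theorem toC_injective : Function.Injective toC := by
  intro A B h
  ext i j
  have := congrArg (fun M : SL(2, ℂ) => M i j) h
  simpa using this

theorem denom_ne_zero (δ : SL(2, ℝ)) {z : ℂ} (hz : z.im ≠ 0) :
    toC δ 1 0 * z + toC δ 1 1 ≠ 0 := by
  intro h
  have h1 := congrArg Complex.im h
  have h2 := congrArg Complex.re h
  simp at h1 h2
  have hc : δ 1 0 = 0 := h1.resolve_right hz
  have hdet := det_eq_one_real δ
  rw [hc] at h2 hdet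
  simp at h2
  rw [h2] at hdet
  simp at hdet

theorem mob_im (δ : SL(2, ℝ)) {z : ℂ} (hz : z.im ≠ 0) :
    (mob (toC δ) z).im = z.im * ‖mobDeriv (toC δ) z‖ := by
  have hd := denom_ne_zero δ hz
  rw [mobDeriv, norm_div, norm_one, norm_pow, ← Complex.normSq_eq_norm_sq, mob, Complex.div_im]
  have hn : Complex.normSq (toC δ 1 0 * z + toC δ 1 1) ≠ 0 := by
    rwa [Ne, Complex.normSq_eq_zero]
  rw [← sub_div, mul_one_div]
  congr 1
  simp
  linear_combination z.im * det_eq_one_real δ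

theorem mob_conj (δ : SL(2, ℝ)) (z : ℂ) : mob (toC δ) (conj z) = conj (mob (toC δ) z) := by
  simp [mob]

theorem continuousAt_mob {γ : SL(2, ℂ)} {z : ℂ} (h : γ 1 0 * z + γ 1 1 ≠ 0) :
    ContinuousAt (mob γ) z := (hasDerivAt_mob γ z h).continuousAt

/-! ### Half planes -/

/-- `S` is the upper or the lower half plane. -/
def IsHalfPlane (S : Set ℂ) : Prop := S = U ∨ S = L

namespace IsHalfPlane

variable {S : Set ℂ} (hS : IsHalfPlane S)
include hS

theorem isOpen : IsOpen S := by
  rcases hS with rfl | rfl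
  · exact isOpen_lt continuous_const Complex.continuous_im
  · exact isOpen_lt Complex.continuous_im continuous_const

theorem im_ne_zero {z : ℂ} (hz : z ∈ S) : z.im ≠ 0 := by
  rcases hS with rfl | rfl
  · exact (show 0 < z.im from hz).ne'
  · exact (show z.im < 0 from hz).ne

theorem abs_im_pos {z : ℂ} (hz : z ∈ S) : 0 < |z.im| := abs_pos.mpr (hS.im_ne_zero hz)

theorem mem_of_im {z w : ℂ} (hz : z ∈ S) {k : ℝ} (hk : 0 < k) (hw : w.im = z.im * k) : w ∈ S := by
  rcases hS with rfl | rfl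
  · change 0 < z.im at hz
    change 0 < w.im
    rw [hw]; positivity
  · change z.im < 0 at hz
    change w.im < 0
    rw [hw]; nlinarith

theorem ball_subset {z : ℂ} (hz : z ∈ S) : ball z |z.im| ⊆ S := by
  intro w hw
  have h1 := (Complex.abs_im_le_norm (w - z)).trans_lt (by simpa [dist_eq_norm] using hw)
  rw [Complex.sub_im, abs_lt] at h1
  rcases hS with rfl | rfl
  · change 0 < z.im at hz
    change 0 < w.im
    rw [abs_of_pos hz] at h1; linarith
  · change z.im < 0 at hz
    change w.im < 0
    rw [abs_of_neg hz] at h1; linarith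

theorem mob_mem (δ : SL(2, ℝ)) {z : ℂ} (hz : z ∈ S) : mob (toC δ) z ∈ S :=
  hS.mem_of_im hz (norm_pos_iff.mpr (mobDeriv_ne_zero (denom_ne_zero δ (hS.im_ne_zero hz))))
    (mob_im δ (hS.im_ne_zero hz))

theorem ofReal_notMem (x : ℝ) : (x : ℂ) ∉ S := fun h => hS.im_ne_zero h (Complex.ofReal_im x)

theorem zero_notMem : (0 : ℂ) ∉ S := fun h => hS.im_ne_zero h rfl

theorem subset_union : S ⊆ U ∪ L := by
  rcases hS with rfl | rfl
  · exact subset_union_left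
  · exact subset_union_right

theorem infinite : S.Infinite := by
  have : S.Nonempty := by
    rcases hS with rfl | rfl
    · exact ⟨Complex.I, by simp [U]⟩
    · exact ⟨-Complex.I, by simp [L]⟩
  obtain ⟨z, hz⟩ := this
  exact infinite_of_mem_nhds z (hS.isOpen.mem_nhds hz)

theorem eq_one_or_of_mob_eq {δ : SL(2, ℝ)} (h : ∀ z ∈ S, mob (toC δ) z = z) : δ = 1 ∨ δ = -1 := by
  have := Liouville.eq_one_or_of_mob_eq hS.infinite
    fun z hz => ⟨denom_ne_zero δ (hS.im_ne_zero hz), h z hz⟩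
  refine this.imp (fun h => toC_injective (by simpa using h)) fun h => toC_injective ?_
  rw [h, toC_neg, map_one]

end IsHalfPlane

end Liouville

/-! ### The components of the region of discontinuity and their hyperbolic density -/

namespace Liouville

theorem countable_of_discrete (G : Subgroup SL(2, ℝ)) (h : DiscreteTopology G) : Countable G := by
  have : SecondCountableTopology (Matrix (Fin 2) (Fin 2) ℝ) :=
    inferInstanceAs (SecondCountableTopology (Fin 2 → Fin 2 → ℝ))
  have : SecondCountableTopology SL(2, ℝ) :=
    TopologicalSpace.Subtype.secondCountableTopology {A : Matrix (Fin 2) (Fin 2) ℝ | A.det = 1}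
  exact countable_of_Lindelof_of_discrete

variable {g n r : ℕ}

namespace QuasiFuchsian

variable {m : Fin r → ℕ} {Q : QuasiFuchsian g n r m}

variable (Q) in
/-- `J` maps the half plane `S` conformally onto a component of the region of discontinuity,
conjugating the cofinite Fuchsian group `G` to the quasi-Fuchsian group. -/
structure IsComponent (G : Subgroup SL(2, ℝ)) (J : ℂ ≃ₜ ℂ) (S : Set ℂ) : Prop where
  halfPlane : IsHalfPlane S
  holo : DifferentiableOn ℂ J S
  rho_eq : ∀ z ∈ J '' S, Q.rho z = ‖deriv J.symm z‖ ^ 2 / (J.symm z).im ^ 2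
  map_zero : J 0 = 0
  exists_conj : ∀ δ ∈ G, ∃ γ ∈ Q.Γ, ∀ z ∈ S, J (mob (toC δ) z) = mob γ (J z)
  exists_inv_conj : ∀ γ ∈ Q.Γ, ∃ δ ∈ G, ∀ z ∈ S, J (mob (toC δ) z) = mob γ (J z)
  countable : Countable G
  area : ∃ D ⊆ S, MeasureTheory.NullMeasurableSet D ∧
    (∀ᵐ z, z ∈ S → ∃ δ ∈ G, mob (toC δ) z ∈ D) ∧
    ∫⁻ z in D, ENNReal.ofReal (1 / z.im ^ 2) < ⊤

theorem isComponent₁ (Q : QuasiFuchsian g n r m) : Q.IsComponent Q.Γ₁ Q.J₁ U where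
  halfPlane := .inl rfl
  holo := Q.holo₁
  rho_eq z hz := if_pos hz
  map_zero := Q.fix₁.1
  exists_conj δ hδ := by
    obtain ⟨γ, hγ, h⟩ := Q.conj₁ δ hδ
    exact ⟨γ, hγ, fun z hz => h z (.inl hz)⟩
  exists_inv_conj γ hγ := by
    obtain ⟨δ, hδ, h⟩ := Q.conj₁' γ hγ
    exact ⟨δ, hδ, fun z hz => h z (.inl hz)⟩
  countable := countable_of_discrete _ Q.fuchsian₁.discrete
  area := by
    obtain ⟨D, hD, hfin⟩ := Q.fuchsian₁.cofinite
    refine ⟨D, hD.subset, hD.nullMeasurable, ?_, hfin⟩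
    filter_upwards [hD.ae_covers] with z h hz
    obtain ⟨γ, ⟨δ, hδ, rfl⟩, hz⟩ := h hz
    exact ⟨δ, hδ, hz⟩

theorem isComponent₂ (Q : QuasiFuchsian g n r m) : Q.IsComponent Q.Γ₂ Q.J₂ L where
  halfPlane := .inr rfl
  holo := Q.holo₂
  rho_eq z hz := by
    refine if_neg fun hz' => ?_
    rw [Ω₁, ← Q.image_U] at hz'
    obtain ⟨w, hw, rfl⟩ := hz
    rw [Q.J₂.injective.mem_set_image] at hz'
    exact lt_asymm (show 0 < w.im from hz') hw
  map_zero := Q.fix₂.1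
  exists_conj δ hδ := by
    obtain ⟨γ, hγ, h⟩ := Q.conj₂ δ hδ
    exact ⟨γ, hγ, fun z hz => h z (.inr hz)⟩
  exists_inv_conj γ hγ := by
    obtain ⟨δ, hδ, h⟩ := Q.conj₂' γ hγ
    exact ⟨δ, hδ, fun z hz => h z (.inr hz)⟩
  countable := countable_of_discrete _ Q.fuchsian₂.discrete
  area := by
    obtain ⟨D, hD, hfin⟩ := Q.fuchsian₂.cofinite
    have hmp : MeasureTheory.MeasurePreserving (conj : ℂ → ℂ) := Complex.conjLIE.measurePreserving
    have hme : MeasurableEmbedding (conj : ℂ → ℂ) :=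
      Complex.conjLIE.toHomeomorph.measurableEmbedding
    refine ⟨conj ⁻¹' D, fun z hz => ?_, hD.nullMeasurable.preimage hmp.quasiMeasurePreserving,
      ?_, ?_⟩
    · have := hD.subset hz
      change 0 < (conj z).im at this
      rw [Complex.conj_im] at this
      exact neg_pos.mp this
    · filter_upwards [hmp.quasiMeasurePreserving.ae hD.ae_covers] with z h hz
      obtain ⟨γ, ⟨δ, hδ, rfl⟩, hz⟩ := h (show 0 < (conj z).im by
        rw [Complex.conj_im]; exact neg_pos.mpr hz)
      exact ⟨δ, hδ, by rwa [mem_preimage, ← mob_conj]⟩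
    · have := hmp.setLIntegral_comp_preimage_emb hme
        (fun z : ℂ => ENNReal.ofReal (1 / z.im ^ 2)) D
      simp only [Complex.conj_im, neg_sq] at this
      rwa [this]

namespace IsComponent

variable {G : Subgroup SL(2, ℝ)} {J : ℂ ≃ₜ ℂ} {S : Set ℂ} (C : Q.IsComponent G J S)

include C

theorem isOpen_image : IsOpen (J '' S) := J.isOpenMap _ C.halfPlane.isOpen

theorem analyticAt {w : ℂ} (hw : w ∈ S) : AnalyticAt ℂ J w :=
  C.holo.analyticAt (C.halfPlane.isOpen.mem_nhds hw)

theorem deriv_ne_zero {w : ℂ} (hw : w ∈ S) : deriv J w ≠ 0 :=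
  deriv_ne_zero_of_homeomorph J (C.analyticAt hw)

theorem hasDerivAt_symm {w : ℂ} (hw : w ∈ S) : HasDerivAt J.symm (deriv J w)⁻¹ (J w) :=
  Liouville.hasDerivAt_symm J (C.analyticAt hw).differentiableAt (C.deriv_ne_zero hw)

theorem differentiableOn_symm : DifferentiableOn ℂ J.symm (J '' S) := by
  rintro _ ⟨w, hw, rfl⟩
  exact (C.hasDerivAt_symm hw).differentiableAt.differentiableWithinAt

theorem zero_notMem : (0 : ℂ) ∉ J '' S := by
  rw [← C.map_zero, J.injective.mem_set_image]
  exact C.halfPlane.zero_notMem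

theorem rho_pos {w : ℂ} (hw : w ∈ S) : 0 < Q.rho (J w) := by
  rw [C.rho_eq _ (mem_image_of_mem J hw), J.symm_apply_apply, (C.hasDerivAt_symm hw).deriv]
  have h1 := norm_pos_iff.mpr (inv_ne_zero (C.deriv_ne_zero hw))
  have h2 := C.halfPlane.im_ne_zero hw
  positivity

theorem exp_phi {w : ℂ} (hw : w ∈ S) :
    Real.exp (Q.phi (J w)) = (‖deriv J w‖ * |w.im|)⁻¹ ^ 2 := by
  rw [phi, Real.exp_log (C.rho_pos hw), C.rho_eq _ (mem_image_of_mem J hw), J.symm_apply_apply,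
    (C.hasDerivAt_symm hw).deriv, norm_inv, mul_inv, mul_pow, inv_pow |w.im|, sq_abs, div_eq_mul_inv]

theorem exp_half_phi {w : ℂ} (hw : w ∈ S) :
    Real.exp (Q.phi (J w) / 2) = (‖deriv J w‖ * |w.im|)⁻¹ := by
  have h := C.exp_phi hw
  have e : Real.exp (Q.phi (J w)) = Real.exp (Q.phi (J w) / 2) ^ 2 := by
    rw [← Real.exp_nat_mul]; congr 1; push_cast; ring
  rw [e] at h
  exact (pow_left_inj₀ (by positivity) (by positivity) two_ne_zero).mp h

theorem exp_neg_half_phi {w : ℂ} (hw : w ∈ S) :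
    Real.exp (-(Q.phi (J w) / 2)) = ‖deriv J w‖ * |w.im| := by
  rw [Real.exp_neg, C.exp_half_phi hw, inv_inv]

/-- The conformal radius is at most comparable to the distance to the boundary. -/
theorem exp_neg_half_phi_le {z z₀ : ℂ} (hz : z ∈ J '' S) (hz₀ : z₀ ∉ J '' S) :
    Real.exp (-(Q.phi z / 2)) ≤ 16 * ‖z - z₀‖ := by
  obtain ⟨w, hw, rfl⟩ := hz
  rw [C.exp_neg_half_phi hw]
  have hsub := C.halfPlane.ball_subset hw
  exact norm_deriv_mul_le_of_notMem (C.halfPlane.abs_im_pos hw) (C.holo.mono hsub)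
    J.injective.injOn fun h => hz₀ (image_mono hsub h)

theorem contDiffOn_rho : ContDiffOn ℝ ∞ Q.rho (J '' S) := by
  have h1 : ContDiffOn ℝ ∞ (deriv J.symm) (J '' S) :=
    ((C.differentiableOn_symm.deriv C.isOpen_image).contDiffOn C.isOpen_image).restrict_scalars ℝ
  have h2 : ContDiffOn ℝ ∞ (fun z => (J.symm z).im) (J '' S) :=
    Complex.imCLM.contDiff.comp_contDiffOn
      ((C.differentiableOn_symm.contDiffOn C.isOpen_image).restrict_scalars ℝ)
  refine ((h1.norm_sq ℝ).div (h2.pow 2) ?_).congr C.rho_eq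
  rintro _ ⟨w, hw, rfl⟩
  rw [J.symm_apply_apply]
  exact pow_ne_zero 2 (C.halfPlane.im_ne_zero hw)

theorem contDiffOn_phi : ContDiffOn ℝ ∞ Q.phi (J '' S) := by
  refine C.contDiffOn_rho.log ?_
  rintro _ ⟨w, hw, rfl⟩
  exact (C.rho_pos hw).ne'

theorem continuousOn_phi : ContinuousOn Q.phi (J '' S) := C.contDiffOn_phi.continuousOn

/-- With the convention $x/0=0$, a vanishing denominator would make `mob γ z` equal to $0=J(0)$. The
conjugacy puts this value in $J(S)$, whereas $0$ lies on the boundary of $S$. -/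
theorem denom_ne_zero {γ : SL(2, ℂ)} (hγ : γ ∈ Q.Γ) {z : ℂ} (hz : z ∈ J '' S) :
    γ 1 0 * z + γ 1 1 ≠ 0 := by
  obtain ⟨w, hw, rfl⟩ := hz
  obtain ⟨δ, hδ, h⟩ := C.exists_inv_conj γ hγ
  intro h0
  have h1 := h w hw
  rw [show mob γ (J w) = J 0 by rw [mob, h0, div_zero, C.map_zero]] at h1
  have := C.halfPlane.mob_mem δ hw
  rw [J.injective h1] at this
  exact C.halfPlane.zero_notMem this

theorem mob_mem {γ : SL(2, ℂ)} (hγ : γ ∈ Q.Γ) {z : ℂ} (hz : z ∈ J '' S) : mob γ z ∈ J '' S := by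
  obtain ⟨w, hw, rfl⟩ := hz
  obtain ⟨δ, hδ, h⟩ := C.exists_inv_conj γ hγ
  rw [← h w hw]
  exact mem_image_of_mem J (C.halfPlane.mob_mem δ hw)

/-- Invariance of the hyperbolic metric: differentiate $J\circ\delta=\gamma\circ J$ and use
$\operatorname{Im}\delta w=\operatorname{Im}w\,|\delta'(w)|$. -/
theorem phi_mob {γ : SL(2, ℂ)} (hγ : γ ∈ Q.Γ) {z : ℂ} (hz : z ∈ J '' S) :
    Real.exp (-(Q.phi (mob γ z) / 2)) = ‖mobDeriv γ z‖ * Real.exp (-(Q.phi z / 2)) := by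
  have hd := C.denom_ne_zero hγ hz
  obtain ⟨w, hw, rfl⟩ := hz
  obtain ⟨δ, hδ, h⟩ := C.exists_inv_conj γ hγ
  have hw' := C.halfPlane.mob_mem δ hw
  have him := C.halfPlane.im_ne_zero hw
  rw [← h w hw, C.exp_neg_half_phi hw, C.exp_neg_half_phi hw', mob_im δ him, abs_mul, abs_norm]
  have h1 := (C.analyticAt hw').differentiableAt.hasDerivAt.comp w
    (hasDerivAt_mob (toC δ) w (Liouville.denom_ne_zero δ him))
  have h2 := (hasDerivAt_mob γ (J w) hd).comp w (C.analyticAt hw).differentiableAt.hasDerivAt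
  have h3 : J ∘ mob (toC δ) =ᶠ[𝓝 w] mob γ ∘ J := by
    filter_upwards [C.halfPlane.isOpen.mem_nhds hw] with u hu using h u hu
  have h4 := congrArg norm (h1.unique (h2.congr_of_eventuallyEq h3))
  rw [norm_mul, norm_mul] at h4
  linear_combination |w.im| * h4

/-- With $f=J^{-1}$ and $M=e^{\varphi/2}$, the derivative of $\log|f'|^2$ is at most
$2|f''/f'|=2|J''|/|J'|^2\le 32e^{16}M$ by the second coefficient bound on the disc of radius
$|\operatorname{Im}w|$. The derivative of $2\log|\operatorname{Im}f|$ is at most $2M$. -/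
theorem norm_phiZ_sq_le {z : ℂ} (hz : z ∈ J '' S) :
    ‖Q.phiZ z‖ ^ 2 ≤ (32 * Real.exp 16 + 2) ^ 2 * Real.exp (Q.phi z) := by
  have hzn : J '' S ∈ 𝓝 z := C.isOpen_image.mem_nhds hz
  have hfz : HasDerivAt J.symm (deriv J.symm z) z :=
    (C.differentiableOn_symm.differentiableAt hzn).hasDerivAt
  have hgz : HasDerivAt (deriv J.symm) (deriv (deriv J.symm) z) z :=
    ((C.differentiableOn_symm.deriv C.isOpen_image).differentiableAt hzn).hasDerivAt
  obtain ⟨w, hw, rfl⟩ := hz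
  have hJ := C.deriv_ne_zero hw
  have him := C.halfPlane.im_ne_zero hw
  have hf1 : deriv J.symm (J w) = (deriv J w)⁻¹ := (C.hasDerivAt_symm hw).deriv
  set a := deriv J w with ha
  set b := deriv (deriv J) w with hb
  have hf2 : deriv (deriv J.symm) (J w) = -(b * a⁻¹) / a ^ 2 := by
    have hbw : HasDerivAt (deriv J) b (J.symm (J w)) := by
      rw [J.symm_apply_apply]
      exact (C.analyticAt hw).deriv.differentiableAt.hasDerivAt
    have h1 := (hbw.comp (J w) (C.hasDerivAt_symm hw)).inv (by simpa using hJ)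
    have h2 : deriv J.symm =ᶠ[𝓝 (J w)] (deriv J ∘ J.symm)⁻¹ := by
      filter_upwards [hzn] with u hu
      obtain ⟨v, hv, rfl⟩ := hu
      simp [(C.hasDerivAt_symm hv).deriv]
    rw [(h1.congr_of_eventuallyEq h2).deriv]
    simp [ha]
  have hK2 : ‖b‖ * |w.im| ≤ 16 * Real.exp 16 * ‖a‖ :=
    norm_deriv_deriv_mul_le J (C.halfPlane.abs_im_pos hw) (C.holo.mono (C.halfPlane.ball_subset hw))
  set M := (‖a‖ * |w.im|)⁻¹ with hM
  have hapos : 0 < ‖a‖ := norm_pos_iff.mpr hJ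
  have hipos : 0 < |w.im| := abs_pos.mpr him
  have hMpos : 0 < M := by positivity
  have hfd : ∀ v : ℂ, ‖v‖ = 1 → |fderiv ℝ Q.phi (J w) v| ≤ (32 * Real.exp 16 + 2) * M := by
    intro v hv
    have hn : HasFDerivAt (fun z => ‖deriv J.symm z‖ ^ 2) _ (J w) :=
      HasFDerivAt.norm_sq (hgz.hasFDerivAt.restrictScalars ℝ)
    have hi : HasFDerivAt (fun z => (J.symm z).im) _ (J w) :=
      Complex.imCLM.hasFDerivAt.comp (J w) (hfz.hasFDerivAt.restrictScalars ℝ)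
    have hg0 : ‖deriv J.symm (J w)‖ ^ 2 ≠ 0 := by
      rw [hf1]; simpa using hJ
    have hi0 : (J.symm (J w)).im ≠ 0 := by rwa [J.symm_apply_apply]
    have hphi := (hn.log hg0).sub ((hi.log hi0).const_mul 2)
    -- `Real.log` is even, so the formula also holds on the lower half plane, where the imaginary
    -- part is negative.
    have heq : Q.phi =ᶠ[𝓝 (J w)] fun z =>
        Real.log (‖deriv J.symm z‖ ^ 2) - 2 * Real.log (J.symm z).im := by
      filter_upwards [hzn] with u hu
      rw [phi, C.rho_eq u hu]
      obtain ⟨x, hx, rfl⟩ := hu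
      rw [Real.log_div, Real.log_pow ((J.symm (J x)).im)]
      · norm_num
      · rw [(C.hasDerivAt_symm hx).deriv]; simpa using C.deriv_ne_zero hx
      · rw [J.symm_apply_apply]; exact pow_ne_zero 2 (C.halfPlane.im_ne_zero hx)
    rw [(hphi.congr_of_eventuallyEq heq).fderiv]
    simp only [sub_apply, smul_apply,
      ContinuousLinearMap.comp_apply, ContinuousLinearMap.coe_restrictScalars',
      ContinuousLinearMap.toSpanSingleton_apply, Complex.imCLM_apply, smul_eq_mul,
      innerSL_apply_apply, hf1, hf2, J.symm_apply_apply, nsmul_eq_mul]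
    refine (abs_sub _ _).trans ?_
    have e1 : |(‖a⁻¹‖ ^ 2)⁻¹ * ((2 : ℕ) * inner ℝ a⁻¹ (v * (-(b * a⁻¹) / a ^ 2)))| ≤
        32 * Real.exp 16 * M := by
      rw [abs_mul, abs_mul]
      have := abs_real_inner_le_norm a⁻¹ (v * (-(b * a⁻¹) / a ^ 2))
      rw [norm_mul, hv, one_mul, norm_div, norm_neg, norm_mul, norm_pow, norm_inv] at this
      rw [norm_inv, abs_of_pos (by positivity)]
      have hb' : ‖b‖ ≤ 16 * Real.exp 16 * ‖a‖ / |w.im| := by rwa [le_div_iff₀ hipos]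
      calc _ ≤ (‖a‖⁻¹ ^ 2)⁻¹ * (2 * (‖a‖⁻¹ * (‖b‖ * ‖a‖⁻¹ / ‖a‖ ^ 2))) := by
            gcongr
            simp
        _ ≤ (‖a‖⁻¹ ^ 2)⁻¹ * (2 * (‖a‖⁻¹ *
            ((16 * Real.exp 16 * ‖a‖ / |w.im|) * ‖a‖⁻¹ / ‖a‖ ^ 2))) := by gcongr
        _ = _ := by rw [hM]; field_simp; ring
    have e2 : |2 * (w.im⁻¹ * (v * a⁻¹).im)| ≤ 2 * M := by
      rw [abs_mul, abs_mul, abs_inv, abs_of_pos (two_pos : (0 : ℝ) < 2), hM, mul_inv, mul_comm ‖a‖⁻¹]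
      gcongr
      refine (Complex.abs_im_le_norm _).trans ?_
      rw [norm_mul, hv, one_mul, norm_inv]
    linarith [e1, e2]
  have h1 := hfd 1 (by simp)
  have hI := hfd Complex.I (by simp)
  have hb1 : ‖Q.phiZ (J w)‖ ≤ (32 * Real.exp 16 + 2) * M := by
    rw [phiZ, norm_div, Complex.norm_two, div_le_iff₀ two_pos]
    refine (norm_sub_le _ _).trans ?_
    rw [norm_mul, Complex.norm_I, one_mul, Complex.norm_real, Complex.norm_real, Real.norm_eq_abs,
      Real.norm_eq_abs]
    linarith
  rw [C.exp_phi hw, ← ha, ← hM, ← mul_pow]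
  gcongr

end IsComponent

end QuasiFuchsian

end Liouville

namespace Liouville

open MeasureTheory

/-! ### Hyperbolic area -/

theorem abs_det_mul (a : ℂ) :
    |((ContinuousLinearMap.toSpanSingleton ℂ a).restrictScalars ℝ).det| = ‖a‖ ^ 2 := by
  simp [ContinuousLinearMap.det, LinearMap.det_restrictScalars, Algebra.norm_complex_eq,
    Complex.normSq_eq_norm_sq]

theorem lintegral_image_eq {f f' : ℂ → ℂ} {T : Set ℂ} (hT : MeasurableSet T)
    (hf : ∀ z ∈ T, HasDerivAt f (f' z) z) (hinj : InjOn f T) (g : ℂ → ENNReal) :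
    ∫⁻ z in f '' T, g z = ∫⁻ z in T, ENNReal.ofReal (‖f' z‖ ^ 2) * g (f z) := by
  rw [lintegral_image_eq_lintegral_abs_det_fderiv_mul volume hT
    (fun z hz => ((hf z hz).hasFDerivAt.restrictScalars ℝ).hasFDerivWithinAt) hinj]
  simp only [abs_det_mul]

/-- The hyperbolic area on the upper and the lower half plane. -/
def hypArea : Measure ℂ := volume.withDensity fun z => ENNReal.ofReal (1 / z.im ^ 2)

theorem hypArea_apply (T : Set ℂ) : hypArea T = ∫⁻ z in T, ENNReal.ofReal (1 / z.im ^ 2) :=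
  withDensity_apply' _ T

theorem measurable_mob (γ : SL(2, ℂ)) : Measurable (mob γ) := by
  unfold mob
  fun_prop

theorem injOn_mob (δ : SL(2, ℝ)) {S : Set ℂ} (hS : IsHalfPlane S) :
    InjOn (mob (toC δ)) S := fun z hz w hw h => by
  have := congrArg (mob (toC δ)⁻¹) h
  rwa [mob_inv_mob (denom_ne_zero δ (hS.im_ne_zero hz)),
    mob_inv_mob (denom_ne_zero δ (hS.im_ne_zero hw))] at this

theorem measurableSet_mob_image (δ : SL(2, ℝ)) {S T : Set ℂ} (hS : IsHalfPlane S)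
    (hTS : T ⊆ S) (hT : MeasurableSet T) : MeasurableSet (mob (toC δ) '' T) :=
  hT.image_of_continuousOn_injOn (fun _z hz => (continuousAt_mob
    (denom_ne_zero δ (hS.im_ne_zero (hTS hz)))).continuousWithinAt) ((injOn_mob δ hS).mono hTS)

theorem hypArea_mob_image (δ : SL(2, ℝ)) {S T : Set ℂ} (hS : IsHalfPlane S)
    (hTS : T ⊆ S) (hT : MeasurableSet T) : hypArea (mob (toC δ) '' T) = hypArea T := by
  rw [hypArea_apply, hypArea_apply, lintegral_image_eq hT
    (fun z hz => hasDerivAt_mob _ z (denom_ne_zero δ (hS.im_ne_zero (hTS hz))))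
    ((injOn_mob δ hS).mono hTS)]
  refine setLIntegral_congr_fun hT fun z hz => ?_
  have him := hS.im_ne_zero (hTS hz)
  have hd := norm_pos_iff.mpr (mobDeriv_ne_zero (denom_ne_zero δ him))
  rw [← ENNReal.ofReal_mul (by positivity), mob_im δ him]
  congr 1
  field_simp

theorem volume_image_eq_zero {f : ℂ → ℂ} {T : Set ℂ} (hf : ∀ z ∈ T, DifferentiableAt ℝ f z)
    (hT : volume T = 0) : volume (f '' T) = 0 :=
  addHaar_image_eq_zero_of_differentiableOn_of_addHaar_eq_zero volume
    (fun z hz => (hf z hz).differentiableWithinAt) hT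

/-- A set whose translates do not overlap has at most the area of a set whose translates cover. -/
theorem hypArea_le_of_packing {G : Subgroup SL(2, ℝ)} (hG : Countable G) {S T D : Set ℂ}
    (hS : IsHalfPlane S) (hTS : T ⊆ S) (hT : MeasurableSet T) (hD : MeasurableSet D)
    (hcov : ∀ᵐ z, z ∈ S → ∃ δ ∈ G, mob (toC δ) z ∈ D)
    (hdisj : ∀ δ ∈ G, δ ≠ 1 → δ ≠ -1 → volume (T ∩ mob (toC δ) '' T) = 0) :
    hypArea T ≤ hypArea D := by
  have hac : hypArea ≪ volume := withDensity_absolutelyContinuous _ _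
  -- The index set consists of transformations rather than matrices: $\delta$ and $-\delta$ act
  -- alike, and counting both would destroy the disjointness of the translates.
  let ι : Set (ℂ → ℂ) := range fun δ : G => mob (toC δ.1)
  have hι : Countable ι := (countable_range _).to_subtype
  have hpre (i : ι) : hypArea (T ∩ i.1 ⁻¹' D) = hypArea (i.1 '' T ∩ D) := by
    obtain ⟨_, δ, rfl⟩ := i
    simp only
    rw [← image_inter_preimage, hypArea_mob_image δ.1 hS (inter_subset_left.trans hTS)
      (hT.inter (measurable_mob _ hD))]
  have hdis : Pairwise fun i j : ι => AEDisjoint hypArea (i.1 '' T ∩ D) (j.1 '' T ∩ D) := by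
    rintro ⟨_, δ, rfl⟩ ⟨_, δ', rfl⟩ hij
    refine AEDisjoint.mono (s := mob (toC δ.1) '' T) (t := mob (toC δ'.1) '' T) ?_
      inter_subset_left inter_subset_left
    refine hac ?_
    have h1 : volume (T ∩ mob (toC (δ.1⁻¹ * δ'.1)) '' T) = 0 := by
      refine hdisj _ (G.mul_mem (G.inv_mem δ.2) δ'.2) (fun h => ?_) (fun h => ?_)
      · have e : δ.1 = δ'.1 := inv_mul_eq_one.mp h
        refine hij (Subtype.ext (funext fun z => ?_))
        simp only [e]
      · have e : δ'.1 = -δ.1 := by rw [inv_mul_eq_iff_eq_mul.mp h, mul_neg_one]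
        refine hij (Subtype.ext (funext fun z => ?_))
        simp only [e, toC_neg, mob_neg]
    have h2 := volume_image_eq_zero (f := mob (toC δ.1)) (fun z hz =>
      ((hasDerivAt_mob _ z (denom_ne_zero δ.1 (hS.im_ne_zero
        (hTS hz.1)))).differentiableAt.restrictScalars ℝ)) h1
    refine measure_mono_null ?_ h2
    rintro _ ⟨⟨z, hz, rfl⟩, w, hw, hwz⟩
    refine ⟨z, ⟨hz, w, hw, ?_⟩, rfl⟩
    have hw' := hS.im_ne_zero (hTS hw)
    rw [map_mul, mob_mul _ _ (denom_ne_zero _ hw'), hwz, map_inv,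
      mob_inv_mob (denom_ne_zero _ (hS.im_ne_zero (hTS hz)))]
  -- Unfolding: $T$ is cut into the pieces carried into $D$ by the various transformations. Moved
  -- there by isometries, these pieces become almost disjoint subsets of $D$.
  calc hypArea T ≤ hypArea (⋃ i : ι, T ∩ i.1 ⁻¹' D) := by
        refine measure_mono_ae ?_
        filter_upwards [hac.ae_le hcov] with z hz hzT
        obtain ⟨δ, hδ, h⟩ := hz (hTS hzT)
        exact mem_iUnion.mpr ⟨⟨_, ⟨δ, hδ⟩, rfl⟩, hzT, h⟩
    _ ≤ ∑' i : ι, hypArea (T ∩ i.1 ⁻¹' D) := measure_iUnion_le _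
    _ = ∑' i : ι, hypArea (i.1 '' T ∩ D) := tsum_congr hpre
    _ = hypArea (⋃ i : ι, i.1 '' T ∩ D) := by
        refine (measure_iUnion₀ hdis fun i => ?_).symm
        obtain ⟨_, δ, rfl⟩ := i
        exact ((measurableSet_mob_image δ.1 hS hTS hT).inter hD).nullMeasurableSet
    _ ≤ hypArea D := measure_mono (iUnion_subset fun i => inter_subset_right)

variable {g n r : ℕ}

/-! ### Finiteness of the area integral -/

namespace QuasiFuchsian.IsComponent

variable {m : Fin r → ℕ} {Q : QuasiFuchsian g n r m} {G : Subgroup SL(2, ℝ)} {J : ℂ ≃ₜ ℂ}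
  {S : Set ℂ} (C : Q.IsComponent G J S)

include C

/-- $e^{\varphi}\,d^2z$ is the image under $J$ of hyperbolic area, so the packing inequality applies
to $J^{-1}(E)$ and the covering set of finite area. Passing to a measurable subset of $E$ and a
measurable superset of $D$ preserves packing and covering and changes only null sets. -/
theorem lintegral_exp_phi_lt_top {E : Set ℂ} (hE : E ⊆ J '' S) (hEm : NullMeasurableSet E)
    (hdisj : ∀ γ ∈ Q.Γ, γ ≠ 1 → γ ≠ -1 → volume (E ∩ mob γ '' E) = 0) :
    ∫⁻ z in E, ENNReal.ofReal (Real.exp (Q.phi z)) < ⊤ := by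
  obtain ⟨E', hE'E, hE'm, hae⟩ := hEm.exists_measurable_subset_ae_eq
  rw [← setLIntegral_congr hae]
  have hT : MeasurableSet (J ⁻¹' E') := J.measurable hE'm
  have himg : J '' (J ⁻¹' E') = E' := image_preimage_eq _ J.surjective
  have hTS : J ⁻¹' E' ⊆ S := fun z hz => (J.injective.mem_set_image).mp (hE (hE'E hz))
  obtain ⟨D, -, hDm, hcov, hfin⟩ := C.area
  obtain ⟨D', hDD', hD'm, hD'ae⟩ := hDm.exists_measurable_superset_ae_eq
  have hle := hypArea_le_of_packing C.countable C.halfPlane hTS hT hD'm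
    (hcov.mono fun z h hz => (h hz).imp fun δ hδ => ⟨hδ.1, hDD' hδ.2⟩) (by
      intro δ hδ h1 h2
      obtain ⟨γ, hγ, h⟩ := C.exists_conj δ hδ
      have hne : mob γ ≠ id := by
        intro h0
        have := C.halfPlane.eq_one_or_of_mob_eq (δ := δ) fun z hz =>
          J.injective (by rw [h z hz, h0, id])
        exact this.elim h1 h2
      have h3 := hdisj γ hγ (fun h => hne (by ext z; simp [h])) (fun h => hne (by ext z; simp [h]))
      have h4 := volume_image_eq_zero (f := J.symm) (fun z hz =>
        ((C.differentiableOn_symm.differentiableAt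
          (C.isOpen_image.mem_nhds (hE hz.1))).restrictScalars ℝ)) h3
      refine measure_mono_null ?_ h4
      rintro _ ⟨hz, w, hw, rfl⟩
      refine ⟨_, ⟨hE'E hz, J w, hE'E hw, (h w (hTS hw)).symm⟩, J.symm_apply_apply _⟩)
  rw [hypArea_apply, hypArea_apply, setLIntegral_congr hD'ae] at hle
  refine lt_of_le_of_lt (le_of_eq ?_) (hle.trans_lt hfin)
  rw [← himg, lintegral_image_eq hT
    (fun z hz => (C.analyticAt (hTS hz)).differentiableAt.hasDerivAt) J.injective.injOn, himg]
  refine setLIntegral_congr_fun hT fun z hz => ?_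
  have him := C.halfPlane.abs_im_pos (hTS hz)
  have hd := norm_pos_iff.mpr (C.deriv_ne_zero (hTS hz))
  rw [← ENNReal.ofReal_mul (by positivity), C.exp_phi (hTS hz), ← sq_abs z.im]
  congr 1
  field_simp

theorem continuousOn_phiZ : ContinuousOn Q.phiZ (J '' S) := by
  have h := C.contDiffOn_phi.continuousOn_fderiv_of_isOpen C.isOpen_image (by simp)
  have h1 (v : ℂ) : ContinuousOn (fun z => (fderiv ℝ Q.phi z v : ℂ)) (J '' S) :=
    Complex.continuous_ofReal.comp_continuousOn (h.clm_apply continuousOn_const)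
  exact ((h1 1).sub (continuousOn_const.mul (h1 Complex.I))).div_const 2

theorem integrableOn_density {E : Set ℂ} (hE : E ⊆ J '' S)
    (hfin : ∫⁻ z in E, ENNReal.ofReal (Real.exp (Q.phi z)) < ⊤) : IntegrableOn Q.density E := by
  have hc : ContinuousOn (fun z => Real.exp (Q.phi z)) (J '' S) := C.continuousOn_phi.rexp
  have hmeas {f : ℂ → ℝ} (hf : ContinuousOn f (J '' S)) :
      AEStronglyMeasurable f (volume.restrict E) :=
    (hf.aestronglyMeasurable C.isOpen_image.measurableSet).mono_measure
      (Measure.restrict_mono hE le_rfl)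
  have hexp : IntegrableOn (fun z => Real.exp (Q.phi z)) E :=
    ⟨hmeas hc, (hasFiniteIntegral_iff_ofReal (Eventually.of_forall fun z =>
      (Real.exp_pos _).le)).mpr hfin⟩
  refine (hexp.const_mul ((32 * Real.exp 16 + 2) ^ 2 + 1)).mono'
    (hmeas ((C.continuousOn_phiZ.norm.pow 2).add hc)) ?_
  refine ae_restrict_of_ae_restrict_of_subset hE
    (ae_restrict_of_forall_mem C.isOpen_image.measurableSet fun z hz => ?_)
  rw [Real.norm_of_nonneg (by unfold density; positivity), density]
  linarith [C.norm_phiZ_sq_le hz]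

end QuasiFuchsian.IsComponent

end Liouville

namespace Liouville

open MeasureTheory

/-! ### The 1-forms near the boundary -/

theorem mobDeriv_continuousAt {γ : SL(2, ℂ)} {z : ℂ} (h : γ 1 0 * z + γ 1 1 ≠ 0) :
    ContinuousAt (mobDeriv γ) z := (hasDerivAt_mobDeriv γ z h).continuousAt

theorem mobQuot_continuousAt {γ : SL(2, ℂ)} {z : ℂ} (h : γ 1 0 * z + γ 1 1 ≠ 0) :
    ContinuousAt (mobQuot γ) z := by
  unfold mobQuot
  fun_prop (disch := assumption)

theorem eventually_norm_le {f : ℂ → ℂ} {z : ℂ} (h : ContinuousAt f z) :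
    ∀ᶠ w in 𝓝 z, ‖f w‖ ≤ ‖f z‖ + 1 :=
  (h.norm.eventually_lt continuousAt_const (lt_add_one _)).mono fun _ => le_of_lt

/-- The 1-form `θ` on `Ω` is continuous. -/
def IsContForm (Ω : Set ℂ) (θ : ℂ → ℂ → ℂ) : Prop :=
  ContinuousOn (fun x : ℂ × ℂ => θ x.1 x.2) (Ω ×ˢ univ)

theorem IsContForm.continuousOn_comp {Ω : Set ℂ} {θ : ℂ → ℂ → ℂ} (hθ : IsContForm Ω θ)
    {p p' : ℝ → ℂ} {I : Set ℝ} (hp : ContinuousOn p I) (hp' : ContinuousOn p' I)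
    (hm : MapsTo p I Ω) : ContinuousOn (fun t => θ (p t) (p' t)) I :=
  ContinuousOn.comp (g := fun x : ℂ × ℂ => θ x.1 x.2) hθ (hp.prodMk hp')
    fun _ ht => ⟨hm ht, mem_univ _⟩

/-- `deriv` need not be the one-sided derivative at the end points. The one-sided derivative is
continuous on the compact interval and agrees with `deriv` on the open one. -/
theorem IsContForm.integrableOn {Ω : Set ℂ} {θ : ℂ → ℂ → ℂ} (hθ : IsContForm Ω θ)
    {p : ℝ → ℂ} {a b : ℝ} (hab : a < b) (hp : ContDiffOn ℝ 1 p (Icc a b))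
    (hm : MapsTo p (Icc a b) Ω) : IntegrableOn (fun t => θ (p t) (deriv p t)) (Ioo a b) := by
  have h1 := hp.continuousOn_derivWithin (uniqueDiffOn_Icc hab) le_rfl
  have h2 := (hθ.continuousOn_comp hp.continuousOn h1 hm).integrableOn_Icc (μ := volume)
  refine (h2.mono_set Ioo_subset_Icc_self).congr_fun (fun t ht => ?_) measurableSet_Ioo
  simp only
  rw [derivWithin_of_mem_nhds (Icc_mem_nhds ht.1 ht.2)]

variable {g n r : ℕ}

namespace QuasiFuchsian

variable {m : Fin r → ℕ} {Q : QuasiFuchsian g n r m}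

variable (Q) in
/-- The 1-form `θ` on `Ω` grows at most like `e^{φ/8}` at the point `z₀`. -/
def TameAt (Ω : Set ℂ) (θ : ℂ → ℂ → ℂ) (z₀ : ℂ) : Prop :=
  ∃ B : ℝ, 0 ≤ B ∧
    ∀ᶠ z in 𝓝 z₀, z ∈ Ω → ∀ v, ‖θ z v‖ ≤ B * Real.exp (Q.phi z / 8) * ‖v‖

theorem TameAt.add {Ω : Set ℂ} {θ₁ θ₂ : ℂ → ℂ → ℂ} {z₀ : ℂ} (h₁ : Q.TameAt Ω θ₁ z₀)
    (h₂ : Q.TameAt Ω θ₂ z₀) : Q.TameAt Ω (fun z v => θ₁ z v + θ₂ z v) z₀ := by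
  obtain ⟨B₁, hB₁, h₁⟩ := h₁
  obtain ⟨B₂, hB₂, h₂⟩ := h₂
  refine ⟨B₁ + B₂, add_nonneg hB₁ hB₂, ?_⟩
  filter_upwards [h₁, h₂] with z h₁ h₂ hz v
  rw [add_mul, add_mul]
  exact (norm_add_le _ _).trans (add_le_add (h₁ hz v) (h₂ hz v))

theorem TameAt.neg {Ω : Set ℂ} {θ : ℂ → ℂ → ℂ} {z₀ : ℂ} (h : Q.TameAt Ω θ z₀) :
    Q.TameAt Ω (fun z v => -θ z v) z₀ := by
  simpa [TameAt] using h

namespace IsComponent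

variable {G : Subgroup SL(2, ℝ)} {J : ℂ ≃ₜ ℂ} {S : Set ℂ} (C : Q.IsComponent G J S)

include C

theorem isContForm_theta {η : SL(2, ℂ)} (hη : η ∈ Q.Γ) : IsContForm (J '' S) (Q.theta η) := by
  have hden : ∀ z ∈ J '' S, η⁻¹ 1 0 * z + η⁻¹ 1 1 ≠ 0 :=
    fun z hz => C.denom_ne_zero (Q.Γ.inv_mem hη) hz
  have hfst : MapsTo Prod.fst ((J '' S) ×ˢ (univ : Set ℂ)) (J '' S) := fun x hx => hx.1
  have h1 : ContinuousOn (fun z => Q.phi z - 1 / 2 * Real.log (‖mobDeriv η⁻¹ z‖ ^ 2) -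
      2 * Real.log 2 - Real.log (‖η⁻¹ 1 0‖ ^ 2)) (J '' S) := by
    refine ((C.continuousOn_phi.sub (continuousOn_const.mul (ContinuousOn.log ?_ ?_))).sub
      continuousOn_const).sub continuousOn_const
    · exact fun z hz => ((mobDeriv_continuousAt (hden z hz)).norm.pow 2).continuousWithinAt
    · exact fun z hz => pow_ne_zero 2 (norm_ne_zero_iff.mpr (mobDeriv_ne_zero (hden z hz)))
  have h2 : ContinuousOn (mobQuot η⁻¹) (J '' S) :=
    fun z hz => (mobQuot_continuousAt (hden z hz)).continuousWithinAt
  have h3 : ContinuousOn (fun x : ℂ × ℂ => mobQuot η⁻¹ x.1 * x.2) ((J '' S) ×ˢ univ) :=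
    (h2.comp continuousOn_fst hfst).mul continuousOn_snd
  exact (Complex.continuous_ofReal.comp_continuousOn (h1.comp continuousOn_fst hfst)).mul
    (h3.sub (Complex.continuous_conj.comp_continuousOn h3))

theorem isContForm_pullback {θ : ℂ → ℂ → ℂ} (hθ : IsContForm (J '' S) θ) {γ : SL(2, ℂ)}
    (hγ : γ ∈ Q.Γ) : IsContForm (J '' S) fun z v => θ (mob γ z) (mobDeriv γ z * v) := by
  have hfst : MapsTo Prod.fst ((J '' S) ×ˢ (univ : Set ℂ)) (J '' S) := fun x hx => hx.1
  have h1 : ContinuousOn (mob γ) (J '' S) :=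
    fun z hz => (continuousAt_mob (C.denom_ne_zero hγ hz)).continuousWithinAt
  have h2 : ContinuousOn (mobDeriv γ) (J '' S) :=
    fun z hz => (mobDeriv_continuousAt (C.denom_ne_zero hγ hz)).continuousWithinAt
  exact ContinuousOn.comp (g := fun x : ℂ × ℂ => θ x.1 x.2) hθ
    ((h1.comp continuousOn_fst hfst).prodMk
      ((h2.comp continuousOn_fst hfst).mul continuousOn_snd))
    fun x hx => ⟨C.mob_mem hγ hx.1, mem_univ _⟩

theorem isContForm_u {η₁ η₂ : SL(2, ℂ)} (h₁ : η₁ ∈ Q.Γ) (h₂ : η₂ ∈ Q.Γ) :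
    IsContForm (J '' S) (Q.u η₁ η₂) :=
  ((C.isContForm_pullback (C.isContForm_theta h₂) (Q.Γ.inv_mem h₁)).sub
    (C.isContForm_theta (Q.Γ.mul_mem h₁ h₂))).add (C.isContForm_theta h₁)

/-- Since $e^{-\varphi/2}$ scales by $|\gamma'|$, the weight $e^{\varphi/8}|dz|$ scales by
$|\gamma'|^{1-2/8}$. Any power $e^{a\varphi}$ with $0<a<1/4$ would do in the sequel: contracting
paths need $2(1-2a)>1$. -/
theorem exp_phi_mob {γ : SL(2, ℂ)} (hγ : γ ∈ Q.Γ) {z : ℂ} (hz : z ∈ J '' S) :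
    Real.exp (Q.phi (mob γ z) / 8) * ‖mobDeriv γ z‖ =
      ‖mobDeriv γ z‖ ^ (3 / 4 : ℝ) * Real.exp (Q.phi z / 8) := by
  have hD := norm_pos_iff.mpr (mobDeriv_ne_zero (C.denom_ne_zero hγ hz))
  have h := congrArg Real.log (C.phi_mob hγ hz)
  rw [Real.log_exp, Real.log_mul hD.ne' (Real.exp_ne_zero _), Real.log_exp] at h
  rw [Real.rpow_def_of_pos hD, ← Real.exp_add]
  conv_lhs => rw [← Real.exp_log hD, ← Real.exp_add]
  congr 1
  linarith

/-- Away from the pole of $\gamma''/\gamma'$ every ingredient of the form is bounded except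
$\varphi$ itself, and $\varphi\le 8e^{\varphi/8}$. -/
theorem tameAt_theta {η : SL(2, ℂ)} {z₀ : ℂ} (hz₀ : z₀ ∉ J '' S)
    (hd : η⁻¹ 1 0 * z₀ + η⁻¹ 1 1 ≠ 0) : Q.TameAt (J '' S) (Q.theta η) z₀ := by
  have h1 : ContinuousAt (fun z => ((1 / 2 * Real.log (‖mobDeriv η⁻¹ z‖ ^ 2) +
      2 * Real.log 2 + Real.log (‖η⁻¹ 1 0‖ ^ 2) : ℝ) : ℂ)) z₀ := by
    refine Complex.continuous_ofReal.continuousAt.comp ((((ContinuousAt.log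
      ((mobDeriv_continuousAt hd).norm.pow 2) ?_).const_mul _).add_const _).add_const _)
    exact pow_ne_zero 2 (norm_ne_zero_iff.mpr (mobDeriv_ne_zero hd))
  obtain ⟨A₁, hA₁⟩ : ∃ A, A = ‖((1 / 2 * Real.log (‖mobDeriv η⁻¹ z₀‖ ^ 2) +
      2 * Real.log 2 + Real.log (‖η⁻¹ 1 0‖ ^ 2) : ℝ) : ℂ)‖ + 1 := ⟨_, rfl⟩
  have hb1 := eventually_norm_le h1
  have hb2 := eventually_norm_le (mobQuot_continuousAt hd)
  rw [← hA₁] at hb1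
  have hA₁0 : 0 ≤ A₁ := by rw [hA₁]; positivity
  set A₂ := ‖mobQuot η⁻¹ z₀‖ + 1 with hA₂
  refine ⟨(8 + A₁) * (2 * A₂), by positivity, ?_⟩
  -- Within distance $1/16$ of a boundary point, Koebe gives $e^{-\varphi/2}\le1$, so $\varphi\ge0$
  -- and $|\varphi|=\varphi$.
  filter_upwards [hb1, hb2, ball_mem_nhds z₀ (show (0 : ℝ) < 1 / 16 by norm_num)] with z h1 h2 h3 hz v
  have hphi : 0 ≤ Q.phi z := by
    have := C.exp_neg_half_phi_le hz hz₀
    rw [mem_ball, dist_eq_norm] at h3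
    have : Real.exp (-(Q.phi z / 2)) ≤ 1 := by linarith
    rw [Real.exp_le_one_iff] at this
    linarith
  have hexp : Q.phi z / 8 + 1 ≤ Real.exp (Q.phi z / 8) := Real.add_one_le_exp _
  rw [Complex.norm_real, Real.norm_eq_abs] at h1
  rw [theta, norm_mul, Complex.norm_real, Real.norm_eq_abs, mul_assoc ((8 + A₁) * _),
    mul_assoc (8 + A₁)]
  have e1 : |Q.phi z - 1 / 2 * Real.log (‖mobDeriv η⁻¹ z‖ ^ 2) - 2 * Real.log 2 -
      Real.log (‖η⁻¹ 1 0‖ ^ 2)| ≤ (8 + A₁) * Real.exp (Q.phi z / 8) := by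
    have h4 := abs_sub (Q.phi z) (1 / 2 * Real.log (‖mobDeriv η⁻¹ z‖ ^ 2) +
      2 * Real.log 2 + Real.log (‖η⁻¹ 1 0‖ ^ 2))
    rw [abs_of_nonneg hphi] at h4
    have e : Q.phi z - 1 / 2 * Real.log (‖mobDeriv η⁻¹ z‖ ^ 2) - 2 * Real.log 2 -
      Real.log (‖η⁻¹ 1 0‖ ^ 2) = Q.phi z - (1 / 2 * Real.log (‖mobDeriv η⁻¹ z‖ ^ 2) +
      2 * Real.log 2 + Real.log (‖η⁻¹ 1 0‖ ^ 2)) := by ring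
    rw [e]
    nlinarith
  have e2 : ‖mobQuot η⁻¹ z * v - conj (mobQuot η⁻¹ z * v)‖ ≤ 2 * A₂ * ‖v‖ := by
    refine (norm_sub_le _ _).trans ?_
    rw [Complex.norm_conj, norm_mul]
    nlinarith [norm_nonneg v]
  calc _ ≤ ((8 + A₁) * Real.exp (Q.phi z / 8)) * (2 * A₂ * ‖v‖) := by gcongr
    _ = _ := by ring

theorem tameAt_pullback {θ : ℂ → ℂ → ℂ} {γ : SL(2, ℂ)} (hγ : γ ∈ Q.Γ) {z₀ : ℂ}
    (hd : γ 1 0 * z₀ + γ 1 1 ≠ 0) (hθ : Q.TameAt (J '' S) θ (mob γ z₀)) :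
    Q.TameAt (J '' S) (fun z v => θ (mob γ z) (mobDeriv γ z * v)) z₀ := by
  obtain ⟨B, hB, h⟩ := hθ
  refine ⟨B * (‖mobDeriv γ z₀‖ + 1) ^ (3 / 4 : ℝ), by positivity, ?_⟩
  filter_upwards [(continuousAt_mob hd).eventually h, eventually_norm_le (mobDeriv_continuousAt hd)]
    with z h1 h2 hz v
  refine (h1 (C.mob_mem hγ hz) _).trans ?_
  rw [norm_mul]
  calc _ = B * (Real.exp (Q.phi (mob γ z) / 8) * ‖mobDeriv γ z‖) * ‖v‖ := by ring
    _ = B * ‖mobDeriv γ z‖ ^ (3 / 4 : ℝ) * Real.exp (Q.phi z / 8) * ‖v‖ := by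
        rw [C.exp_phi_mob hγ hz]; ring
    _ ≤ _ := by gcongr

/-- Three terms, hence three possible poles. By the chain rule for denominators, the pole of the
pulled back term is excluded by the condition on $\eta_1\eta_2$. -/
theorem tameAt_u {η₁ η₂ : SL(2, ℂ)} (h₁ : η₁ ∈ Q.Γ) {z₀ : ℂ} (hz₀ : z₀ ∉ J '' S)
    (hd₁ : η₁⁻¹ 1 0 * z₀ + η₁⁻¹ 1 1 ≠ 0) (hd : (η₁ * η₂)⁻¹ 1 0 * z₀ + (η₁ * η₂)⁻¹ 1 1 ≠ 0) :
    Q.TameAt (J '' S) (Q.u η₁ η₂) z₀ := by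
  have hd₂ : η₂⁻¹ 1 0 * mob η₁⁻¹ z₀ + η₂⁻¹ 1 1 ≠ 0 := by
    rw [mul_inv_rev, denom_mul _ _ hd₁] at hd
    exact left_ne_zero_of_mul hd
  have hm : mob η₁⁻¹ z₀ ∉ J '' S := fun h => hz₀ (by
    have := C.mob_mem h₁ h
    have e := mob_inv_mob hd₁
    rw [inv_inv] at e
    rwa [e] at this)
  have := ((C.tameAt_pullback (Q.Γ.inv_mem h₁) hd₁ (C.tameAt_theta hm hd₂)).add
    (C.tameAt_theta hz₀ hd).neg).add (C.tameAt_theta hz₀ hd₁)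
  simp only [← sub_eq_add_neg] at this
  exact this

end IsComponent

end QuasiFuchsian

end Liouville

namespace Liouville

open MeasureTheory

/-! ### Contracting paths -/

theorem affine_iterate {a b : ℂ} {x : ℕ → ℂ} (hx : ∀ N, x (N + 1) = a * x N + b) (ha : a ≠ 1)
    (N : ℕ) : x N + b / (a - 1) = a ^ N * (x 0 + b / (a - 1)) := by
  have : a - 1 ≠ 0 := sub_ne_zero.mpr ha
  induction N with
  | zero => simp
  | succ N ih =>
    rw [pow_succ', mul_assoc, ← ih, hx]
    field_simp
    ring

theorem translation_iterate {b : ℂ} {x : ℕ → ℂ} (hx : ∀ N, x (N + 1) = 1 * x N + b) (N : ℕ) :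
    x N = x 0 + N * b := by
  induction N with
  | zero => simp
  | succ N ih => rw [hx, ih]; push_cast; ring

theorem affine_tendsto_atTop {a b : ℂ} {x : ℕ → ℂ} (hx : ∀ N, x (N + 1) = a * x N + b)
    (ha : a ≠ 1) (hlim : Tendsto (fun N => ‖x N‖) atTop atTop) :
    1 < ‖a‖ ∧ 0 < ‖x 0 + b / (a - 1)‖ := by
  set e := b / (a - 1) with he
  have hgrow : Tendsto (fun N => ‖a‖ ^ N * ‖x 0 + e‖) atTop atTop := by
    refine tendsto_atTop_mono (fun N => ?_) (tendsto_atTop_add_const_right _ (-‖e‖) hlim)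
    rw [← norm_pow, ← norm_mul, ← affine_iterate hx ha]
    have := norm_le_add_norm_add (x N) e
    linarith
  constructor
  · by_contra! h
    obtain ⟨N, hN⟩ := (hgrow.eventually_gt_atTop ‖x 0 + e‖).exists
    have := pow_le_one₀ (n := N) (norm_nonneg a) h
    nlinarith [norm_nonneg (x 0 + e)]
  · obtain ⟨N, hN⟩ := (hgrow.eventually_gt_atTop 0).exists
    rcases (norm_nonneg (x 0 + e)).eq_or_lt with h | h
    · rw [← h, mul_zero] at hN
      exact absurd hN (lt_irrefl _)
    · exact h

theorem translation_ne_zero {b : ℂ} {x : ℕ → ℂ} (hx : ∀ N, x (N + 1) = 1 * x N + b)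
    (hlim : Tendsto (fun N => ‖x N‖) atTop atTop) : b ≠ 0 := by
  rintro rfl
  have e : (fun N => ‖x N‖) = fun _ => ‖x 0‖ := by
    ext N
    rw [translation_iterate hx N, mul_zero, add_zero]
  exact not_tendsto_const_atTop _ _ (e ▸ hlim)

/-- If the affine map `x ↦ a x + b` repels a compact set to infinity, it does so linearly, or
exponentially if `a ≠ 1`. -/
theorem exists_affine_iterate_bound {a b : ℂ} {K : Set ℂ} (hK : IsCompact K) (hne : K.Nonempty)
    (ha0 : a ≠ 0) (x : ℂ → ℕ → ℂ) (hx0 : ∀ z ∈ K, x z 0 = z)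
    (hx : ∀ z ∈ K, ∀ N, x z (N + 1) = a * x z N + b)
    (hlim : ∀ z ∈ K, Tendsto (fun N => ‖x z N‖) atTop atTop) :
    ∃ B : ℝ, ∀ᶠ N : ℕ in atTop, ∀ z ∈ K, ‖a‖ ^ N / ‖x z N‖ ^ 2 ≤ B / (N : ℝ) ^ 2 := by
  obtain ⟨Z, hZ⟩ := hK.exists_bound_of_continuousOn (f := id) continuousOn_id
  obtain ⟨z₁, hz₁⟩ := hne
  have hZ0 : 0 ≤ Z := (norm_nonneg _).trans (hZ z₁ hz₁)
  -- For $a=1$ the orbit is $z+Nb$ with $b\ne0$. Otherwise divergence forces $|a|>1$, and $|x_N|$ is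
  -- at least of order $|a|^N$, uniformly on $K$; the quotient is then $O(|a|^{-N})$.
  by_cases ha : a = 1
  · subst ha
    have hb : 0 < ‖b‖ := norm_pos_iff.mpr (translation_ne_zero (hx z₁ hz₁) (hlim z₁ hz₁))
    refine ⟨(2 / ‖b‖) ^ 2, ?_⟩
    have hev : ∀ᶠ N : ℕ in atTop, 2 * Z / ‖b‖ < N :=
      tendsto_natCast_atTop_atTop.eventually_gt_atTop _
    filter_upwards [hev, eventually_gt_atTop 0] with N hN hN0 z hz
    have hN0' : (0 : ℝ) < N := by exact_mod_cast hN0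
    rw [div_lt_iff₀ hb] at hN
    have h1 : N * ‖b‖ / 2 ≤ ‖x z N‖ := by
      rw [translation_iterate (hx z hz), hx0 z hz]
      have h2 := norm_sub_le_norm_add ((N : ℂ) * b) z
      rw [norm_mul, Complex.norm_natCast, add_comm] at h2
      have h3 := hZ z hz
      simp only [id] at h3
      linarith
    rw [norm_one, one_pow]
    calc 1 / ‖x z N‖ ^ 2 ≤ 1 / (N * ‖b‖ / 2) ^ 2 := by gcongr
      _ = _ := by field_simp
  · set e := b / (a - 1) with he
    have hsol : ∀ z ∈ K, ∀ N, x z N + e = a ^ N * (z + e) := fun z hz N => by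
      rw [affine_iterate (hx z hz) ha, hx0 z hz]
    have ha1 : 1 < ‖a‖ := (affine_tendsto_atTop (hx z₁ hz₁) ha (hlim z₁ hz₁)).1
    have hpos : ∀ z ∈ K, 0 < ‖z + e‖ := fun z hz => by
      have := (affine_tendsto_atTop (hx z hz) ha (hlim z hz)).2
      rwa [hx0 z hz] at this
    obtain ⟨z₂, hz₂, hmin⟩ := hK.exists_isMinOn ⟨z₁, hz₁⟩
      (f := fun z => ‖z + e‖) (by fun_prop)
    set μ := ‖z₂ + e‖ with hμ
    have hμ0 : 0 < μ := hpos z₂ hz₂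
    refine ⟨4 / μ ^ 2, ?_⟩
    have h1 : ∀ᶠ N : ℕ in atTop, 2 * ‖e‖ / μ ≤ ‖a‖ ^ N :=
      (tendsto_pow_atTop_atTop_of_one_lt ha1).eventually_ge_atTop _
    have h2 : ∀ᶠ N : ℕ in atTop, (N : ℝ) ^ 2 / ‖a‖ ^ N < 1 :=
      (tendsto_pow_const_div_const_pow_of_one_lt 2 ha1).eventually_lt_const one_pos
    filter_upwards [h1, h2, eventually_gt_atTop 0] with N h1 h2 hN0 z hz
    have hN0' : (0 : ℝ) < N := by exact_mod_cast hN0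
    have hap : 0 < ‖a‖ ^ N := by positivity
    rw [div_le_iff₀ hμ0] at h1
    rw [div_lt_one hap] at h2
    have h3 : ‖a‖ ^ N * μ / 2 ≤ ‖x z N‖ := by
      have h4 := norm_add_le (x z N) e
      rw [hsol z hz, norm_mul, norm_pow] at h4
      have h5 : μ ≤ ‖z + e‖ := hmin hz
      have h6 : ‖a‖ ^ N * μ ≤ ‖a‖ ^ N * ‖z + e‖ := by gcongr
      linarith
    calc ‖a‖ ^ N / ‖x z N‖ ^ 2 ≤ ‖a‖ ^ N / (‖a‖ ^ N * μ / 2) ^ 2 := by gcongr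
      _ = (4 / μ ^ 2) / ‖a‖ ^ N := by field_simp; norm_num
      _ ≤ (4 / μ ^ 2) / (N : ℝ) ^ 2 := by gcongr

/-- The powers of a transformation contract a compact set to its fixed point `0` at least
quadratically. -/
theorem exists_mobDeriv_pow_bound {γ : SL(2, ℂ)} (h0 : γ 0 1 = 0) {K : Set ℂ} (hK : IsCompact K)
    (hne : K.Nonempty) (hK0 : (0 : ℂ) ∉ K)
    (hden : ∀ N, ∀ z ∈ K, (γ ^ N) 1 0 * z + (γ ^ N) 1 1 ≠ 0)
    (hlim : ∀ z ∈ K, Tendsto (fun N => mob (γ ^ N) z) atTop (𝓝 0)) :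
    ∃ B : ℝ, ∀ᶠ N : ℕ in atTop, ∀ z ∈ K, ‖mobDeriv (γ ^ N) z‖ ≤ B / (N : ℝ) ^ 2 := by
  have hdet := det_eq_one γ
  rw [h0, zero_mul, sub_zero] at hdet
  have ha : γ 0 0 ≠ 0 := left_ne_zero_of_mul_eq_one hdet
  have hd : γ 1 1 ≠ 0 := right_ne_zero_of_mul_eq_one hdet
  have hstep : ∀ N, ∀ z ∈ K, γ 1 0 * mob (γ ^ N) z + γ 1 1 ≠ 0 := by
    intro N z hz
    have := hden (N + 1) z hz
    rw [pow_succ', denom_mul _ _ (hden N z hz)] at this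
    exact left_ne_zero_of_mul this
  have hmob : ∀ N, ∀ z ∈ K, mob (γ ^ (N + 1)) z = γ 0 0 * mob (γ ^ N) z /
      (γ 1 0 * mob (γ ^ N) z + γ 1 1) := by
    intro N z hz
    rw [pow_succ', mob_mul _ _ (hden N z hz), mob, h0, add_zero]
  have hnz : ∀ N, ∀ z ∈ K, mob (γ ^ N) z ≠ 0 := by
    intro N z hz
    induction N with
    | zero => simp only [pow_zero, mob_one]; exact fun h => hK0 (h ▸ hz)
    | succ N ih =>
      rw [hmob N z hz]
      exact div_ne_zero (mul_ne_zero ha ih) (hstep N z hz)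
  -- In the coordinate $y=1/z$ a transformation fixing $0$ is the affine map $y\mapsto d^2y+cd$.
  have hrec : ∀ N, ∀ z ∈ K, (mob (γ ^ (N + 1)) z)⁻¹ =
      γ 1 1 ^ 2 * (mob (γ ^ N) z)⁻¹ + γ 1 0 * γ 1 1 := by
    intro N z hz
    rw [hmob N z hz, inv_div]
    have h1 := hnz N z hz
    have h2 : γ 1 1 = (γ 0 0)⁻¹ := eq_inv_of_mul_eq_one_right hdet
    rw [h2]
    field_simp
    ring
  -- The chain rule for $z\mapsto y\mapsto y_N\mapsto 1/y_N$: the middle map has the constant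
  -- derivative $d^{2N}$.
  have hder : ∀ N, ∀ z ∈ K, mobDeriv (γ ^ N) z =
      (γ 1 1 ^ 2) ^ N * (z⁻¹) ^ 2 / ((mob (γ ^ N) z)⁻¹) ^ 2 := by
    intro N z hz
    have hz0 : z ≠ 0 := fun h => hK0 (h ▸ hz)
    induction N with
    | zero => simp [mobDeriv, hz0]
    | succ N ih =>
      have h1 := hnz N z hz
      have h2 := hstep N z hz
      rw [pow_succ' γ, mobDeriv_mul _ _ (hden N z hz), ih, ← pow_succ' γ, hmob N z hz, mobDeriv,
        pow_succ (γ 1 1 ^ 2) N]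
      have h3 : γ 0 0 = (γ 1 1)⁻¹ := eq_inv_of_mul_eq_one_left hdet
      rw [h3]
      field_simp
  obtain ⟨z₁, hz₁⟩ := hne
  have hinv0 : ∀ z ∈ K, z ≠ 0 := fun z hz h => hK0 (h ▸ hz)
  have hcinv : ContinuousOn (fun z : ℂ => z⁻¹) K := continuousOn_inv₀.mono hinv0
  obtain ⟨B, hB⟩ := exists_affine_iterate_bound (hK.image_of_continuousOn hcinv)
    ⟨_, mem_image_of_mem _ hz₁⟩ (pow_ne_zero 2 hd) (b := γ 1 0 * γ 1 1)
    (fun y N => (mob (γ ^ N) y⁻¹)⁻¹)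
    (by rintro _ ⟨z, hz, rfl⟩; simp)
    (by rintro _ ⟨z, hz, rfl⟩ N; simpa using hrec N z hz)
    (by
      rintro _ ⟨z, hz, rfl⟩
      simp only [inv_inv, norm_inv]
      refine tendsto_inv_nhdsGT_zero.comp (tendsto_nhdsWithin_iff.mpr ⟨?_, ?_⟩)
      · simpa using (hlim z hz).norm
      · exact Eventually.of_forall fun N => norm_pos_iff.mpr (hnz N z hz))
  obtain ⟨Z, hZ⟩ := hK.exists_bound_of_continuousOn hcinv
  refine ⟨Z ^ 2 * B, hB.mono fun N hN z hz => ?_⟩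
  have h1 := hN _ (mem_image_of_mem _ hz)
  simp only [inv_inv] at h1
  have h2 := hZ z hz
  have h3 : (0 : ℝ) ≤ B / (N : ℝ) ^ 2 := le_trans (by positivity) h1
  calc ‖mobDeriv (γ ^ N) z‖ = ‖z⁻¹‖ ^ 2 * (‖γ 1 1 ^ 2‖ ^ N / ‖(mob (γ ^ N) z)⁻¹‖ ^ 2) := by
        rw [hder N z hz, norm_div, norm_mul, norm_pow (γ 1 1 ^ 2) N, norm_pow z⁻¹,
          norm_pow (mob (γ ^ N) z)⁻¹]
        ring
    _ ≤ Z ^ 2 * (B / (N : ℝ) ^ 2) := by gcongr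
    _ = _ := by ring

/-- The $N$-th dyadic interval has length $\delta/2^{N+1}$, which absorbs the factor $2^N$ that
differentiating $s\mapsto p(s/2^N)$ produces; it contributes at most $\delta b_N/2$. -/
theorem integrableOn_of_dyadic_bound {f : ℝ → ℂ} {δ : ℝ} (hδ : 0 < δ)
    (hf : ContinuousOn f (Ioc 0 δ)) {b : ℕ → ℝ} (hb : Summable b)
    (hbound : ∀ N : ℕ, ∀ s ∈ Ioc (δ / 2 ^ (N + 1)) (δ / 2 ^ N), ‖f s‖ ≤ 2 ^ N * b N) :
    IntegrableOn f (Ioc 0 δ) := by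
  refine ⟨hf.aestronglyMeasurable measurableSet_Ioc, ?_⟩
  have hb0 : ∀ N, 0 ≤ b N := fun N => by
    have h1 := hbound N (δ / 2 ^ N) ⟨by gcongr <;> simp, le_rfl⟩
    exact nonneg_of_mul_nonneg_right ((norm_nonneg _).trans h1) (by positivity)
  have hcover : Ioc 0 δ ⊆ ⋃ N : ℕ, Ioc (δ / 2 ^ (N + 1)) (δ / 2 ^ N) := by
    intro s hs
    obtain ⟨N, hN1, hN2⟩ := exists_nat_pow_near (one_le_div hs.1 |>.mpr hs.2) (one_lt_two (α := ℝ))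
    refine mem_iUnion.mpr ⟨N, ?_, ?_⟩
    · rw [div_lt_iff₀ (by positivity)]
      rwa [div_lt_iff₀ hs.1, mul_comm] at hN2
    · rw [le_div_iff₀ (by positivity)]
      rwa [le_div_iff₀ hs.1, mul_comm] at hN1
  rw [hasFiniteIntegral_iff_enorm]
  calc ∫⁻ s in Ioc 0 δ, ‖f s‖ₑ ≤ ∫⁻ s in ⋃ N : ℕ, Ioc (δ / 2 ^ (N + 1)) (δ / 2 ^ N), ‖f s‖ₑ :=
        lintegral_mono_set hcover
    _ ≤ ∑' N : ℕ, ∫⁻ s in Ioc (δ / 2 ^ (N + 1)) (δ / 2 ^ N), ‖f s‖ₑ := lintegral_iUnion_le _ _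
    _ ≤ ∑' N : ℕ, ENNReal.ofReal (δ / 2 * b N) := by
        refine ENNReal.tsum_le_tsum fun N => ?_
        calc _ ≤ ∫⁻ s in Ioc (δ / 2 ^ (N + 1)) (δ / 2 ^ N), ENNReal.ofReal (2 ^ N * b N) := by
              refine setLIntegral_mono measurable_const fun s hs => ?_
              rw [← ofReal_norm]
              exact ENNReal.ofReal_le_ofReal (hbound N s hs)
          _ = _ := by
              rw [setLIntegral_const, Real.volume_Ioc, ← ENNReal.ofReal_mul (by
                have := hb0 N; positivity)]
              congr 1
              rw [pow_succ]
              field_simp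
              ring
    _ < ⊤ := by
        rw [← ENNReal.ofReal_tsum_of_nonneg (fun N => mul_nonneg (by positivity) (hb0 N))
          (hb.mul_left _)]
        exact ENNReal.ofReal_lt_top

end Liouville

namespace Liouville

open MeasureTheory

variable {g n r : ℕ}

namespace QuasiFuchsian.IsComponent

variable {m : Fin r → ℕ} {Q : QuasiFuchsian g n r m} {G : Subgroup SL(2, ℝ)} {J : ℂ ≃ₜ ℂ}
  {S : Set ℂ} (C : Q.IsComponent G J S)

include C

theorem contracting_pow {p : ℝ → ℂ} {γ : SL(2, ℂ)} (hγ : γ ∈ Q.Γ) {ε : ℝ} (hε : ε ≤ 1)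
    (hm : MapsTo p (Ioc 0 1) (J '' S)) (hrel : ∀ s ∈ Ioc 0 ε, p (s / 2) = mob γ (p s)) (N : ℕ)
    {s : ℝ} (hs : s ∈ Ioc 0 ε) : p (s / 2 ^ N) = mob (γ ^ N) (p s) := by
  induction N with
  | zero => simp
  | succ N ih =>
    have h1 : s / 2 ^ N ≤ s := div_le_self hs.1.le (one_le_pow₀ one_le_two)
    have h2 := hrel (s / 2 ^ N) ⟨div_pos hs.1 (by positivity), h1.trans hs.2⟩
    rw [pow_succ, ← div_div, h2, ih, pow_succ', mob_mul _ _
      (C.denom_ne_zero (Q.Γ.pow_mem hγ N) (hm ⟨hs.1, hs.2.trans hε⟩))]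

/-- The integral of a form that grows slowly at `0` converges along a contracting path. -/
theorem integrableOn_contracting {θ : ℂ → ℂ → ℂ} (hθ : IsContForm (J '' S) θ)
    (ht : Q.TameAt (J '' S) θ 0) {p : ℝ → ℂ} (hp : ContDiffOn ℝ 1 p (Ioc 0 1))
    (hm : MapsTo p (Ioc 0 1) (J '' S)) (h0 : Tendsto p (𝓝[>] 0) (𝓝 0)) {γ : SL(2, ℂ)}
    (hγ : γ ∈ Q.Γ) {ε : ℝ} (hε : ε ∈ Ioc (0 : ℝ) 1)
    (hrel : ∀ s ∈ Ioc 0 ε, p (s / 2) = mob γ (p s)) :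
    IntegrableOn (fun t => θ (p t) (deriv p t)) (Ioo 0 1) := by
  have hε0 := hε.1
  have hε1 := hε.2
  have hpow := fun N {s} hs => C.contracting_pow hγ hε.2 hm hrel N (s := s) hs
  have hden : ∀ N, ∀ z ∈ J '' S, (γ ^ N) 1 0 * z + (γ ^ N) 1 1 ≠ 0 :=
    fun N z hz => C.denom_ne_zero (Q.Γ.pow_mem hγ N) hz
  have hdiff : ∀ s ∈ Ioo (0 : ℝ) 1, HasDerivAt p (deriv p s) s := fun s hs =>
    ((hp.differentiableOn one_ne_zero).differentiableAt
      (Ioc_mem_nhds hs.1 hs.2)).hasDerivAt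
  have hpc : ContinuousOn p (Ioo 0 1) := hp.continuousOn.mono Ioo_subset_Ioc_self
  have hdc : ContinuousOn (deriv p) (Ioo 0 1) :=
    (hp.mono Ioo_subset_Ioc_self).continuousOn_deriv_of_isOpen isOpen_Ioo le_rfl
  -- Pass to the limit $s\to0$ in the functional equation with denominators cleared, so that no
  -- assumption on the pole of $\gamma$ is needed.
  have hfix : γ 0 1 = 0 := by
    have hhalf : Tendsto (fun s : ℝ => s / 2) (𝓝[>] 0) (𝓝[>] 0) := by
      refine tendsto_nhdsWithin_iff.mpr ⟨?_, ?_⟩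
      · have : Tendsto (fun s : ℝ => s / 2) (𝓝 0) (𝓝 (0 / 2)) := (continuous_id.div_const 2).tendsto 0
        rw [zero_div] at this
        exact this.mono_left nhdsWithin_le_nhds
      · filter_upwards [self_mem_nhdsWithin] with s hs using half_pos (show (0 : ℝ) < s from hs)
    have h1 : Tendsto (fun s => p (s / 2) * (γ 1 0 * p s + γ 1 1)) (𝓝[>] 0)
        (𝓝 (0 * (γ 1 0 * 0 + γ 1 1))) :=
      (h0.comp hhalf).mul ((h0.const_mul _).add_const _)
    have h2 : Tendsto (fun s => γ 0 0 * p s + γ 0 1) (𝓝[>] 0) (𝓝 (γ 0 0 * 0 + γ 0 1)) :=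
      (h0.const_mul _).add_const _
    have h3 : (fun s => p (s / 2) * (γ 1 0 * p s + γ 1 1)) =ᶠ[𝓝[>] 0]
        fun s => γ 0 0 * p s + γ 0 1 := by
      filter_upwards [Ioc_mem_nhdsGT hε.1] with s hs
      rw [hrel s hs, mob, div_mul_cancel₀ _ (C.denom_ne_zero hγ (hm ⟨hs.1, hs.2.trans hε1⟩))]
    have := tendsto_nhds_unique (h1.congr' h3) h2
    simpa using this.symm
  have hder : ∀ N : ℕ, ∀ s ∈ Ioo 0 ε,
      deriv p (s / 2 ^ N) = 2 ^ N * (mobDeriv (γ ^ N) (p s) * deriv p s) := by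
    intro N s hs
    have hs1 : s ∈ Ioo (0 : ℝ) 1 := ⟨hs.1, hs.2.trans_le hε1⟩
    have hsN : s / 2 ^ N ∈ Ioo (0 : ℝ) 1 := ⟨div_pos hs.1 (by positivity),
      (div_le_self hs.1.le (one_le_pow₀ one_le_two)).trans_lt hs1.2⟩
    have h1 := (hdiff _ hsN).scomp s ((hasDerivAt_id s).div_const (2 ^ N))
    have h2 := (hasDerivAt_mob (γ ^ N) (p s)
      (hden N _ (hm (Ioo_subset_Ioc_self hs1)))).comp s (hdiff s hs1)
    have h3 : p ∘ (fun s : ℝ => id s / 2 ^ N) =ᶠ[𝓝 s] mob (γ ^ N) ∘ p := by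
      filter_upwards [Ioo_mem_nhds hs.1 hs.2] with u hu using hpow N (Ioo_subset_Ioc_self hu)
    have h4 := h2.unique (h1.congr_of_eventuallyEq h3.symm)
    rw [h4]
    simp
  -- Halving keeps the closed fundamental arc inside the open interval, where `deriv p` is
  -- continuous and the functional equation can be differentiated.
  set ε₁ := ε / 2 with hε₁
  have hIcc : Icc (ε₁ / 2) ε₁ ⊆ Ioo 0 ε := fun s hs => ⟨by linarith [hs.1], by linarith [hs.2]⟩
  have hIcc1 : Icc (ε₁ / 2) ε₁ ⊆ Ioo 0 1 := fun s hs => ⟨(hIcc hs).1, (hIcc hs).2.trans_le hε1⟩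
  have hKΩ : p '' Icc (ε₁ / 2) ε₁ ⊆ J '' S := by
    rintro _ ⟨s, hs, rfl⟩
    exact hm (Ioo_subset_Ioc_self (hIcc1 hs))
  have hlim : ∀ s ∈ Ioc 0 ε, Tendsto (fun N : ℕ => s / 2 ^ N) atTop (𝓝[>] 0) := by
    intro s hs
    refine tendsto_nhdsWithin_iff.mpr ⟨?_, Eventually.of_forall fun N => div_pos hs.1 (by positivity)⟩
    exact tendsto_const_nhds.div_atTop (tendsto_pow_atTop_atTop_of_one_lt one_lt_two)
  obtain ⟨B, hB⟩ := exists_mobDeriv_pow_bound hfix (K := p '' Icc (ε₁ / 2) ε₁)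
    (isCompact_Icc.image_of_continuousOn (hpc.mono hIcc1))
    ((nonempty_Icc.mpr (by linarith)).image p) (fun h => C.zero_notMem (hKΩ h))
    (fun N z hz => hden N z (hKΩ hz)) (by
      rintro _ ⟨s, hs, rfl⟩
      have hs' := Ioo_subset_Ioc_self (hIcc hs)
      exact (h0.comp (hlim s hs')).congr fun N => hpow N hs')
  obtain ⟨A, hA0, hA⟩ := ht
  obtain ⟨δ₀, hδ₀, hδ⟩ := mem_nhdsGT_iff_exists_Ioo_subset.mp (h0.eventually hA)
  have hε₁0 : ε₁ ∈ Ioc 0 ε := ⟨by linarith, by linarith⟩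
  have hev : ∀ᶠ N : ℕ in atTop, ε₁ / 2 ^ N < δ₀ :=
    (tendsto_nhds_of_tendsto_nhdsWithin (hlim ε₁ hε₁0)).eventually_lt_const hδ₀
  obtain ⟨N₀, hN₀⟩ := eventually_atTop.mp (hB.and hev)
  obtain ⟨M, hM⟩ := (isCompact_Icc (a := ε₁ / 2) (b := ε₁)).exists_bound_of_continuousOn
    (f := fun s => Real.exp (Q.phi (p s) / 8) * ‖deriv p s‖)
    ((((C.continuousOn_phi.comp hpc fun s hs => hm (Ioo_subset_Ioc_self hs)).div_const 8).rexp.mul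
      hdc.norm).mono hIcc1)
  have hmem₁ : ε₁ ∈ Icc (ε₁ / 2) ε₁ := ⟨by linarith, le_rfl⟩
  have hM0 : 0 ≤ M := (norm_nonneg _).trans (hM ε₁ hmem₁)
  have hB0 : 0 ≤ B := by
    have h := (norm_nonneg _).trans ((hN₀ (N₀ + 1) (by simp)).1 _ (mem_image_of_mem p hmem₁))
    rwa [le_div_iff₀ (by positivity), zero_mul] at h
  set δ := ε₁ / 2 ^ N₀ with hδdef
  have hδpos : 0 < δ := div_pos hε₁0.1 (by positivity)
  have hδ1 : δ < 1 := (div_le_self hε₁0.1.le (one_le_pow₀ one_le_two)).trans_lt (by linarith)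
  -- Each dyadic piece is the image of the fundamental arc under $\gamma^N$. The bound
  -- $|(\gamma^N)'|\le B/N^2$, raised to the power $3/4$, yields the summable $N^{-3/2}$; the shift
  -- by $N_0$ keeps only the range where both this bound and the growth estimate hold.
  have hnear : IntegrableOn (fun t => θ (p t) (deriv p t)) (Ioc 0 δ) := by
    refine integrableOn_of_dyadic_bound hδpos ?_
      (b := fun k => 2 ^ N₀ * (A * M) * (B / ((k + N₀ : ℕ) : ℝ) ^ 2) ^ (3 / 4 : ℝ)) ?_ ?_
    · have hsub : Ioc 0 δ ⊆ Ioo (0 : ℝ) 1 := fun s hs => ⟨hs.1, hs.2.trans_lt hδ1⟩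
      exact hθ.continuousOn_comp (hpc.mono hsub) (hdc.mono hsub)
        fun s hs => hm (Ioo_subset_Ioc_self (hsub hs))
    · refine Summable.mul_left _ ((summable_nat_add_iff (f := fun k : ℕ =>
        (B / (k : ℝ) ^ 2) ^ (3 / 4 : ℝ)) N₀).mpr ?_)
      have h1 : Summable fun k : ℕ => B ^ (3 / 4 : ℝ) * (1 / (k : ℝ) ^ (3 / 2 : ℝ)) :=
        (Real.summable_one_div_nat_rpow.mpr (by norm_num)).mul_left _
      refine h1.congr fun k => ?_
      rw [Real.div_rpow hB0 (by positivity), ← Real.rpow_natCast, ← Real.rpow_mul (by positivity),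
        mul_one_div]
      norm_num
    · intro k s hs
      set N := k + N₀ with hN
      have h2N : (0 : ℝ) < 2 ^ N := by positivity
      have hsum : (2 : ℝ) ^ N = 2 ^ k * 2 ^ N₀ := by rw [hN, pow_add]
      have hσ : s * 2 ^ N ∈ Icc (ε₁ / 2) ε₁ := by
        have h1 := hs.1
        have h2 := hs.2
        rw [hδdef, div_div, div_lt_iff₀ (by positivity), pow_succ] at h1
        rw [hδdef, div_div, le_div_iff₀ (by positivity)] at h2
        rw [hsum]
        constructor <;> nlinarith
      set σ := s * 2 ^ N with hσdef
      have hs' : s = σ / 2 ^ N := by rw [hσdef, mul_div_cancel_right₀ _ h2N.ne']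
      have hsδ : s ∈ Ioo 0 δ₀ := by
        refine ⟨lt_trans (by positivity) hs.1, ?_⟩
        have h1 := (hN₀ N (by omega)).2
        refine lt_of_le_of_lt ?_ h1
        rw [hs']
        gcongr
        exact hσ.2
      have hσΩ : p σ ∈ J '' S := hm (Ioo_subset_Ioc_self (hIcc1 hσ))
      have hsΩ : p s ∈ J '' S := hm ⟨hsδ.1, hs.2.trans
        ((div_le_self hδpos.le (one_le_pow₀ one_le_two)).trans hδ1.le)⟩
      have h1 := hδ hsδ hsΩ (deriv p s)
      have hps : p s = mob (γ ^ N) (p σ) := by rw [hs']; exact hpow N (Ioo_subset_Ioc_self (hIcc hσ))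
      have hds : ‖deriv p s‖ = 2 ^ N * (‖mobDeriv (γ ^ N) (p σ)‖ * ‖deriv p σ‖) := by
        rw [hs', hder N σ (hIcc hσ)]
        simp
      have hDb := (hN₀ N (by omega)).1 _ (mem_image_of_mem p hσ)
      have hMb := hM σ hσ
      rw [Real.norm_of_nonneg (by positivity)] at hMb
      calc _ ≤ A * Real.exp (Q.phi (p s) / 8) * ‖deriv p s‖ := h1
        _ = A * 2 ^ N * (Real.exp (Q.phi (mob (γ ^ N) (p σ)) / 8) * ‖mobDeriv (γ ^ N) (p σ)‖) *
              ‖deriv p σ‖ := by rw [hds, hps]; ring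
        _ = A * 2 ^ N * ‖mobDeriv (γ ^ N) (p σ)‖ ^ (3 / 4 : ℝ) *
              (Real.exp (Q.phi (p σ) / 8) * ‖deriv p σ‖) := by
            rw [C.exp_phi_mob (Q.Γ.pow_mem hγ N) hσΩ]; ring
        _ ≤ A * 2 ^ N * (B / (N : ℝ) ^ 2) ^ (3 / 4 : ℝ) * M := by gcongr
        _ = _ := by rw [hsum]; ring
  have hfar := hθ.integrableOn hδ1 (hp.mono fun s hs => ⟨hδpos.trans_le hs.1, hs.2⟩)
    (fun s hs => hm ⟨hδpos.trans_le hs.1, hs.2⟩)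
  exact (hnear.union hfar).mono_set fun s hs => (le_or_gt s δ).imp (fun h => ⟨hs.1, h⟩)
    fun h => ⟨h, hs.2⟩

end QuasiFuchsian.IsComponent

end Liouville

namespace Liouville

open MeasureTheory

/-! ### Cusps -/

/-- Sending the fixed point $z_0$ to infinity by $1/(z-z_0)$ makes the transformation affine. -/
theorem inv_mob_sub {γ : SL(2, ℂ)} {z₀ z : ℂ} (hd₀ : γ 1 0 * z₀ + γ 1 1 ≠ 0)
    (hfix : mob γ z₀ = z₀) (hd : γ 1 0 * z + γ 1 1 ≠ 0) (hz : z ≠ z₀) :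
    (mob γ z - z₀)⁻¹ = (γ 1 0 * z₀ + γ 1 1) ^ 2 * (z - z₀)⁻¹ +
      γ 1 0 * (γ 1 0 * z₀ + γ 1 1) := by
  have hs : z - z₀ ≠ 0 := sub_ne_zero.mpr hz
  have hdet := det_eq_one γ
  have h1 : mob γ z - z₀ = (z - z₀) / ((γ 1 0 * z + γ 1 1) * (γ 1 0 * z₀ + γ 1 1)) := by
    nth_rewrite 1 [← hfix]
    rw [mob, mob, div_sub_div _ _ hd hd₀]
    congr 1
    linear_combination (z - z₀) * hdet
  rw [h1, inv_div]
  field_simp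
  ring

/-- For $a\neq1$, divergence in the forward direction requires $|a|>1$ and in the backward direction
$|a^{-1}|>1$. This is how the image of a translation is recognized as parabolic. -/
theorem eq_one_of_tendsto_both {a b : ℂ} (ha : a ≠ 0) {x : ℤ → ℂ}
    (hx : ∀ N, x (N + 1) = a * x N + b)
    (h₁ : Tendsto (fun N : ℕ => ‖x N‖) atTop atTop)
    (h₂ : Tendsto (fun N : ℕ => ‖x (-N)‖) atTop atTop) : a = 1 := by
  by_contra hne
  have e1 := (affine_tendsto_atTop (x := fun N : ℕ => x N) (a := a) (b := b)
    (fun N => by simpa using hx N) hne h₁).1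
  have e2 := (affine_tendsto_atTop (x := fun N : ℕ => x (-N)) (a := a⁻¹) (b := -(a⁻¹ * b))
    (fun N => by
      have := hx (-(N + 1 : ℕ))
      have e : (-((N + 1 : ℕ) : ℤ) + 1) = -N := by push_cast; ring
      rw [e] at this
      rw [this]
      field_simp
      ring) (by simpa using hne) h₂).1
  rw [norm_inv] at e2
  have := inv_lt_one_of_one_lt₀ e1
  linarith

/-- A nonvanishing path of small logarithmic length and large displacement is far from `0`. -/
theorem norm_sub_le_of_log_deriv_le {f f' : ℝ → ℂ} {κ : ℝ} (hκ : 0 ≤ κ)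
    (hf : ∀ s ∈ Icc (0 : ℝ) 1, HasDerivAt f (f' s) s)
    (hb : ∀ s ∈ Icc (0 : ℝ) 1, ‖f' s‖ ≤ κ * ‖f s‖) :
    ‖f 1 - f 0‖ ≤ κ * Real.exp κ * ‖f 0‖ := by
  have hg : ∀ s ∈ Icc (0 : ℝ) 1, ‖f s‖ ≤ ‖f 0‖ * Real.exp κ := by
    intro s hs
    have := norm_le_gronwallBound_of_norm_deriv_right_le (f := f) (f' := f') (δ := ‖f 0‖) (K := κ)
      (ε := 0) (a := 0) (b := 1) (fun t ht => (hf t ht).continuousAt.continuousWithinAt)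
      (fun t ht => (hf t ⟨ht.1, ht.2.le⟩).hasDerivWithinAt) le_rfl
      (fun t ht => by rw [add_zero]; exact hb t ⟨ht.1, ht.2.le⟩) s hs
    rw [gronwallBound_ε0, sub_zero] at this
    refine this.trans ?_
    gcongr
    nlinarith [hs.2]
  have := norm_image_sub_le_of_norm_deriv_le_segment_01' (f := f) (f' := f')
    (C := κ * Real.exp κ * ‖f 0‖) (fun t ht => (hf t ht).hasDerivWithinAt) (fun t ht => by
      refine (hb t ⟨ht.1, ht.2.le⟩).trans ?_
      have := hg t ⟨ht.1, ht.2.le⟩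
      nlinarith)
  exact this

theorem integrableOn_rpow_one_sub : 
    IntegrableOn (fun t : ℝ => (1 - t) ^ (-(1 / 4) : ℝ)) (Ioo 0 1) := by
  have h := (intervalIntegral.intervalIntegrable_rpow' (a := 0) (b := 1)
    (r := (-(1 / 4) : ℝ)) (by norm_num)).comp_sub_left 1
  simp only [sub_zero, sub_self] at h
  exact ((intervalIntegrable_iff_integrableOn_Ioc_of_le zero_le_one).mp h.symm).mono_set
    Ioo_subset_Ioc_self

variable {g n r : ℕ}

namespace QuasiFuchsian.IsComponent

variable {m : Fin r → ℕ} {Q : QuasiFuchsian g n r m} {G : Subgroup SL(2, ℝ)} {J : ℂ ≃ₜ ℂ}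
  {S : Set ℂ} (C : Q.IsComponent G J S)

include C

/-- Along a vertical ray to a cusp the conformal radius decays at least linearly. -/
theorem exists_cusp_bound {H : ℂ → ℂ} {T : Set ℂ} (hT : IsHalfPlane T) (hH : ContDiffOn ℝ 1 H T)
    (hm : MapsTo H T (J '' S)) {K : ℝ}
    (hK : ∀ w ∈ T, Real.exp (Q.phi (H w) / 2) * ‖fderiv ℝ H w‖ ≤ K / |w.im|)
    {z₀ : ℂ} (hz₀ : z₀ ∉ J '' S) {γ : SL(2, ℂ)} (hγ : γ ∈ Q.Γ)
    (hd₀ : γ 1 0 * z₀ + γ 1 1 ≠ 0) (hfix : mob γ z₀ = z₀) {l : ℝ}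
    (hl : l ≠ 0) (hrel : ∀ w ∈ T, H (w + l) = mob γ (H w))
    (hlim : ∀ w ∈ T, Tendsto (fun x : ℝ => H (w + x)) (cocompact ℝ) (𝓝 z₀)) :
    ∃ M : ℝ, 0 ≤ M ∧ ∀ w ∈ T, 1 ≤ |w.im| → ‖H w - z₀‖ ≤ M / |w.im| := by
  have hadd : ∀ w ∈ T, ∀ x : ℝ, w + x ∈ T := fun w hw x =>
    hT.mem_of_im hw one_pos (by simp)
  have hne : ∀ w ∈ T, H w ≠ z₀ := fun w hw h => hz₀ (h ▸ hm hw)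
  have hsub : ∀ w ∈ T, H w - z₀ ≠ 0 := fun w hw => sub_ne_zero.mpr (hne w hw)
  set a := (γ 1 0 * z₀ + γ 1 1) ^ 2 with ha
  set b := γ 1 0 * (γ 1 0 * z₀ + γ 1 1) with hb
  have hstep : ∀ w ∈ T, (H (w + l) - z₀)⁻¹ = a * (H w - z₀)⁻¹ + b := by
    intro w hw
    rw [hrel w hw, inv_mob_sub hd₀ hfix (C.denom_ne_zero hγ (hm hw)) (hne w hw)]
  obtain ⟨w₀, hw₀⟩ := hT.infinite.nonempty
  have hinf : ∀ {u : ℕ → ℝ}, Tendsto u atTop (cocompact ℝ) →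
      Tendsto (fun N => ‖(H (w₀ + u N) - z₀)⁻¹‖) atTop atTop := by
    intro u hu
    simp only [norm_inv]
    refine tendsto_inv_nhdsGT_zero.comp (tendsto_nhdsWithin_iff.mpr ⟨?_, ?_⟩)
    · have := ((hlim w₀ hw₀).comp hu).sub_const z₀
      rw [sub_self] at this
      simpa using this.norm
    · exact Eventually.of_forall fun N => norm_pos_iff.mpr (hsub _ (hadd w₀ hw₀ _))
  have hcoc : ∀ {c : ℝ}, c ≠ 0 → Tendsto (fun N : ℕ => (N : ℝ) * c) atTop (cocompact ℝ) := by
    intro c hc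
    rw [cocompact_eq_atBot_atTop]
    rcases lt_or_gt_of_ne hc with h | h
    · exact (tendsto_natCast_atTop_atTop.atTop_mul_const_of_neg h).mono_right le_sup_left
    · exact (tendsto_natCast_atTop_atTop.atTop_mul_const h).mono_right le_sup_right
  have hiter : ∀ N : ℤ, (H (w₀ + ((N + 1 : ℤ) * l : ℝ)) - z₀)⁻¹ =
      a * (H (w₀ + (N * l : ℝ)) - z₀)⁻¹ + b := by
    intro N
    rw [← hstep _ (hadd w₀ hw₀ _)]
    congr 3
    push_cast
    ring
  have hlim1 : Tendsto (fun N : ℕ => ‖(H (w₀ + (((N : ℤ) : ℝ) * l : ℝ)) - z₀)⁻¹‖) atTop atTop := by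
    simpa using hinf (hcoc hl)
  -- Moving $w$ to infinity horizontally in either direction brings $H$ to $z_0$, so the affine
  -- orbit diverges both ways; it is a translation, and $b\ne0$ as the orbit is not constant.
  have ha1 : a = 1 := eq_one_of_tendsto_both (x := fun N : ℤ => (H (w₀ + (N * l : ℝ)) - z₀)⁻¹)
    (pow_ne_zero 2 hd₀) hiter hlim1 (by simpa using hinf (hcoc (neg_ne_zero.mpr hl)))
  have hb0 : b ≠ 0 := translation_ne_zero (x := fun N : ℕ =>
    (H (w₀ + (((N : ℤ) : ℝ) * l : ℝ)) - z₀)⁻¹) (fun N => by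
      have := hiter N
      rw [ha1] at this
      exact_mod_cast this) hlim1
  have hK0 : 0 ≤ K := by
    have h1 := (mul_nonneg (Real.exp_pos _).le (norm_nonneg _)).trans (hK w₀ hw₀)
    rwa [le_div_iff₀ (hT.abs_im_pos hw₀), zero_mul] at h1
  -- The Lipschitz bound and Koebe at $z_0$ give $|dH|/|H-z_0|\le 16K\,|dw|/|\operatorname{Im}w|$;
  -- over a horizontal segment of length $|l|$ this integrates to at most
  -- $\kappa_1/|\operatorname{Im}w|$.
  set κ₁ := 16 * K * |l| with hκ₁
  have hκ₁0 : 0 ≤ κ₁ := by positivity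
  have hbpos : 0 < ‖b‖ := norm_pos_iff.mpr hb0
  refine ⟨κ₁ * Real.exp κ₁ / ‖b‖, by positivity, fun w hw h1 => ?_⟩
  have him := hT.abs_im_pos hw
  have hder : ∀ s ∈ Icc (0 : ℝ) 1, HasDerivAt (fun s : ℝ => (H (w + (s * l : ℝ)) - z₀)⁻¹)
      (-(fderiv ℝ H (w + (s * l : ℝ)) l) / (H (w + (s * l : ℝ)) - z₀) ^ 2) s := by
    intro s hs
    have hws := hadd w hw (s * l)
    have h1 : HasDerivAt (fun s : ℝ => w + ((s * l : ℝ) : ℂ)) (l : ℂ) s := by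
      simpa using (((hasDerivAt_id s).mul_const l).ofReal_comp).const_add w
    have h2 := ((hH.differentiableOn one_ne_zero).differentiableAt
      (hT.isOpen.mem_nhds hws)).hasFDerivAt
    exact ((h2.comp_hasDerivAt s h1).sub_const z₀).inv (hsub _ hws)
  have hbd : ∀ s ∈ Icc (0 : ℝ) 1,
      ‖-(fderiv ℝ H (w + (s * l : ℝ)) l) / (H (w + (s * l : ℝ)) - z₀) ^ 2‖ ≤
      κ₁ / |w.im| * ‖(H (w + (s * l : ℝ)) - z₀)⁻¹‖ := by
    intro s hs
    have hws := hadd w hw (s * l)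
    set v := w + (s * l : ℝ) with hv
    have hvim : v.im = w.im := by simp [hv]
    have h2 := hK v hws
    rw [hvim] at h2
    have h3 := C.exp_neg_half_phi_le (hm hws) hz₀
    have h4 : ‖fderiv ℝ H v‖ ≤ K / |w.im| * (16 * ‖H v - z₀‖) := by
      calc ‖fderiv ℝ H v‖ = (Real.exp (Q.phi (H v) / 2) * ‖fderiv ℝ H v‖) *
            Real.exp (-(Q.phi (H v) / 2)) := by
              rw [mul_right_comm, ← Real.exp_add]; simp
        _ ≤ _ := by gcongr
    have hpos : 0 < ‖H v - z₀‖ := norm_pos_iff.mpr (hsub v hws)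
    rw [norm_div, norm_neg, norm_pow, norm_inv, div_le_iff₀ (by positivity)]
    calc ‖fderiv ℝ H v l‖ ≤ ‖fderiv ℝ H v‖ * ‖(l : ℂ)‖ := ContinuousLinearMap.le_opNorm _ _
      _ ≤ K / |w.im| * (16 * ‖H v - z₀‖) * |l| := by
          rw [Complex.norm_real, Real.norm_eq_abs]; gcongr
      _ = _ := by rw [hκ₁]; field_simp
  -- Across one period $1/(H-z_0)$ moves by exactly $b\ne0$ although its logarithmic variation is
  -- only $O(1/|\operatorname{Im}w|)$. Hence it must itself be at least of order
  -- $|\operatorname{Im}w|$.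
  have hmain := norm_sub_le_of_log_deriv_le (by positivity) hder hbd
  have e1 : (H (w + ((1 : ℝ) * l : ℝ)) - z₀)⁻¹ - (H (w + ((0 : ℝ) * l : ℝ)) - z₀)⁻¹ = b := by
    rw [one_mul, hstep w hw, ha1]
    simp
  rw [e1] at hmain
  simp only [zero_mul, Complex.ofReal_zero, add_zero, norm_inv] at hmain
  have hpos : 0 < ‖H w - z₀‖ := norm_pos_iff.mpr (hsub w hw)
  have h5 : Real.exp (κ₁ / |w.im|) ≤ Real.exp κ₁ := Real.exp_le_exp.mpr (div_le_self hκ₁0 h1)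
  have h6 : ‖b‖ ≤ κ₁ / |w.im| * Real.exp κ₁ * ‖H w - z₀‖⁻¹ := hmain.trans (by gcongr)
  rw [← div_eq_mul_inv, le_div_iff₀ hpos] at h6
  rw [div_div, le_div_iff₀ (by positivity)]
  calc ‖H w - z₀‖ * (‖b‖ * |w.im|) = (‖b‖ * ‖H w - z₀‖) * |w.im| := by ring
    _ ≤ (κ₁ / |w.im| * Real.exp κ₁) * |w.im| := by gcongr
    _ = _ := by field_simp

/-- The integral of a form that grows slowly at a cusp converges along a ray to the cusp. -/
theorem integrableOn_cusp {θ : ℂ → ℂ → ℂ} (hθ : IsContForm (J '' S) θ) {z₀ : ℂ}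
    (ht : Q.TameAt (J '' S) θ z₀) (hz₀ : z₀ ∉ J '' S) {H : ℂ → ℂ} {T : Set ℂ} (hT : IsHalfPlane T)
    (hH : ContDiffOn ℝ 1 H T) (hm : MapsTo H T (J '' S)) {K : ℝ}
    (hK : ∀ w ∈ T, Real.exp (Q.phi (H w) / 2) * ‖fderiv ℝ H w‖ ≤ K / |w.im|)
    {M : ℝ} (hM0 : 0 ≤ M) (hM : ∀ w ∈ T, 1 ≤ |w.im| → ‖H w - z₀‖ ≤ M / |w.im|)
    {ε : ℝ} (hε : |ε| = 1) (hεT : ε * Complex.I ∈ T) :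
    IntegrableOn (fun t => θ (H (ε * ray t)) (deriv (fun t => H (ε * ray t)) t)) (Ioo 0 1) := by
  have hray : ∀ t : ℝ, (ε * ray t : ℂ) = ((ε * (1 - t)⁻¹ : ℝ) : ℂ) * Complex.I := fun t => by
    rw [ray]; push_cast; ring
  simp only [hray]
  set c : ℝ → ℂ := fun t => ((ε * (1 - t)⁻¹ : ℝ) : ℂ) * Complex.I with hc
  have him : ∀ t, (c t).im = ε * (1 - t)⁻¹ := fun t => by
    simp only [hc, Complex.im_ofReal_mul, Complex.I_im, mul_one]
  have hpos : ∀ t ∈ Iio (1 : ℝ), 0 < 1 - t := fun t ht => sub_pos.mpr ht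
  have habs : ∀ t ∈ Iio (1 : ℝ), |(c t).im| = (1 - t)⁻¹ := fun t ht => by
    rw [him, abs_mul, hε, one_mul, abs_of_pos (inv_pos.mpr (hpos t ht))]
  have hcT : ∀ t ∈ Iio (1 : ℝ), c t ∈ T := fun t ht =>
    hT.mem_of_im hεT (inv_pos.mpr (hpos t ht)) (by rw [him]; simp)
  have hcd : ∀ t ∈ Iio (1 : ℝ), HasDerivAt c (((ε * ((1 - t) ^ 2)⁻¹ : ℝ) : ℂ) * Complex.I) t := by
    intro t ht
    have h1 := (((((hasDerivAt_id t).const_sub 1).inv (hpos t ht).ne').const_mul ε).ofReal_comp).mul_const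
      Complex.I
    refine h1.congr_deriv ?_
    simp
  have hcc : ContDiffOn ℝ 1 c (Iio 1) := by
    refine ContDiffOn.mul (Complex.ofRealCLM.contDiff.comp_contDiffOn (contDiffOn_const.mul
      (ContDiffOn.inv (contDiffOn_const.sub contDiffOn_id) fun t ht => (hpos t ht).ne')))
      contDiffOn_const
  set p : ℝ → ℂ := fun t => H (c t) with hp
  have hpC : ContDiffOn ℝ 1 p (Iio 1) := hH.comp hcc hcT
  have hpm : MapsTo p (Iio 1) (J '' S) := fun t ht => hm (hcT t ht)
  have hpd : ∀ t ∈ Iio (1 : ℝ), ‖deriv p t‖ ≤ ‖fderiv ℝ H (c t)‖ * ((1 - t) ^ 2)⁻¹ := by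
    intro t ht
    have h1 := (((hH.differentiableOn one_ne_zero).differentiableAt
      (hT.isOpen.mem_nhds (hcT t ht))).hasFDerivAt.comp_hasDerivAt t (hcd t ht)).deriv
    rw [show deriv p t = _ from h1]
    refine (ContinuousLinearMap.le_opNorm _ _).trans (le_of_eq ?_)
    have := hpos t ht
    rw [norm_mul, Complex.norm_I, mul_one, Complex.norm_real, norm_mul, Real.norm_eq_abs, hε, one_mul,
      Real.norm_of_nonneg (by positivity)]
  have hcont : ContinuousOn (fun t => θ (p t) (deriv p t)) (Iio 1) :=
    hθ.continuousOn_comp hpC.continuousOn (hpC.continuousOn_deriv_of_isOpen isOpen_Iio le_rfl) hpm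
  have hpz : ∀ t ∈ Ico (0 : ℝ) 1, ‖p t - z₀‖ ≤ M * (1 - t) := by
    intro t ht
    have h1 := hM (c t) (hcT t ht.2) (by
      rw [habs t ht.2]
      exact (one_le_inv₀ (hpos t ht.2)).mpr (by linarith [ht.1]))
    rwa [habs t ht.2, div_inv_eq_mul] at h1
  have hK0 : 0 ≤ K := by
    have h1 := (mul_nonneg (Real.exp_pos _).le (norm_nonneg _)).trans (hK _ hεT)
    rwa [le_div_iff₀ (hT.abs_im_pos hεT), zero_mul] at h1
  obtain ⟨A, hA0, hA⟩ := ht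
  obtain ⟨ρ, hρ, hball⟩ := Metric.eventually_nhds_iff.mp hA
  obtain ⟨δ, hδ0, hδ1, hδρ⟩ : ∃ δ : ℝ, 0 < δ ∧ δ < 1 ∧ M * δ < ρ := by
    refine ⟨min (1 / 2) (ρ / (M + 1)), by positivity, ?_, ?_⟩
    · exact (min_le_left _ _).trans_lt (by norm_num)
    · calc M * min (1 / 2) (ρ / (M + 1)) ≤ M * (ρ / (M + 1)) := by gcongr; exact min_le_right _ _
        _ < ρ := by rw [mul_div_assoc', div_lt_iff₀ (by positivity)]; nlinarith
  have hbound : ∀ t ∈ Ioo (1 - δ) 1, ‖θ (p t) (deriv p t)‖ ≤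
      A * K * (16 * M) ^ (3 / 4 : ℝ) * (1 - t) ^ (-(1 / 4) : ℝ) := by
    intro t ht
    have ht1 : t ∈ Ico (0 : ℝ) 1 := ⟨by linarith [ht.1], ht.2⟩
    have h1t := hpos t ht.2
    have hz := hpz t ht1
    have hdist : dist (p t) z₀ < ρ := by
      rw [dist_eq_norm]
      refine hz.trans_lt (lt_of_le_of_lt ?_ hδρ)
      gcongr
      linarith [ht.1]
    have h1 := hball hdist (hpm ht.2) (deriv p t)
    have h2 := hK (c t) (hcT t ht.2)
    rw [habs t ht.2, div_inv_eq_mul] at h2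
    have h3 := C.exp_neg_half_phi_le (hpm ht.2) hz₀
    have h4 : Real.exp (-(Q.phi (p t) / 2)) ≤ 16 * M * (1 - t) := by linarith
    have h5 : Real.exp (Q.phi (p t) / 8) * Real.exp (-(Q.phi (p t) / 2)) =
        Real.exp (-(Q.phi (p t) / 2)) ^ (3 / 4 : ℝ) := by
      rw [← Real.exp_add, ← Real.exp_mul]; congr 1; ring
    have h6 : ‖fderiv ℝ H (c t)‖ ≤ K * (1 - t) * Real.exp (-(Q.phi (p t) / 2)) := by
      calc ‖fderiv ℝ H (c t)‖ = (Real.exp (Q.phi (p t) / 2) * ‖fderiv ℝ H (c t)‖) *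
            Real.exp (-(Q.phi (p t) / 2)) := by
              rw [mul_right_comm, ← Real.exp_add]; simp
        _ ≤ _ := by gcongr
    calc ‖θ (p t) (deriv p t)‖ ≤ A * Real.exp (Q.phi (p t) / 8) * ‖deriv p t‖ := h1
      _ ≤ A * Real.exp (Q.phi (p t) / 8) * ((K * (1 - t) * Real.exp (-(Q.phi (p t) / 2))) *
            ((1 - t) ^ 2)⁻¹) := by
          gcongr
          exact (hpd t ht.2).trans (by gcongr)
      _ = A * K * (Real.exp (Q.phi (p t) / 8) * Real.exp (-(Q.phi (p t) / 2))) * (1 - t)⁻¹ := by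
          field_simp
      _ ≤ A * K * (16 * M * (1 - t)) ^ (3 / 4 : ℝ) * (1 - t)⁻¹ := by rw [h5]; gcongr
      _ = A * K * (16 * M) ^ (3 / 4 : ℝ) * ((1 - t) ^ (3 / 4 : ℝ) * (1 - t)⁻¹) := by
          rw [Real.mul_rpow (by positivity) h1t.le]; ring
      _ = _ := by
          congr 1
          rw [← Real.rpow_neg_one (1 - t), ← Real.rpow_add h1t]
          norm_num
  have hnear : IntegrableOn (fun t => θ (p t) (deriv p t)) (Ioo (1 - δ) 1) := by
    refine Integrable.mono' ((integrableOn_rpow_one_sub.mono_set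
      (Ioo_subset_Ioo_left (by linarith))).const_mul (A * K * (16 * M) ^ (3 / 4 : ℝ)))
      ((hcont.mono fun t ht => ht.2).aestronglyMeasurable measurableSet_Ioo) ?_
    exact ae_restrict_of_forall_mem measurableSet_Ioo hbound
  have hfar := (hcont.mono (s := Iio 1) (t := Icc 0 (1 - δ)) fun t ht => by
    have := ht.2
    simp only [mem_Iio]
    linarith).integrableOn_Icc (μ := volume)
  exact (hfar.union hnear).mono_set fun s hs => (le_or_gt s (1 - δ)).imp (fun h => ⟨hs.1.le, h⟩)
    fun h => ⟨h, hs.2⟩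

end QuasiFuchsian.IsComponent

end Liouville

namespace Liouville

/-! ### The points `0` and `∞` are not equivalent -/

theorem mul_apply_two_real (A B : SL(2, ℝ)) (i j : Fin 2) :
    (A * B) i j = A i 0 * B 0 j + A i 1 * B 1 j := by
  rw [Matrix.SpecialLinearGroup.coe_mul, Matrix.mul_apply, Fin.sum_univ_two]

theorem inv_apply_real (γ : SL(2, ℝ)) :
    γ⁻¹ 0 0 = γ 1 1 ∧ γ⁻¹ 0 1 = -γ 0 1 ∧ γ⁻¹ 1 0 = -γ 1 0 ∧ γ⁻¹ 1 1 = γ 0 0 := by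
  rw [Matrix.SpecialLinearGroup.coe_inv, Matrix.adjugate_fin_two]
  simp

theorem act_ofReal (δ : SL(2, ℝ)) (x : ℝ) : act δ (x : OnePoint ℝ) =
    if δ 1 0 * x + δ 1 1 = 0 then OnePoint.infty
    else (((δ 0 0 * x + δ 0 1) / (δ 1 0 * x + δ 1 1) : ℝ) : OnePoint ℝ) := by
  rw [act, OnePoint.smul_some_eq_ite]
  rfl

theorem act_infty (δ : SL(2, ℝ)) : act δ OnePoint.infty =
    if δ 1 0 = 0 then OnePoint.infty else ((δ 0 0 / δ 1 0 : ℝ) : OnePoint ℝ) := by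
  rw [act, OnePoint.smul_infty_eq_ite]
  rfl

/-- In a discrete group, an element with a fixed point in common with a diagonal hyperbolic
element is diagonal. -/
theorem upper_right_eq_zero {G : Subgroup SL(2, ℝ)} (hG : DiscreteTopology G) {α β : SL(2, ℝ)}
    (hα : α ∈ G) (hβ : β ∈ G) (h01 : α 0 1 = 0) (h10 : α 1 0 = 0) (h11 : 1 < |α 1 1|)
    (hβ10 : β 1 0 = 0) : β 0 1 = 0 := by
  have hdet := det_eq_one_real α
  rw [h01, zero_mul, sub_zero] at hdet
  have hdβ := det_eq_one_real β
  rw [hβ10, mul_zero, sub_zero] at hdβ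
  obtain ⟨i00, i01, i10, i11⟩ := inv_apply_real α
  set k := α 0 0 ^ 2 with hk
  have hk1 : k < 1 := by
    have h1 : |α 0 0| * |α 1 1| = 1 := by rw [← abs_mul, hdet, abs_one]
    have h2 : |α 0 0| < 1 := by
      by_contra! h
      nlinarith
    rw [hk, ← sq_abs]
    nlinarith [abs_nonneg (α 0 0)]
  -- $u_N=\alpha^N\beta\alpha^{-N}$ has the diagonal of $\beta$ and upper right entry
  -- $\beta_{01}k^N\to0$, so it converges to a diagonal matrix.
  let u : ℕ → SL(2, ℝ) := fun N => Nat.rec β (fun _ x => α * x * α⁻¹) N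
  have hu : ∀ N, u (N + 1) = α * u N * α⁻¹ := fun N => rfl
  have hmem : ∀ N, u N ∈ G := by
    intro N
    induction N with
    | zero => exact hβ
    | succ N ih => rw [hu]; exact G.mul_mem (G.mul_mem hα ih) (G.inv_mem hα)
  have hent : ∀ N, u N 0 0 = β 0 0 ∧ u N 0 1 = β 0 1 * k ^ N ∧ u N 1 0 = 0 ∧ u N 1 1 = β 1 1 := by
    intro N
    induction N with
    | zero => exact ⟨rfl, by simp [u], hβ10, rfl⟩
    | succ N ih =>
      obtain ⟨e00, e01, e10, e11⟩ := ih
      rw [hu]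
      simp only [mul_apply_two_real, i00, i01, i10, i11, h01, h10, e00, e01, e10, e11]
      refine ⟨?_, ?_, ?_, ?_⟩
      · linear_combination β 0 0 * hdet
      · rw [pow_succ, hk]; ring
      · ring
      · linear_combination β 1 1 * hdet
  let lim : SL(2, ℝ) := ⟨!![β 0 0, 0; 0, β 1 1], by rw [Matrix.det_fin_two_of, hdβ]; ring⟩
  have hlim : Tendsto u atTop (𝓝 lim) := by
    refine tendsto_subtype_rng.mpr ?_
    refine tendsto_pi_nhds.mpr fun i => tendsto_pi_nhds.mpr fun j => ?_
    have hk0 : Tendsto (fun N => β 0 1 * k ^ N) atTop (𝓝 0) := by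
      have := (tendsto_pow_atTop_nhds_zero_of_lt_one (sq_nonneg (α 0 0)) hk1).const_mul (β 0 1)
      rwa [mul_zero] at this
    fin_cases i <;> fin_cases j
    · exact tendsto_const_nhds.congr fun N => (hent N).1.symm
    · exact hk0.congr fun N => (hent N).2.1.symm
    · exact tendsto_const_nhds.congr fun N => (hent N).2.2.1.symm
    · exact tendsto_const_nhds.congr fun N => (hent N).2.2.2.symm
  have hclosed : IsClosed (G : Set SL(2, ℝ)) := Subgroup.isClosed_of_discrete
  have hlmem : lim ∈ G := hclosed.mem_of_tendsto hlim (Eventually.of_forall hmem)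
  -- A discrete subgroup is closed, so the limit belongs to $G$ and some $u_N$ equals it; there
  -- $\beta_{01}k^N=0$ with $k\ne0$.
  have hsub : Tendsto (fun N => (⟨u N, hmem N⟩ : G)) atTop (𝓝 ⟨lim, hlmem⟩) :=
    tendsto_subtype_rng.mpr hlim
  rw [nhds_discrete, tendsto_pure] at hsub
  obtain ⟨N, hN⟩ := hsub.exists
  have h1 : u N 0 1 = 0 := by rw [show u N = lim from congrArg Subtype.val hN]; rfl
  rw [(hent N).2.1] at h1
  refine (mul_eq_zero.mp h1).resolve_right (pow_ne_zero _ ?_)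
  rw [hk]
  exact pow_ne_zero 2 (left_ne_zero_of_mul_eq_one hdet)

variable {g n r : ℕ}

theorem IsMarkedFuchsian.exists_lift {m : Fin r → ℕ} {Γ : Subgroup SL(2, ℝ)}
    {gen : Gen g n r → SL(2, ℝ)} (h : IsMarkedFuchsian m Γ gen) {δ : SL(2, ℝ)} (hδ : δ ∈ Γ) :
    ∃ w : FreeGroup (Gen g n r), δ = FreeGroup.lift gen w ∨ δ = -FreeGroup.lift gen w := by
  rw [← h.generate] at hδ
  induction hδ using Subgroup.closure_induction with
  | mem x hx =>
    rcases hx with ⟨s, rfl⟩ | hx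
    · exact ⟨FreeGroup.of s, .inl (by simp)⟩
    · exact ⟨1, .inr (by rw [map_one]; exact hx)⟩
  | one => exact ⟨1, .inl (by simp)⟩
  | mul x y _ _ hx hy =>
    obtain ⟨v, hv⟩ := hx
    obtain ⟨w, hw⟩ := hy
    refine ⟨v * w, ?_⟩
    rw [map_mul]
    rcases hv with rfl | rfl <;> rcases hw with rfl | rfl <;> simp
  | inv x _ hx =>
    obtain ⟨v, hv⟩ := hx
    refine ⟨v⁻¹, ?_⟩
    rw [map_inv]
    rcases hv with rfl | rfl
    · simp
    · right; rw [inv_neg]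

/-- The generator `α_k` is not conjugate to its inverse. -/
theorem IsMarkedFuchsian.not_conj_inv {m : Fin r → ℕ} {Γ : Subgroup SL(2, ℝ)}
    {gen : Gen g n r → SL(2, ℝ)} (h : IsMarkedFuchsian m Γ gen) {δ : SL(2, ℝ)} (hδ : δ ∈ Γ)
    (k : Fin g) : δ * gen (.a k) * δ⁻¹ * gen (.a k) ≠ 1 := by
  classical
  intro h1
  obtain ⟨w, hw⟩ := h.exists_lift hδ
  -- The exponent sum of $\alpha_k$. It kills the commutators and the relators $\tau_j^{m_j}$, hence
  -- factors through the presentation; a conjugacy of $\alpha_k$ with its inverse would give $1+1=0$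
  -- in $\mathbb Z$.
  let χ : FreeGroup (Gen g n r) →* Multiplicative ℤ := FreeGroup.lift fun s =>
    match s with
    | .a j => if j = k then Multiplicative.ofAdd 1 else 1
    | _ => 1
  have hrel : FreeGroup.lift gen
      (w * FreeGroup.of (.a k) * w⁻¹ * FreeGroup.of (.a k)) = 1 := by
    simp only [map_mul, map_inv, FreeGroup.lift_apply_of]
    rcases hw with rfl | rfl
    · exact h1
    · rw [← h1]; simp [inv_neg]
  have hmem := (h.presentation _).mp (.inl hrel)
  have hle : Subgroup.normalClosure (relators g n r m) ≤ χ.ker := by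
    refine Subgroup.normalClosure_le_normal ?_
    rintro x (rfl | ⟨j, rfl⟩)
    · change χ (longWord g n r) = 1
      rw [longWord, map_mul, map_mul, map_list_prod, map_list_prod, map_list_prod,
        List.map_ofFn, List.map_ofFn, List.map_ofFn]
      have e1 : (List.ofFn (χ ∘ fun k : Fin g => FreeGroup.of (Gen.a k) * FreeGroup.of (Gen.b k) *
          (FreeGroup.of (Gen.a k))⁻¹ * (FreeGroup.of (Gen.b k))⁻¹)).prod = 1 := by
        refine List.prod_eq_one fun x hx => ?_
        obtain ⟨j, rfl⟩ := List.mem_ofFn.mp hx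
        simp [χ]
      have e2 : (List.ofFn (χ ∘ fun i : Fin n => FreeGroup.of (Gen.c i))).prod = 1 := by
        refine List.prod_eq_one fun x hx => ?_
        obtain ⟨j, rfl⟩ := List.mem_ofFn.mp hx
        simp [χ]
      have e3 : (List.ofFn (χ ∘ fun j : Fin r => FreeGroup.of (Gen.d j))).prod = 1 := by
        refine List.prod_eq_one fun x hx => ?_
        obtain ⟨j, rfl⟩ := List.mem_ofFn.mp hx
        simp [χ]
      rw [e1, e2, e3, one_mul, one_mul]
    · change χ (FreeGroup.of (Gen.d j) ^ m j) = 1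
      simp [χ]
  have hker : χ (w * FreeGroup.of (.a k) * w⁻¹ * FreeGroup.of (.a k)) = 1 := hle hmem
  have h2 : χ (FreeGroup.of (.a k)) * χ (FreeGroup.of (.a k)) = 1 := by
    rw [map_mul, map_mul, map_mul, map_inv, mul_comm (χ w), mul_inv_cancel_right] at hker
    exact hker
  have h3 : χ (FreeGroup.of (.a k)) = Multiplicative.ofAdd 1 := by simp [χ]
  rw [h3, ← ofAdd_add, ofAdd_eq_one] at h2
  norm_num at h2

namespace QuasiFuchsian

variable {m : Fin r → ℕ} (Q : QuasiFuchsian g n r m)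

/-- No element of the normalized group maps `0` to `∞`. -/
theorem lower_right_ne_zero {δ : SL(2, ℝ)} (hδ : δ ∈ Q.Γ₁) : δ 1 1 ≠ 0 := by
  intro h0
  rcases Q.normalized with ⟨hg, ⟨hfix0, hfixI, hμ⟩, -⟩ | ⟨-, -, -, hne⟩
  · set α := Q.gen₁ (.a ⟨0, hg⟩) with hα
    have hαm : α ∈ Q.Γ₁ := by
      rw [← Q.fuchsian₁.generate]
      exact Subgroup.subset_closure (.inl ⟨_, rfl⟩)
    have hμ0 : α 1 1 ≠ 0 := by
      intro h; rw [h, abs_zero] at hμ; linarith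
    have h10 : α 1 0 = 0 := by
      rw [act_infty] at hfixI
      by_contra h
      rw [if_neg h] at hfixI
      exact OnePoint.coe_ne_infty _ hfixI
    have h01 : α 0 1 = 0 := by
      rw [act_ofReal, mul_zero, zero_add, if_neg hμ0, mul_zero, zero_add] at hfix0
      have := OnePoint.coe_injective hfix0
      exact (div_eq_zero_iff.mp this).resolve_right hμ0
    have hdα := det_eq_one_real α
    have hdδ := det_eq_one_real δ
    rw [h01, zero_mul, sub_zero] at hdα
    rw [h0, mul_zero, zero_sub] at hdδ
    obtain ⟨i00, i01, i10, i11⟩ := inv_apply_real δ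
    have hcm : δ * α * δ⁻¹ ∈ Q.Γ₁ :=
      Q.Γ₁.mul_mem (Q.Γ₁.mul_mem hδ hαm) (Q.Γ₁.inv_mem hδ)
    -- If $\delta(0)=\infty$, then $\delta\alpha\delta^{-1}$ fixes $\infty$ as $\alpha$ does, and
    -- discreteness makes it diagonal. This forces $\delta_{00}=0$.
    have hur := upper_right_eq_zero Q.fuchsian₁.discrete hαm hcm h01 h10 hμ (by
      simp only [mul_apply_two_real, i00, i10, h01, h10, h0]; ring)
    simp only [mul_apply_two_real, i01, i11, h01, h10] at hur
    have hb : δ 0 1 ≠ 0 := by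
      intro h; rw [h] at hdδ; simp at hdδ
    have hμ2 : α 1 1 - α 0 0 ≠ 0 := by
      intro h
      have e : α 0 0 = α 1 1 := by linarith
      rw [e] at hdα
      have : |α 1 1| * |α 1 1| = 1 := by rw [← abs_mul, hdα, abs_one]
      nlinarith
    have ha : δ 0 0 = 0 := by
      have : δ 0 0 * (δ 0 1 * (α 1 1 - α 0 0)) = 0 := by linear_combination hur
      exact (mul_eq_zero.mp this).resolve_right (mul_ne_zero hb hμ2)
    -- Now $\delta$ is antidiagonal and exchanges $0$ and $\infty$, so it conjugates the diagonal
    -- $\alpha$ to its inverse.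
    refine Q.fuchsian₁.not_conj_inv hδ ⟨0, hg⟩ ?_
    rw [← hα]
    ext i j
    fin_cases i <;> fin_cases j
    all_goals
      simp only [Fin.zero_eta, Fin.mk_one, mul_apply_two_real, i00, i01, i10, i11, h01, h10, h0, ha]
      simp
    · linear_combination (-(δ 0 1 * δ 1 0)) * hdα + hdδ
    · linear_combination (-(δ 0 1 * δ 1 0)) * hdα + hdδ
  · exact hne δ hδ (by rw [act_ofReal, if_pos (by rw [h0]; ring)])

end QuasiFuchsian

end Liouville

/-! ### Geodesics and the boundary of the polygon -/

namespace Liouville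

open MeasureTheory

variable {g n r : ℕ}

theorem volume_re_eq_zero : volume {z : ℂ | z.re = 0} = 0 := by
  have h : LinearMap.ker Complex.reLm ≠ ⊤ := by
    intro h
    have h1 : (1 : ℂ) ∈ LinearMap.ker Complex.reLm := h ▸ Submodule.mem_top
    simp at h1
  exact Measure.addHaar_submodule volume _ h

theorem contDiffOn_mob (A : SL(2, ℝ)) {T : Set ℂ} (hT : IsHalfPlane T) :
    ContDiffOn ℝ 1 (mob (toC A)) T :=
  (DifferentiableOn.contDiffOn (fun _z hz => (hasDerivAt_mob _ _
    (denom_ne_zero A (hT.im_ne_zero hz))).differentiableAt.differentiableWithinAt)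
    hT.isOpen).restrict_scalars ℝ

theorem mob_sub_div (A : SL(2, ℂ)) (hA : A 1 0 ≠ 0) {z : ℂ} (h : A 1 0 * z + A 1 1 ≠ 0) :
    mob A z = A 0 0 / A 1 0 - (A 1 0 * (A 1 0 * z + A 1 1))⁻¹ := by
  rw [mob, eq_sub_iff_add_eq, inv_eq_one_div, div_add_div _ _ h (mul_ne_zero hA h),
    div_eq_div_iff (mul_ne_zero h (mul_ne_zero hA h)) hA]
  linear_combination (-(A 1 0 * (A 1 0 * z + A 1 1))) * det_eq_one A

theorem tendsto_norm_mul_add {a b : ℂ} (ha : a ≠ 0) {ι : Type*} {l : Filter ι} {x : ι → ℂ}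
    (hx : Tendsto (fun i => ‖x i‖) l atTop) : Tendsto (fun i => ‖a * x i + b‖) l atTop := by
  have h1 : Tendsto (fun i => ‖a‖ * ‖x i‖ + -‖b‖) l atTop :=
    tendsto_atTop_add_const_right _ _ (hx.const_mul_atTop (norm_pos_iff.mpr ha))
  refine tendsto_atTop_mono (fun i => ?_) h1
  rw [← norm_mul]
  have := norm_le_add_norm_add (a * x i) b
  linarith

theorem tendsto_norm_of_homeomorph (J : ℂ ≃ₜ ℂ) {ι : Type*} {l : Filter ι} {x : ι → ℂ}
    (hx : Tendsto (fun i => ‖x i‖) l atTop) : Tendsto (fun i => ‖J (x i)‖) l atTop :=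
  (tendsto_norm_cocompact_atTop (E := ℂ)).comp
    (J.isClosedEmbedding.tendsto_cocompact.comp (by
      rwa [← Metric.cobounded_eq_cocompact, ← comap_norm_atTop, tendsto_comap_iff]))

theorem contDiff_segment (l : ℝ) : ContDiff ℝ 1 (segment l) := by
  unfold segment
  have h : ContDiff ℝ 1 fun t : ℝ => ((Real.exp (l * t) : ℝ) : ℂ) :=
    Complex.ofRealCLM.contDiff.comp
      (Real.contDiff_exp.comp (contDiff_const.mul contDiff_id))
  exact contDiff_const.mul h

theorem segment_mem (l t : ℝ) : segment l t ∈ U := by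
  simp only [U, segment, mem_ofPred_eq, Complex.mul_im, Complex.I_re, Complex.I_im,
    Complex.ofReal_im, Complex.ofReal_re]
  simpa using Real.exp_pos _

theorem ray_eq (t : ℝ) : ray t = (((1 - t)⁻¹ : ℝ) : ℂ) * Complex.I := by
  rw [ray]; push_cast; ring

theorem ray_mem {t : ℝ} (ht : t < 1) : ray t ∈ U := by
  rw [ray_eq, U, mem_ofPred_eq, Complex.im_ofReal_mul, Complex.I_im, mul_one]
  exact inv_pos.mpr (sub_pos.mpr ht)

theorem countable_gen : Countable (Gen g n r) := by
  let f : Gen g n r → Fin 4 × ℕ := fun s => match s with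
    | .a k => (0, k)
    | .b k => (1, k)
    | .c i => (2, i)
    | .d j => (3, j)
  refine Function.Injective.countable (f := f) ?_
  rintro (k | k | k | k) (l | l | l | l) h <;> simp [f, Fin.ext_iff] at h ⊢ <;> exact h

theorem volume_mob_image_eq_zero (A : SL(2, ℝ)) {X : Set ℂ} (hX : X ⊆ U) (h : volume X = 0) :
    volume (mob (toC A) '' X) = 0 :=
  volume_image_eq_zero (fun _z hz => ((hasDerivAt_mob _ _ (denom_ne_zero A
    (IsHalfPlane.im_ne_zero (.inl rfl) (hX hz)))).differentiableAt.restrictScalars ℝ)) h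

/-- The boundary in $\mathbb U$ is a countable union of arcs that Möbius maps carry from the
imaginary axis, which is a null set. -/
theorem volume_diff_interior_eq_zero {Γ : Subgroup SL(2, ℝ)} {gen : Gen g n r → SL(2, ℝ)}
    {F : Set ℂ} {e : Gen g n r → ℝ → ℂ} {q : ℕ → ℂ} (h : IsStandardPolygon Γ gen F e q) :
    volume (F \ interior F) = 0 := by
  have hU : IsHalfPlane U := .inl rfl
  have hax : volume ({z : ℂ | z.re = 0} ∩ U) = 0 :=
    measure_mono_null inter_subset_left volume_re_eq_zero
  have hsub : F \ interior F ⊆ frontier F ∩ U := fun z hz =>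
    ⟨⟨subset_closure hz.1, hz.2⟩, h.subset hz.1⟩
  refine measure_mono_null hsub ?_
  rw [h.boundary]
  have : Countable (Gen g n r × Bool) := by
    have := countable_gen (g := g) (n := n) (r := r)
    infer_instance
  refine measure_iUnion_null fun s => ?_
  have he : ∃ A : SL(2, ℝ), e s.1 '' sideDom s.1 ⊆ mob (toC A) '' ({z : ℂ | z.re = 0} ∩ U) := by
    by_cases hs : ∃ i, s.1 = .c i
    · obtain ⟨i, hi⟩ := hs
      obtain ⟨A, hA, -⟩ := h.cusp i
      refine ⟨A, ?_⟩
      rw [hi]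
      rintro _ ⟨t, ht, rfl⟩
      rw [hA t ht]
      exact mem_image_of_mem _ ⟨by simp [ray_eq], ray_mem ht.2⟩
    · push Not at hs
      obtain ⟨A, l, -, hA, -⟩ := h.geodesic s.1 hs
      refine ⟨A, ?_⟩
      rintro _ ⟨t, ht, rfl⟩
      have ht' : t ∈ Icc (0 : ℝ) 1 := by
        revert ht
        cases s.1 with
        | c i => exact fun ht => Ico_subset_Icc_self ht
        | _ => exact id
      rw [hA t ht']
      exact mem_image_of_mem _ ⟨by simp [segment, -Complex.ofReal_exp], segment_mem l t⟩
  obtain ⟨A, hA⟩ := he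
  have h1 : volume (e s.1 '' sideDom s.1) = 0 :=
    measure_mono_null hA (volume_mob_image_eq_zero A inter_subset_right hax)
  have hsU : e s.1 '' sideDom s.1 ⊆ U := hA.trans (by
    rintro _ ⟨z, hz, rfl⟩
    exact hU.mob_mem A hz.2)
  by_cases hb : s.2
  · have e1 : side gen e s '' sideDom s.1 = mob (toC (gen s.1)⁻¹) '' (e s.1 '' sideDom s.1) := by
      rw [side, if_pos hb, image_image]
    rw [e1]
    exact volume_mob_image_eq_zero _ hsU h1
  · rw [side, if_neg hb]
    exact h1

/-! ### Polygon, compact sides and contracting paths on both components -/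

namespace QuasiFuchsian

variable {m : Fin r → ℕ} {Q : QuasiFuchsian g n r m}

/-- No element of the normalized quasi-Fuchsian group maps `0` to `∞`. -/
theorem lower_right_ne_zero' {γ : SL(2, ℂ)} (hγ : γ ∈ Q.Γ) : γ 1 0 * 0 + γ 1 1 ≠ 0 := by
  obtain ⟨δ, hδ, h⟩ := Q.conj₁' γ hγ
  have hδ0 := Q.lower_right_ne_zero hδ
  have hU : IsHalfPlane U := .inl rfl
  set z : ℕ → ℂ := fun N => ((1 / ((N : ℝ) + 1) : ℝ) : ℂ) * Complex.I with hz
  have hzU : ∀ N, z N ∈ U := fun N => by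
    rw [U, mem_ofPred_eq, hz, Complex.im_ofReal_mul, Complex.I_im, mul_one]
    positivity
  have hz0 : Tendsto z atTop (𝓝 0) := by
    have := ((Complex.continuous_ofReal.tendsto 0).comp
      (tendsto_one_div_add_atTop_nhds_zero_nat (𝕜 := ℝ))).mul_const Complex.I
    rw [Complex.ofReal_zero, zero_mul] at this
    exact this
  have hJ : Tendsto (fun N => Q.J₁ (z N)) atTop (𝓝 0) := by
    have := (Q.J₁.continuous.tendsto 0).comp hz0
    rwa [Q.fix₁.1] at this
  have hd0 : toC δ 1 0 * 0 + toC δ 1 1 ≠ 0 := by simpa using hδ0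
  have hJδ := (Q.J₁.continuous.tendsto _).comp ((continuousAt_mob hd0).tendsto.comp hz0)
  -- Let $z\to0$ in $J_1(\delta z)(cJ_1(z)+d)=aJ_1(z)+b$; the left side stays finite since
  -- $\delta(0)\ne\infty$. Thus $d=0$ would imply $b=0$, contradicting $\det\gamma=1$.
  have h1 := hJδ.mul ((hJ.const_mul (γ 1 0)).add_const (γ 1 1))
  have h2 := (hJ.const_mul (γ 0 0)).add_const (γ 0 1)
  have h3 := tendsto_nhds_unique (h1.congr fun N => by
    simp only [Function.comp_apply]
    rw [h _ (.inl (hzU N)), mob, div_mul_cancel₀ _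
      (Q.isComponent₁.denom_ne_zero hγ (mem_image_of_mem _ (hzU N)))]) h2
  intro h0
  rw [h0, mul_zero, mul_zero, zero_add] at h3
  rw [mul_zero, zero_add] at h0
  have hdet := det_eq_one γ
  rw [← h3, h0] at hdet
  simp at hdet

variable (Q) in
/-- `J₁ ∘ ψ` maps the upper half plane onto the component `J(S)`; it is continuously
differentiable and Lipschitz for the hyperbolic metrics. -/
structure IsHalf (G : Subgroup SL(2, ℝ)) (J : ℂ ≃ₜ ℂ) (S T : Set ℂ) (ψ : ℂ ≃L[ℝ] ℂ)
    (K ε : ℝ) : Prop where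
  component : Q.IsComponent G J S
  halfPlane : IsHalfPlane T
  image_eq : Q.J₁ '' T = J '' S
  contDiffOn : ContDiffOn ℝ 1 Q.J₁ T
  lipschitz : ∀ w ∈ T, Real.exp (Q.phi (Q.J₁ w) / 2) * ‖fderiv ℝ Q.J₁ w‖ ≤ K / |w.im|
  map_mob : ∀ (δ : SL(2, ℝ)) (z : ℂ), ψ (mob (toC δ) z) = mob (toC δ) (ψ z)
  mapsTo : MapsTo ψ U T
  abs_eq : |ε| = 1
  map_ray : ∀ t, ψ (ray t) = ε * ray t

namespace IsHalf

variable {G : Subgroup SL(2, ℝ)} {J : ℂ ≃ₜ ℂ} {S T : Set ℂ} {ψ : ℂ ≃L[ℝ] ℂ} {K ε : ℝ}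
  (C : Q.IsHalf G J S T ψ K ε)

include C

theorem mapsTo_J : MapsTo Q.J₁ T (J '' S) := fun z hz => by
  rw [← C.image_eq]; exact mem_image_of_mem _ hz

theorem integrableOn_density {gen : Gen g n r → SL(2, ℝ)} {F : Set ℂ}
    {e : Gen g n r → ℝ → ℂ} {q : ℕ → ℂ} (h : IsStandardPolygon Q.Γ₁ gen F e q) :
    IntegrableOn Q.density (Q.J₁ '' (ψ '' F)) := by
  have hsub : Q.J₁ '' (ψ '' F) ⊆ J '' S := by
    rintro _ ⟨_, ⟨z, hz, rfl⟩, rfl⟩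
    exact C.mapsTo_J (C.mapsTo (h.subset hz))
  have hiF : interior F ⊆ F := interior_subset
  have hopen : IsOpen (Q.J₁ '' (ψ '' interior F)) :=
    Q.J₁.isOpenMap _ (ψ.toHomeomorph.isOpenMap _ isOpen_interior)
  -- The polygon is replaced by its interior, whose image is open and has genuinely disjoint
  -- translates; the rest of its image is null because $J_1$ is differentiable there.
  have hfin := C.component.lintegral_exp_phi_lt_top ((image_mono (image_mono hiF)).trans hsub)
    hopen.measurableSet.nullMeasurableSet (by
      intro γ hγ h1 h2
      obtain ⟨δ, hδ, hconj⟩ := Q.conj₁' γ hγ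
      have hne : mob (toC δ) ≠ id := by
        intro h0
        have := eq_one_or_of_mob_eq (γ := γ) (C.halfPlane.infinite.image Q.J₁.injective.injOn) (by
          rintro _ ⟨z, hz, rfl⟩
          refine ⟨C.component.denom_ne_zero hγ (C.mapsTo_J hz), ?_⟩
          rw [← hconj z (C.halfPlane.subset_union hz), h0, id])
        exact this.elim h1 h2
      have hdis := h.disjoint δ hδ (fun h => hne (by ext z; simp [h]))
        (fun h => hne (by ext z; simp [h, toC_neg]))
      refine measure_mono_null ?_ (measure_empty (μ := volume))
      rintro _ ⟨⟨_, ⟨x, hx, rfl⟩, rfl⟩, _, ⟨_, ⟨y, hy, rfl⟩, rfl⟩, hxy⟩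
      have hyT := C.mapsTo (h.subset (hiF hy))
      rw [← hconj _ (C.halfPlane.subset_union hyT), ← C.map_mob] at hxy
      have hxy' := ψ.injective (Q.J₁.injective hxy)
      exact disjoint_left.mp hdis hx ⟨y, hy, hxy'⟩)
  have hnull : volume (Q.J₁ '' (ψ '' (F \ interior F))) = 0 := by
    refine volume_image_eq_zero ?_ (volume_image_eq_zero (fun z _ => ψ.differentiableAt)
      (volume_diff_interior_eq_zero h))
    rintro _ ⟨z, hz, rfl⟩
    exact (C.contDiffOn.differentiableOn one_ne_zero).differentiableAt
      (C.halfPlane.isOpen.mem_nhds (C.mapsTo (h.subset hz.1)))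
  refine C.component.integrableOn_density hsub ?_
  have hun : Q.J₁ '' (ψ '' F) = Q.J₁ '' (ψ '' interior F) ∪ Q.J₁ '' (ψ '' (F \ interior F)) := by
    rw [← image_union, ← image_union, union_sdiff_cancel hiF]
  rw [hun]
  refine (lintegral_union_le _ _ _).trans_lt ?_
  rw [setLIntegral_measure_zero _ _ hnull, add_zero]
  exact hfin

theorem lineIntegrable_geodesic {η : SL(2, ℂ)} (hη : η ∈ Q.Γ) {p : ℝ → ℂ} {A : SL(2, ℝ)} {l : ℝ}
    (hp : ∀ t ∈ Icc (0 : ℝ) 1, p t = mob (toC A) (segment l t)) :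
    LineIntegrable (Q.theta η) fun t => Q.J₁ (ψ (p t)) := by
  have hU : IsHalfPlane U := .inl rfl
  have hpU : MapsTo p (Icc 0 1) U := fun t ht => by
    rw [hp t ht]; exact hU.mob_mem A (segment_mem l t)
  have hpc : ContDiffOn ℝ 1 p (Icc 0 1) :=
    ((contDiffOn_mob A hU).comp (contDiff_segment l).contDiffOn
      fun t _ => segment_mem l t).congr hp
  exact (C.component.isContForm_theta hη).integrableOn zero_lt_one
    (C.contDiffOn.comp (ψ.contDiff.comp_contDiffOn hpc) fun t ht => C.mapsTo (hpU ht))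
    fun t ht => C.mapsTo_J (C.mapsTo (hpU ht))

/-- The path is carried to a path contracted to $0$ by the corresponding element of $\Gamma$, and no
element of $\Gamma$ has its pole at $0$, so $\check u$ is tame there. -/
theorem lineIntegrable_contracting {η₁ η₂ : SL(2, ℂ)} (h₁ : η₁ ∈ Q.Γ) (h₂ : η₂ ∈ Q.Γ)
    {p : ℝ → ℂ} {w : ℂ} (hp : IsContractingPath Q.Γ₁ w p) :
    LineIntegrable (Q.u η₁ η₂) fun t => Q.J₁ (ψ (p t)) := by
  obtain ⟨δ, hδ, -, κ, hκ, hrel⟩ := hp.contracting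
  obtain ⟨γ, hγ, hconj⟩ := Q.conj₁ δ hδ
  have hpT : ∀ s ∈ Ioc (0 : ℝ) 1, ψ (p s) ∈ T := fun s hs => C.mapsTo (hp.mem s hs)
  have hlim : Tendsto (fun s => Q.J₁ (ψ (p s))) (𝓝[>] 0) (𝓝 0) := by
    have h1 : Tendsto p (𝓝[>] 0) (𝓝 0) := by
      have := hp.continuousOn 0 (by simp)
      rw [ContinuousWithinAt, hp.source] at this
      exact this.mono_left (nhdsWithin_le_of_mem (Icc_mem_nhdsGT zero_lt_one))
    have h2 := (Q.J₁.continuous.comp ψ.continuous).tendsto 0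
    simp only [Function.comp_apply, map_zero, Q.fix₁.1] at h2
    exact h2.comp h1
  exact C.component.integrableOn_contracting (C.component.isContForm_u h₁ h₂)
    (C.component.tameAt_u h₁ C.component.zero_notMem (lower_right_ne_zero' (Q.Γ.inv_mem h₁))
      (lower_right_ne_zero' (Q.Γ.inv_mem (Q.Γ.mul_mem h₁ h₂))))
    (C.contDiffOn.comp (ψ.contDiff.comp_contDiffOn hp.smooth) hpT)
    (fun s hs => C.mapsTo_J (hpT s hs)) hlim hγ hκ (fun s hs => by
      rw [hrel s hs, C.map_mob, hconj _ (C.halfPlane.subset_union (hpT s ⟨hs.1, hs.2.trans hκ.2⟩))])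

end IsHalf

end QuasiFuchsian

end Liouville

/-! ### Sides ending at cusps -/

namespace Liouville

open MeasureTheory

variable {g n r : ℕ}

/-- A parabolic element fixing `A(∞)` is conjugate by `A` to a translation. -/
theorem exists_translation {κ A : SL(2, ℝ)} (hκ : κ.val.IsParabolic)
    (hfix : act κ (act A OnePoint.infty) = act A OnePoint.infty) :
    ∃ l : ℝ, l ≠ 0 ∧ ∀ z : ℂ, z.im ≠ 0 →
      mob (toC A) (z + l) = mob (toC κ) (mob (toC A) z) := by
  obtain ⟨i00, i01, i10, i11⟩ := inv_apply_real A
  set κ' := A⁻¹ * κ * A with hκ'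
  have h10 : κ' 1 0 = 0 := by
    have hact : ∀ δ δ' : SL(2, ℝ), ∀ x, act (δ * δ') x = act δ (act δ' x) := fun δ δ' x => by
      simp only [act, map_mul, mul_smul]
    have h1 : act κ' OnePoint.infty = OnePoint.infty := by
      rw [hκ', hact, hact, hfix, ← hact, inv_mul_cancel]
      simp [act]
    rw [act_infty] at h1
    by_contra h
    rw [if_neg h] at h1
    exact OnePoint.coe_ne_infty _ h1
  have hpar : κ'.val.IsParabolic := by
    have : κ'.val = (Matrix.SpecialLinearGroup.toGL A : GL (Fin 2) ℝ).val⁻¹ * κ.val *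
        (Matrix.SpecialLinearGroup.toGL A : GL (Fin 2) ℝ).val := by
      rw [← Matrix.coe_units_inv, ← map_inv]
      rfl
    rw [this]
    exact (Matrix.isParabolic_conj'_iff _).mpr hκ
  obtain ⟨hdiag, h01⟩ := (Matrix.isParabolic_iff_of_upperTriangular h10).mp hpar
  have hdet := det_eq_one_real κ'
  rw [h10, mul_zero, sub_zero] at hdet
  have h11 : κ' 1 1 ≠ 0 := right_ne_zero_of_mul_eq_one hdet
  refine ⟨κ' 0 1 / κ' 1 1, div_ne_zero h01 h11, fun z hz => ?_⟩
  have h1 : z + ((κ' 0 1 / κ' 1 1 : ℝ) : ℂ) = mob (toC κ') z := by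
    have h11' : (κ' 1 1 : ℂ) ≠ 0 := by exact_mod_cast h11
    rw [mob]
    simp only [toC_apply, h10, hdiag, Complex.ofReal_zero, zero_mul, zero_add, Complex.ofReal_div]
    rw [eq_div_iff h11', add_mul, div_mul_cancel₀ _ h11']
    ring
  rw [h1, ← mob_mul _ _ (denom_ne_zero κ' hz), ← mob_mul _ _ (denom_ne_zero A hz), ← map_mul,
    ← map_mul, hκ']
  congr 2
  group

namespace QuasiFuchsian

variable {m : Fin r → ℕ} {Q : QuasiFuchsian g n r m}

namespace IsHalf

variable {G : Subgroup SL(2, ℝ)} {J : ℂ ≃ₜ ℂ} {S T : Set ℂ} {ψ : ℂ ≃L[ℝ] ℂ} {K ε : ℝ}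
  (C : Q.IsHalf G J S T ψ K ε)

include C

/-- If a parabolic generator does not fix `∞`, neither does the corresponding element of the
Fuchsian group. -/
theorem cusp_ne_infty {η : SL(2, ℂ)} (hη : η ∈ Q.Γ) (hη10 : η 1 0 ≠ 0) {A : SL(2, ℝ)} {l : ℝ}
    (hrel : ∀ w ∈ T, Q.J₁ (mob (toC A) (w + l)) = mob η (Q.J₁ (mob (toC A) w))) :
    A 1 0 ≠ 0 := by
  intro hA10
  obtain ⟨w₀, hw₀⟩ := C.halfPlane.infinite.nonempty
  have hdet := det_eq_one_real A
  rw [hA10, mul_zero, sub_zero] at hdet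
  have ha : A 0 0 ≠ 0 := left_ne_zero_of_mul_eq_one hdet
  have hmob : ∀ z, mob (toC A) z = (A 0 0 ^ 2 : ℝ) * z + (A 0 0 * A 0 1 : ℝ) := by
    intro z
    have h11 : A 1 1 = (A 0 0)⁻¹ := eq_inv_of_mul_eq_one_right hdet
    have ha' : (A 0 0 : ℂ) ≠ 0 := by exact_mod_cast ha
    simp only [mob, toC_apply, hA10, h11]
    push_cast
    field_simp
    ring
  have ha2 : ((A 0 0 ^ 2 : ℝ) : ℂ) ≠ 0 := by exact_mod_cast pow_ne_zero 2 ha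
  have hadd : ∀ x : ℝ, w₀ + x ∈ T := fun x => C.halfPlane.mem_of_im hw₀ one_pos (by simp)
  have hN : ∀ b : ℂ, Tendsto (fun N : ℕ => ‖w₀ + (N : ℝ) + b‖) atTop atTop := by
    intro b
    have h1 : Tendsto (fun N : ℕ => ‖((N : ℝ) : ℂ)‖) atTop atTop := by
      simpa using tendsto_natCast_atTop_atTop (R := ℝ)
    refine (tendsto_norm_mul_add (b := w₀ + b) one_ne_zero h1).congr fun N => ?_
    congr 1; ring
  have hx := tendsto_norm_of_homeomorph Q.J₁
    (tendsto_norm_mul_add (b := ((A 0 0 * A 0 1 : ℝ) : ℂ)) ha2 (by simpa only [add_zero] using hN 0))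
  have hy := tendsto_norm_of_homeomorph Q.J₁
    (tendsto_norm_mul_add (b := ((A 0 0 * A 0 1 : ℝ) : ℂ)) ha2 (hN l))
  simp only [← hmob] at hx hy
  have h1 := tendsto_norm_mul_add (b := η 1 1) hη10 hx
  have h2 := tendsto_norm_mul_add (b := -η 0 0) hη10 hy
  -- If $A$ fixed $\infty$, then $x=J_1(A(w_0+N))$ and $y=J_1(A(w_0+N+l))$ would both tend to
  -- $\infty$. But $y=\eta(x)$ means $(cy-a)(cx+d)=-1$, and both factors cannot exceed $1$ in
  -- modulus.
  obtain ⟨N, h1N, h2N⟩ := ((h1.eventually_gt_atTop 1).and (h2.eventually_gt_atTop 1)).exists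
  have hwN := hadd N
  have h3 := hrel _ hwN
  have hd := C.component.denom_ne_zero hη
    (C.mapsTo_J (C.halfPlane.mob_mem A hwN))
  replace h3 := h3.trans (c := (_ / _ : ℂ)) rfl
  rw [eq_div_iff hd] at h3
  have h4 : (η 1 0 * Q.J₁ (mob (toC A) (w₀ + (N : ℝ) + l)) + -η 0 0) *
      (η 1 0 * Q.J₁ (mob (toC A) (w₀ + (N : ℝ))) + η 1 1) = -1 := by
    linear_combination η 1 0 * h3 - det_eq_one η
  have h5 := congrArg norm h4
  rw [norm_mul, norm_neg, norm_one] at h5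
  nlinarith

/-- The map $A$ moves the cusp to $\infty$: $H=J_1\circ A$ intertwines a real translation with
$\eta$, and it keeps the Lipschitz constant because $A$ is a hyperbolic isometry. The side becomes a
vertical ray, and $z_0=J_1(A(\infty))$ is the fixed point of $\eta$. -/
theorem lineIntegrable_cusp {η : SL(2, ℂ)} (hη : η ∈ Q.Γ) {κ : SL(2, ℝ)}
    (hκ : κ.val.IsParabolic) (hmark : ∀ z ∈ U ∪ L, Q.J₁ (mob (toC κ) z) = mob η (Q.J₁ z))
    {A : SL(2, ℝ)} (hfix : act κ (act A OnePoint.infty) = act A OnePoint.infty)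
    {p : ℝ → ℂ} (hp : ∀ t ∈ Ico (0 : ℝ) 1, p t = mob (toC A) (ray t)) :
    LineIntegrable (Q.theta η) fun t => Q.J₁ (ψ (p t)) := by
  -- If $\eta$ fixes $\infty$, the form is identically $0$; the estimates at a finite $z_0$ are
  -- needed only otherwise.
  by_cases hη10 : η 1 0 = 0
  · have h0 : ∀ z v, Q.theta η z v = 0 := by
      intro z v
      simp [theta, mobQuot, (inv_apply η).2.2.1, hη10]
    simp only [LineIntegrable, h0]
    exact integrableOn_zero
  have hT := C.halfPlane
  obtain ⟨l, hl, htrans⟩ := exists_translation hκ hfix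
  have hrel : ∀ w ∈ T, Q.J₁ (mob (toC A) (w + l)) = mob η (Q.J₁ (mob (toC A) w)) := by
    intro w hw
    rw [htrans w (hT.im_ne_zero hw), hmark _ (hT.subset_union (hT.mob_mem A hw))]
  have hA10 := C.cusp_ne_infty hη hη10 hrel
  have hA10' : toC A 1 0 ≠ 0 := by simpa using hA10
  set x₀ : ℂ := toC A 0 0 / toC A 1 0 with hx₀
  set z₀ := Q.J₁ x₀ with hz₀
  have hz₀Ω : z₀ ∉ J '' S := by
    rw [← C.image_eq, hz₀, Q.J₁.injective.mem_set_image]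
    have : x₀ = ((A 0 0 / A 1 0 : ℝ) : ℂ) := by rw [hx₀]; push_cast; rfl
    rw [this]
    exact hT.ofReal_notMem _
  have hadd : ∀ w ∈ T, ∀ x : ℝ, w + x ∈ T := fun w hw x => hT.mem_of_im hw one_pos (by simp)
  have hAlim : ∀ w ∈ T, Tendsto (fun x : ℝ => mob (toC A) (w + x)) (cocompact ℝ) (𝓝 x₀) := by
    intro w hw
    have h1 : Tendsto (fun x : ℝ => ‖(x : ℂ)‖) (cocompact ℝ) atTop :=
      (tendsto_norm_cocompact_atTop (E := ℝ)).congr fun x => (Complex.norm_real x).symm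
    have h2 := tendsto_norm_mul_add (b := toC A 1 0 * (toC A 1 0 * w + toC A 1 1))
      (mul_ne_zero hA10' hA10') h1
    have h3 : Tendsto (fun x : ℝ => (toC A 1 0 * toC A 1 0 * (x : ℂ) +
        toC A 1 0 * (toC A 1 0 * w + toC A 1 1))⁻¹) (cocompact ℝ) (𝓝 0) := by
      rw [tendsto_zero_iff_norm_tendsto_zero]
      simp only [norm_inv]
      exact tendsto_inv_atTop_zero.comp h2
    have h4 := h3.const_sub x₀
    rw [sub_zero] at h4
    refine h4.congr fun x => ?_
    rw [mob_sub_div _ hA10' (denom_ne_zero A (hT.im_ne_zero (hadd w hw x)))]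
    congr 2
    ring
  have hHlim : ∀ w ∈ T, Tendsto (fun x : ℝ => Q.J₁ (mob (toC A) (w + x))) (cocompact ℝ) (𝓝 z₀) :=
    fun w hw => (Q.J₁.continuous.tendsto x₀).comp (hAlim w hw)
  obtain ⟨w₀, hw₀⟩ := hT.infinite.nonempty
  have heq : z₀ * (η 1 0 * z₀ + η 1 1) = η 0 0 * z₀ + η 0 1 := by
    have h1 := hHlim w₀ hw₀
    have h2 := hHlim (w₀ + l) (hadd w₀ hw₀ l)
    refine tendsto_nhds_unique ((h2.mul ((h1.const_mul (η 1 0)).add_const (η 1 1))).congr fun x => ?_)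
      ((h1.const_mul (η 0 0)).add_const (η 0 1))
    rw [add_right_comm, hrel _ (hadd w₀ hw₀ x), mob, div_mul_cancel₀ _
      (C.component.denom_ne_zero hη (C.mapsTo_J (hT.mob_mem A (hadd w₀ hw₀ x))))]
  -- By the limiting equation a zero of the denominator at $z_0$ would also be a zero of the
  -- numerator, impossible for determinant $1$.
  have hd₀ : η 1 0 * z₀ + η 1 1 ≠ 0 := by
    intro h0
    rw [h0, mul_zero] at heq
    have : (1 : ℂ) = 0 := by
      linear_combination (-1 : ℂ) * det_eq_one η + η 0 0 * h0 + η 1 0 * heq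
    exact one_ne_zero this
  have hfixz : mob η z₀ = z₀ := by rw [mob, div_eq_iff hd₀, heq]
  set H : ℂ → ℂ := fun w => Q.J₁ (mob (toC A) w) with hH
  have hHm : MapsTo H T (J '' S) := fun w hw => C.mapsTo_J (hT.mob_mem A hw)
  have hHc : ContDiffOn ℝ 1 H T :=
    C.contDiffOn.comp (contDiffOn_mob A hT) fun w hw => hT.mob_mem A hw
  have hHK : ∀ w ∈ T, Real.exp (Q.phi (H w) / 2) * ‖fderiv ℝ H w‖ ≤ K / |w.im| := by
    intro w hw
    have hw' := hT.mob_mem A hw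
    have hden := denom_ne_zero A (hT.im_ne_zero hw)
    have hD := norm_pos_iff.mpr (mobDeriv_ne_zero hden)
    have h1 := ((C.contDiffOn.differentiableOn one_ne_zero).differentiableAt
      (hT.isOpen.mem_nhds hw')).hasFDerivAt
    have h2 := (hasDerivAt_mob (toC A) w hden).hasFDerivAt.restrictScalars ℝ
    have h3 := (h1.comp w h2).fderiv
    rw [show fderiv ℝ H w = _ from h3]
    have h4 := C.lipschitz _ hw'
    rw [mob_im A (hT.im_ne_zero hw), abs_mul, abs_norm, ← div_div, le_div_iff₀ hD] at h4
    refine le_trans ?_ h4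
    rw [mul_assoc]
    gcongr
    refine (ContinuousLinearMap.opNorm_comp_le _ _).trans (le_of_eq ?_)
    rw [ContinuousLinearMap.norm_restrictScalars, ContinuousLinearMap.norm_toSpanSingleton]
  obtain ⟨M, hM0, hM⟩ := C.component.exists_cusp_bound hT hHc hHm hHK hz₀Ω hη hd₀ hfixz hl hrel hHlim
  have hdinv := denom_inv_ne_zero hd₀
  rw [hfixz] at hdinv
  have hεT : (ε : ℂ) * Complex.I ∈ T := by
    have := C.mapsTo (ray_mem (t := 0) zero_lt_one)
    rw [C.map_ray] at this
    simpa [ray] using this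
  have hint := C.component.integrableOn_cusp (C.component.isContForm_theta hη)
    (C.component.tameAt_theta hz₀Ω hdinv) hz₀Ω hT hHc hHm hHK hM0 hM C.abs_eq hεT
  refine hint.congr_fun (fun t ht => ?_) measurableSet_Ioo
  have hpt : ∀ s ∈ Ioo (0 : ℝ) 1, H (ε * ray s) = Q.J₁ (ψ (p s)) := by
    intro s hs
    rw [hp s (Ioo_subset_Ico_self hs), C.map_mob, C.map_ray]
  have hev : (fun s => H (ε * ray s)) =ᶠ[𝓝 t] fun s => Q.J₁ (ψ (p s)) := by
    filter_upwards [Ioo_mem_nhds ht.1 ht.2] with s hs using hpt s hs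
  simp only
  rw [hpt t ht, hev.deriv_eq]

theorem lineIntegrable_theta {F : Set ℂ} {e : Gen g n r → ℝ → ℂ} {q : ℕ → ℂ}
    (h : IsStandardPolygon Q.Γ₁ Q.gen₁ F e q) (s : Gen g n r) :
    LineIntegrable (Q.theta (Q.gen s)) fun t => Q.J₁ (ψ (e s t)) := by
  by_cases hs : ∃ i, s = .c i
  · obtain ⟨i, rfl⟩ := hs
    obtain ⟨A, hA, hfix, -⟩ := h.cusp i
    exact C.lineIntegrable_cusp (Q.gen_mem _) (Q.fuchsian₁.parabolic i) (Q.marking₁ _) hfix hA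
  · push Not at hs
    obtain ⟨A, l, -, hA, -⟩ := h.geodesic s hs
    exact C.lineIntegrable_geodesic (Q.gen_mem _) hA

end IsHalf

/-! ### The two components and the convergence of the action -/

/-- On $\mathbb U$ the map $J_1$ is holomorphic, hence an isometry of the hyperbolic metrics: the
Lipschitz constant is $1$. -/
theorem isHalf₁ (Q : QuasiFuchsian g n r m) :
    Q.IsHalf Q.Γ₁ Q.J₁ U U (ContinuousLinearEquiv.refl ℝ ℂ) 1 1 where
  component := Q.isComponent₁
  halfPlane := .inl rfl
  image_eq := rfl
  contDiffOn := (Q.holo₁.contDiffOn (IsHalfPlane.isOpen (.inl rfl))).restrict_scalars ℝ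
  lipschitz w hw := by
    have hd := (Q.isComponent₁.analyticAt hw).differentiableAt.hasDerivAt
    have hpos := norm_pos_iff.mpr (Q.isComponent₁.deriv_ne_zero hw)
    rw [Q.isComponent₁.exp_half_phi hw, (hd.hasFDerivAt.restrictScalars ℝ).fderiv,
      ContinuousLinearMap.norm_restrictScalars, ContinuousLinearMap.norm_toSpanSingleton]
    refine le_of_eq ?_
    field_simp
  map_mob _ _ := rfl
  mapsTo _ hz := hz
  abs_eq := abs_one
  map_ray t := by simp

/-- The metric on $\Omega_2$ comes from $J_2$, while the chains are pushed forward by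
$J_1\circ\mathrm{conj}$, which is not conformal in general. The regularity assumed of $J_1$ on
$\mathbb L$ links the two; the sign $-1$ appears because conjugation reverses the imaginary axis. -/
theorem isHalf₂ (Q : QuasiFuchsian g n r m) {K : ℝ} (hC : ContDiffOn ℝ 1 Q.J₁ L)
    (hK : ∀ z ∈ L, Real.exp (Q.phi (Q.J₁ z) / 2) * ‖fderiv ℝ Q.J₁ z‖ ≤ K / |z.im|) :
    Q.IsHalf Q.Γ₂ Q.J₂ L L Complex.conjCLE K (-1) where
  component := Q.isComponent₂
  halfPlane := .inr rfl
  image_eq := Q.image_L.symm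
  contDiffOn := hC
  lipschitz := hK
  map_mob δ z := (mob_conj δ z).symm
  mapsTo z hz := by
    change (conj z).im < 0
    rw [Complex.conj_im]
    exact neg_neg_of_pos hz
  abs_eq := by simp
  map_ray t := by
    rw [ray_eq]
    simp

theorem chainW_mem (Q : QuasiFuchsian g n r m) {x : ℤ × ℕ × SL(2, ℂ) × SL(2, ℂ)}
    (hx : x ∈ chainW Q.gen) : x.2.1 ≤ g ∧ x.2.2.1 ∈ Q.Γ ∧ x.2.2.2 ∈ Q.Γ := by
  have hcomm : ∀ k, comm Q.gen k ∈ Q.Γ := fun k =>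
    Q.Γ.mul_mem (Q.Γ.mul_mem (Q.Γ.mul_mem (Q.gen_mem _) (Q.gen_mem _))
      (Q.Γ.inv_mem (Q.gen_mem _))) (Q.Γ.inv_mem (Q.gen_mem _))
  have hofFn : ∀ {N : ℕ} {f : Fin N → SL(2, ℂ)}, (∀ i, f i ∈ Q.Γ) →
      ∀ y ∈ List.ofFn f, y ∈ Q.Γ := by
    intro N f hf y hy
    obtain ⟨i, rfl⟩ := List.mem_ofFn.mp hy
    exact hf i
  simp only [chainW, List.mem_append, List.mem_flatten, List.mem_ofFn] at hx
  rcases hx with ((⟨_, ⟨k, rfl⟩, hx⟩ | ⟨k, rfl⟩) | ⟨i, rfl⟩) | ⟨j, rfl⟩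
  · simp only [List.mem_cons, List.not_mem_nil, or_false] at hx
    rcases hx with rfl | rfl | rfl
    · exact ⟨k.2.le, Q.gen_mem _, Q.gen_mem _⟩
    · exact ⟨k.2, Q.gen_mem _, Q.gen_mem _⟩
    · exact ⟨k.2, Q.Γ.inv_mem (hcomm k), Q.Γ.mul_mem (Q.gen_mem _) (Q.gen_mem _)⟩
  · exact ⟨le_rfl, Q.Γ.inv_mem (Q.Γ.list_prod_mem fun y hy =>
      hofFn hcomm y (List.mem_of_mem_drop hy)), Q.Γ.inv_mem (hcomm _)⟩
  · exact ⟨le_rfl, Q.Γ.list_prod_mem fun y hy =>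
      hofFn (fun i => Q.gen_mem _) y (List.mem_of_mem_take hy), Q.gen_mem _⟩
  · exact ⟨le_rfl, Q.Γ.mul_mem (Q.Γ.list_prod_mem (hofFn fun i => Q.gen_mem _))
      (Q.Γ.list_prod_mem fun y hy =>
        hofFn (fun i => Q.gen_mem _) y (List.mem_of_mem_take hy)), Q.gen_mem _⟩

theorem IsComponent.integrableOn_fundamentalDomain {G : Subgroup SL(2, ℝ)} {J : ℂ ≃ₜ ℂ}
    {S : Set ℂ} (C : Q.IsComponent G J S) {F : Set ℂ} (hF : IsFundamentalDomain Q.Γ (J '' S) F) :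
    IntegrableOn Q.density F :=
  C.integrableOn_density hF.subset
    (C.lintegral_exp_phi_lt_top hF.subset hF.nullMeasurable hF.ae_disjoint)

theorem actionConverges (Q : QuasiFuchsian g n r m) (hL : Q.IsLipschitzOnL) {F : Set ℂ}
    {e : Gen g n r → ℝ → ℂ} {q : ℕ → ℂ} {P : ℕ → ℝ → ℂ}
    (hF : IsStandardPolygon Q.Γ₁ Q.gen₁ F e q)
    (hP : ∀ k ≤ g, IsContractingPath Q.Γ₁ (q k) (P k)) : Q.ActionConverges F e P := by
  obtain ⟨hC, K, hK⟩ := hL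
  have H₁ := Q.isHalf₁
  have H₂ := Q.isHalf₂ hC hK
  refine ⟨?_, H₂.integrableOn_density hF, H₁.lineIntegrable_theta hF, H₂.lineIntegrable_theta hF,
    fun x hx => ?_, fun x hx => ?_⟩
  · simpa using H₁.integrableOn_density hF
  · obtain ⟨hk, h1, h2⟩ := Q.chainW_mem hx
    exact H₁.lineIntegrable_contracting h1 h2 (hP _ hk)
  · obtain ⟨hk, h1, h2⟩ := Q.chainW_mem hx
    exact H₂.lineIntegrable_contracting h1 h2 (hP _ hk)

end QuasiFuchsian

end Liouville

end

theorem theoremA3 {g n r : ℕ} {m : Fin r → ℕ} (hm : ∀ j, 2 ≤ m j)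
    (hχ : (0 : ℝ) < 2 * (g : ℝ) - 2 + n + ∑ j, (1 - 1 / (m j : ℝ)))
    (hdim : (0 : ℤ) < 3 * (g : ℤ) - 3 + n + r)
    (Q : Liouville.QuasiFuchsian g n r m) :
    ContDiffOn ℝ ∞ Q.phi (Q.Ω₁ ∪ Q.Ω₂) ∧
    (∀ F₁ : Set ℂ, Liouville.IsFundamentalDomain Q.Γ Q.Ω₁ F₁ →
      MeasureTheory.IntegrableOn (fun z => ‖Q.phiZ z‖ ^ 2 + Real.exp (Q.phi z)) F₁) ∧
    (∀ F₂ : Set ℂ, Liouville.IsFundamentalDomain Q.Γ Q.Ω₂ F₂ →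
      MeasureTheory.IntegrableOn (fun z => ‖Q.phiZ z‖ ^ 2 + Real.exp (Q.phi z)) F₂) ∧
    (Q.IsLipschitzOnL →
      ∀ (F : Set ℂ) (e : Liouville.Gen g n r → ℝ → ℂ) (q : ℕ → ℂ) (P : ℕ → ℝ → ℂ),
        Liouville.IsStandardPolygon Q.Γ₁ Q.gen₁ F e q →
        (∀ k ≤ g, Liouville.IsContractingPath Q.Γ₁ (q k) (P k)) →
        ∃! S : ℂ, Q.HasClassicalAction F e P S) := by
  have hΩ₂ : Q.Ω₂ = Q.J₂ '' Liouville.L := Q.image_L.symm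
  have C₁ := Q.isComponent₁
  have C₂ := Q.isComponent₂
  refine ⟨?_, fun F hF => C₁.integrableOn_fundamentalDomain hF, fun F hF => ?_,
    fun hL F e q P hF hP => ?_⟩
  · rw [hΩ₂]
    exact C₁.contDiffOn_phi.union_of_isOpen C₂.contDiffOn_phi C₁.isOpen_image C₂.isOpen_image
  · rw [hΩ₂] at hF
    exact C₂.integrableOn_fundamentalDomain hF
  · exact ⟨_, ⟨Q.actionConverges hL hF hP, rfl⟩, fun S hS => hS.2⟩
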